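/- A real algebraic variety is, up to biregular isomorphism, an algebraic subset of $\mathbb{R}^n$ for some $n$ (this includes all quasiprojective real algebraic varieties), equipped with the sheaf of regular functions, i.e. functions that are locally, in the Zariski topology, quotients of polynomials. It is nonsingular if each of its points is nonsingular; its connected components may have different dimensions. Regular maps are the morphisms of real algebraic varieties. All topological notions refer to the Euclidean topology unless the Zariski topology is mentioned. Let $Y$ be a nonsingular real algebraic variety. A spray for $Y$ is a triple $(E,p,s)$, where $p\colon E\to Y$ is an algebraic $\mathbb{R}$-vector bundle (that is, isomorphic to a Zariski locally trivial algebraic subbundle of a product bundle $Y\times\mathbb{R}^m$) and $s\colon E\to Y$ is a regular map such that $s(0_y)=y$ for all $y\in Y$, where $0_y$ is the zero vector of the fiber $E_y=p^{-1}(y)$. The spray is dominating if $d_{0_y}s(E_y)=T_yY$ for all $y\in Y$, where $E_y=T_{0_y}E_y\subseteq T_{0_y}E$. The variety $Y$ is malleable if it admits a dominating spray. For nonsingular real algebraic varieties $X$ and $Y$, the space $\mathcal{C}^\infty(X,Y)$ of all $\mathcal{C}^\infty$ maps carries the (weak) $\mathcal{C}^\infty$ topology, i.e. the topology of uniform convergence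 in local coordinates, on compact sets, of maps and all their derivatives. A $\mathcal{C}^\infty$ map $f\colon X\to Y$ can be approximated by regular maps in the $\mathcal{C}^\infty$ topology if every neighborhood of $f$ in $\mathcal{C}^\infty(X,Y)$ contains a regular map. **Theorem 4.2.** Let $X$ be a nonsingular real algebraic variety and let $Y$ be a malleable nonsingular real algebraic variety. Then, for a $\mathcal{C}^\infty$ map $f\colon X\to Y$, the following conditions are equivalent: (a) $f$ can be approximated by regular maps in the $\mathcal{C}^\infty$ topology. (b) $f$ is homotopic (through continuous maps) to a regular map $X\to Y$. -/

import Mathlib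

open scoped ContDiff Topology

namespace RealAlg

/-! Real algebraic varieties are represented by algebraic subsets of real affine space `σ → ℝ`
(`σ` finite), with the sheaf of regular functions and the Euclidean topology induced from
`σ → ℝ`; algebraic subsets of `ℝⁿ` represent all (quasi-projective) real algebraic varieties up to
biregular isomorphism. -/

section Algebra

variable {σ τ : Type*}

/-- `V` is the common zero set of a family of real polynomials. -/
def IsAlgebraicSet (V : Set (σ → ℝ)) : Prop :=
  ∃ I : Ideal (MvPolynomial σ ℝ), V = MvPolynomial.zeroLocus ℝ I

/-- The gradient of the polynomial `P` at the point `x`. -/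
noncomputable def gradAt (P : MvPolynomial σ ℝ) (x : σ → ℝ) : σ → ℝ :=
  fun j => MvPolynomial.eval x (MvPolynomial.pderiv j P)

/-- Every point `x` of `V` is nonsingular (in some dimension `|σ| - c`, which may vary with `x`):
in a Zariski neighborhood of `x`, the set `V` is cut out by `c` polynomials that vanish on `V` and
have linearly independent gradients at `x`. -/
def IsNonsingular (V : Set (σ → ℝ)) : Prop :=
  ∀ x ∈ V, ∃ (c : ℕ) (P : Fin c → MvPolynomial σ ℝ),
    (∀ i, P i ∈ MvPolynomial.vanishingIdeal ℝ V) ∧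
    LinearIndependent ℝ (fun i => gradAt (P i) x) ∧
    ∃ Q : MvPolynomial σ ℝ, MvPolynomial.eval x Q ≠ 0 ∧
      ∀ y, MvPolynomial.eval y Q ≠ 0 → (∀ i, MvPolynomial.eval y (P i) = 0) → y ∈ V

/-- The tangent space to `V` at `x`: the vectors annihilated by the differentials at `x` of all
polynomials vanishing on `V`. -/
noncomputable def tangentSpace [Fintype σ] (V : Set (σ → ℝ)) (x : σ → ℝ) :
    Submodule ℝ (σ → ℝ) where
  carrier := {v | ∀ P ∈ MvPolynomial.vanishingIdeal ℝ V, ∑ j, gradAt P x j * v j = 0}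
  zero_mem' := by intro P _; simp
  add_mem' := by
    intro a b ha hb P hP
    simp [mul_add, Finset.sum_add_distrib, ha P hP, hb P hP]
  smul_mem' := by
    intro c a ha P hP
    have h : ∑ j, gradAt P x j * (c • a) j = c * ∑ j, gradAt P x j * a j := by
      rw [Finset.mul_sum]
      exact Finset.sum_congr rfl fun j _ => by simp only [Pi.smul_apply, smul_eq_mul]; ring
    rw [h, ha P hP, mul_zero]

/-- `f` is a regular map from `V` to `τ → ℝ`: every component is, in a Zariski neighborhood of each
point of `V`, a quotient of polynomials. -/
def IsRegularFun {V : Set (σ → ℝ)} (f : V → τ → ℝ) : Prop :=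
  ∀ (j : τ) (x : V), ∃ P Q : MvPolynomial σ ℝ, MvPolynomial.eval (x : σ → ℝ) Q ≠ 0 ∧
    ∀ y : V, MvPolynomial.eval (y : σ → ℝ) Q ≠ 0 →
      f y j = MvPolynomial.eval (y : σ → ℝ) P / MvPolynomial.eval (y : σ → ℝ) Q

/-- A map between subsets of affine spaces is regular. -/
def IsRegularMap {V : Set (σ → ℝ)} {W : Set (τ → ℝ)} (f : V → W) : Prop :=
  IsRegularFun fun x => (f x : τ → ℝ)

/-- An algebraic vector bundle over `Y`, realized as an algebraic vector subbundle of a product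
bundle `Y × ℝᵐ`, `m = dim`: a family of linear subspaces of `ℝᵐ` which is
Zariski locally trivial, that is, has a regular frame `e` over some Zariski neighborhood
`{y ∈ Y | Q y ≠ 0}` of each point. The rank `r` may vary from one neighborhood to another. Every
algebraic vector bundle is by definition isomorphic to one of this form. -/
structure AlgVectorBundle (Y : Set (τ → ℝ)) where
  dim : ℕ
  fiber : Y → Submodule ℝ (Fin dim → ℝ)
  locally_trivial : ∀ y₀ : Y, ∃ (Q : MvPolynomial τ ℝ) (r : ℕ)
    (e : Fin r → ↥(Y ∩ {y | MvPolynomial.eval y Q ≠ 0}) → Fin dim → ℝ),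
    MvPolynomial.eval (y₀ : τ → ℝ) Q ≠ 0 ∧
    (∀ i, IsRegularFun (e i)) ∧
    ∀ y : ↥(Y ∩ {y | MvPolynomial.eval y Q ≠ 0}),
      LinearIndependent ℝ (fun i => e i y) ∧
      Submodule.span ℝ (Set.range fun i => e i y) = fiber ⟨y, y.2.1⟩

namespace AlgVectorBundle

variable {Y : Set (τ → ℝ)} (E : AlgVectorBundle Y)

/-- The total space `{(y, v) | y ∈ Y, v ∈ E_y}`, a subset of affine space. -/
def total : Set (τ ⊕ Fin E.dim → ℝ) :=
  {z | ∃ (y : Y) (v : E.fiber y), z = Sum.elim (y : τ → ℝ) (v : Fin E.dim → ℝ)}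

/-- The point `(y, v)` of the total space; `E.point y 0` is the zero vector over `y`. -/
def point (y : Y) (v : E.fiber y) : E.total :=
  ⟨Sum.elim (y : τ → ℝ) (v : Fin E.dim → ℝ), y, v, rfl⟩

/-- `(E, p, s)` is a spray for `Y`, where `p` is the bundle projection. -/
def IsSpray (s : E.total → Y) : Prop :=
  IsRegularMap s ∧ ∀ y : Y, s (E.point y 0) = y

/-- For every `y ∈ Y` the derivative at `0_y` of `s` maps the fiber `E_y = T_{0_y} E_y` onto
`T_y Y`; this restriction of the derivative of `s` to `E_y` is the derivative of
`s` restricted to `E_y`. -/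
def IsDominating [Fintype τ] (s : E.total → Y) : Prop :=
  ∀ y : Y, LinearMap.range
    (fderiv ℝ (fun v : E.fiber y => (s (E.point y v) : τ → ℝ)) 0 : E.fiber y →ₗ[ℝ] (τ → ℝ)) =
      tangentSpace Y (y : τ → ℝ)

end AlgVectorBundle

/-- `Y` admits a dominating spray. -/
def IsMalleable [Fintype τ] (Y : Set (τ → ℝ)) : Prop :=
  ∃ (E : AlgVectorBundle Y) (s : E.total → Y), E.IsSpray s ∧ E.IsDominating s

end Algebra

section Smooth

variable {σ τ : Type*} [Fintype σ] [Fintype τ]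

/-- The vector-valued function `f` on `X` is of class `C^∞` on the subset `S` of `X`: around each
point of `S` it extends to a `C^∞` map on an open subset of the ambient space. -/
def IsSmoothOn {X : Set (σ → ℝ)} (f : X → τ → ℝ) (S : Set X) : Prop :=
  ∀ x ∈ S, ∃ (U : Set (σ → ℝ)) (F : (σ → ℝ) → τ → ℝ), IsOpen U ∧ (x : σ → ℝ) ∈ U ∧
    ContDiffOn ℝ ∞ F U ∧ ∀ y ∈ S, (y : σ → ℝ) ∈ U → F y = f y

/-- The set of all `C^∞` maps from `X` to `Y`. -/
structure SmoothMap (X : Set (σ → ℝ)) (Y : Set (τ → ℝ)) where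
  toFun : X → Y
  smooth : IsSmoothOn (fun x => (toFun x : τ → ℝ)) Set.univ

/-- A `C^∞` chart on `X` with values in `ℝᵈ`: a homeomorphism from an open subset of `X` onto an
open subset of `ℝᵈ` which is of class `C^∞` together with its inverse. -/
structure SmoothChart (X : Set (σ → ℝ)) (d : ℕ) where
  toHomeo : OpenPartialHomeomorph X (Fin d → ℝ)
  smooth : IsSmoothOn (fun x => toHomeo x) toHomeo.source
  smooth_symm : ContDiffOn ℝ ∞ (fun u => (toHomeo.symm u : σ → ℝ)) toHomeo.target

namespace SmoothMap

variable {X : Set (σ → ℝ)} {Y : Set (τ → ℝ)}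

theorem continuous_toFun (f : SmoothMap X Y) : Continuous f.toFun := by
  refine continuous_induced_rng.2 (continuous_iff_continuousAt.2 fun x => ?_)
  obtain ⟨U, F, hU, hx, hF, h⟩ := f.smooth x (Set.mem_univ x)
  have h1 : ContinuousAt (fun y : X => F y) x :=
    ContinuousAt.comp (f := fun y : X => (y : σ → ℝ)) (g := F)
      (hF.continuousOn.continuousAt (hU.mem_nhds hx)) continuous_subtype_val.continuousAt
  refine h1.congr ?_
  filter_upwards [continuous_subtype_val.continuousAt.preimage_mem_nhds (hU.mem_nhds hx)]
    with y hy using h y (Set.mem_univ y) hy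

/-- The continuous map underlying a `C^∞` map. -/
def toContinuousMap (f : SmoothMap X Y) : C(X, Y) := ⟨f.toFun, f.continuous_toFun⟩

/-- The expression `ψ ∘ f ∘ φ⁻¹` of the map `f` in the charts `φ` and `ψ`. -/
def inCharts (f : SmoothMap X Y) {d e : ℕ} (φ : SmoothChart X d) (ψ : SmoothChart Y e) :
    (Fin d → ℝ) → (Fin e → ℝ) :=
  fun u => ψ.toHomeo (f.toFun (φ.toHomeo.symm u))

/-- The set `N^r(f; φ, ψ, K, ε)` of all `C^∞` maps `g` that map `K` into the domain of `ψ` and whose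
expression in the charts `φ`, `ψ` is `ε`-close on `K` to that of `f`, together with the derivatives
of order at most `r`. -/
def basicNhd (f : SmoothMap X Y) {d e : ℕ} (φ : SmoothChart X d) (ψ : SmoothChart Y e)
    (K : Set X) (r : ℕ) (ε : ℝ) : Set (SmoothMap X Y) :=
  {g | Set.MapsTo g.toFun K ψ.toHomeo.source ∧ ∀ k ≤ r, ∀ x ∈ K,
    ‖iteratedFDeriv ℝ k (f.inCharts φ ψ) (φ.toHomeo x) -
      iteratedFDeriv ℝ k (g.inCharts φ ψ) (φ.toHomeo x)‖ < ε}

/-- The (weak) `C^∞` topology, generated by the sets `N^r(f; φ, ψ, K, ε)` with `r` finite, `ε > 0`,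
and `K` compact, contained in the domain of `φ` and mapped by `f` into the domain of `ψ`. -/
instance : TopologicalSpace (SmoothMap X Y) :=
  TopologicalSpace.generateFrom
    {N | ∃ (f : SmoothMap X Y) (d e : ℕ) (φ : SmoothChart X d) (ψ : SmoothChart Y e)
      (K : Set X) (r : ℕ) (ε : ℝ), IsCompact K ∧ K ⊆ φ.toHomeo.source ∧
        Set.MapsTo f.toFun K ψ.toHomeo.source ∧ 0 < ε ∧ N = f.basicNhd φ ψ K r ε}

end SmoothMap

end Smooth

end RealAlg

open RealAlg

/-! Composing with orthogonal projections onto the fibers turns a dominating spray into a spray `S`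
on a trivial bundle `Y × ℝᴹ` (`IsMalleable.exists_isTrivialSpray`). Domination makes `S` invertible
near the diagonal: there is a smooth `ν`, defined near the diagonal of any given compact subset of
`Y`, with `S y (ν (y, z)) = z` (`IsTrivialSpray.exists_inverse_near_diagonal`). A map `f` close to
`g` on a compact set is thus `S(g, ξ)` there, with `ξ = ν(g, f)` vector-valued. Deforming or
approximating `f` becomes deforming or approximating `ξ`. Since `S` is defined on all of `Y × ℝᴹ`,
replacing `ξ` by a polynomial map gives a regular map on the whole of `X` whenever `g` is regular.

For (b) ⇒ (a), let `H` be a homotopy from a regular map to `f` and `K` a compact set. The times `t`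
at which `H(t, ·)` is a uniform limit on `K` of regular maps form a clopen set, hence all of `[0,
1]` (`exists_isRegularMap_dist_lt_of_homotopic`). So `f = S(g', ν(g', f))` on `K` for a regular
`g'`. Approximating a cutoff of `ν(g', f)` by polynomials with all derivatives approximates `f` in
the `C^∞` sense on `K` (`IsTrivialSpray.exists_tendstoSmoothlyAt`).

For (a) ⇒ (b), every `g` close enough to `f` is homotopic to `f` (`eventually_homotopic`). As `X`
need not be compact while the topology only sees compact sets, `X` is first compressed: the squared
norm has finitely many critical values on `X`, so flowing inwards deforms the identity to a map `κ`
with bounded image (`exists_homotopic_id_bounded`). Then `f ≃ f ∘ κ ≃ g ∘ κ ≃ g`, the middle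
homotopy being `S(g ∘ κ, t ν(g ∘ κ, f ∘ κ))`.

Calculus on `X` and `Y` is done through smooth nearest-point retractions of neighborhoods
(`exists_isSmoothRetraction`). -/

namespace RealAlg

/-! ### Calculus of regular functions. -/

section Regular

variable {σ τ υ : Type*} {V : Set (σ → ℝ)}

/-- The function `f` on `V` is a quotient of polynomials in a Zariski neighborhood of `x`. -/
def RegularAt (f : V → ℝ) (x : V) : Prop :=
  ∃ P Q : MvPolynomial σ ℝ, MvPolynomial.eval (x : σ → ℝ) Q ≠ 0 ∧
    ∀ y : V, MvPolynomial.eval (y : σ → ℝ) Q ≠ 0 →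
      f y = MvPolynomial.eval (y : σ → ℝ) P / MvPolynomial.eval (y : σ → ℝ) Q

theorem RegularAt.congr {f g : V → ℝ} {x : V} (hf : RegularAt f x) (R : MvPolynomial σ ℝ)
    (hR : MvPolynomial.eval (x : σ → ℝ) R ≠ 0)
    (h : ∀ y : V, MvPolynomial.eval (y : σ → ℝ) R ≠ 0 → g y = f y) : RegularAt g x := by
  obtain ⟨P, Q, hQ, hf⟩ := hf
  refine ⟨P * R, Q * R, by simp [hQ, hR], fun y hy => ?_⟩
  simp only [map_mul, mul_ne_zero_iff] at hy ⊢
  rw [h y hy.2, hf y hy.1, mul_div_mul_right _ _ hy.2]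

theorem regularAt_eval (P : MvPolynomial σ ℝ) (x : V) :
    RegularAt (fun y : V => MvPolynomial.eval (y : σ → ℝ) P) x :=
  ⟨P, 1, by simp, by simp⟩

theorem regularAt_const (c : ℝ) (x : V) : RegularAt (fun _ : V => c) x :=
  ⟨MvPolynomial.C c, 1, by simp, by simp⟩

theorem regularAt_coord (i : σ) (x : V) : RegularAt (fun y : V => (y : σ → ℝ) i) x :=
  ⟨MvPolynomial.X i, 1, by simp, by simp⟩

theorem RegularAt.add {f g : V → ℝ} {x : V} (hf : RegularAt f x) (hg : RegularAt g x) :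
    RegularAt (fun y => f y + g y) x := by
  obtain ⟨P, Q, hQ, hf⟩ := hf
  obtain ⟨P', Q', hQ', hg⟩ := hg
  refine ⟨P * Q' + Q * P', Q * Q', by simp [hQ, hQ'], fun y hy => ?_⟩
  simp only [map_mul, map_add, mul_ne_zero_iff] at hy ⊢
  rw [hf y hy.1, hg y hy.2, div_add_div _ _ hy.1 hy.2]

theorem RegularAt.mul {f g : V → ℝ} {x : V} (hf : RegularAt f x) (hg : RegularAt g x) :
    RegularAt (fun y => f y * g y) x := by
  obtain ⟨P, Q, hQ, hf⟩ := hf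
  obtain ⟨P', Q', hQ', hg⟩ := hg
  refine ⟨P * P', Q * Q', by simp [hQ, hQ'], fun y hy => ?_⟩
  simp only [map_mul, mul_ne_zero_iff] at hy ⊢
  rw [hf y hy.1, hg y hy.2, div_mul_div_comm]

theorem RegularAt.inv {f : V → ℝ} {x : V} (hf : RegularAt f x) (hx : f x ≠ 0) :
    RegularAt (fun y => (f y)⁻¹) x := by
  obtain ⟨P, Q, hQ, hf⟩ := hf
  have hP : MvPolynomial.eval (x : σ → ℝ) P ≠ 0 := fun h => hx (by rw [hf x hQ, h, zero_div])
  refine ⟨Q * Q, P * Q, by simp [hQ, hP], fun y hy => ?_⟩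
  simp only [map_mul, mul_ne_zero_iff] at hy ⊢
  rw [hf y hy.2, inv_div, mul_div_mul_right _ _ hy.2]

theorem RegularAt.div {f g : V → ℝ} {x : V} (hf : RegularAt f x) (hg : RegularAt g x)
    (hx : g x ≠ 0) : RegularAt (fun y => f y / g y) x := by
  simpa only [div_eq_mul_inv] using hf.mul (hg.inv hx)

theorem RegularAt.sum {ι : Type*} {s : Finset ι} {f : ι → V → ℝ} {x : V}
    (hf : ∀ i ∈ s, RegularAt (f i) x) : RegularAt (fun y => ∑ i ∈ s, f i y) x := by
  classical
  induction s using Finset.induction_on with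
  | empty => simpa using regularAt_const 0 x
  | insert a s ha ih =>
    simp only [Finset.sum_insert ha]
    exact (hf a (by simp)).add (ih fun i hi => hf i (by simp [hi]))

theorem RegularAt.prod {ι : Type*} {s : Finset ι} {f : ι → V → ℝ} {x : V}
    (hf : ∀ i ∈ s, RegularAt (f i) x) : RegularAt (fun y => ∏ i ∈ s, f i y) x := by
  classical
  induction s using Finset.induction_on with
  | empty => simpa using regularAt_const 1 x
  | insert a s ha ih =>
    simp only [Finset.prod_insert ha]
    exact (hf a (by simp)).mul (ih fun i hi => hf i (by simp [hi]))

theorem RegularAt.det {ι : Type*} [Fintype ι] [DecidableEq ι] {A : V → Matrix ι ι ℝ} {x : V}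
    (hA : ∀ i j, RegularAt (fun y => A y i j) x) : RegularAt (fun y => (A y).det) x := by
  simp only [Matrix.det_apply']
  exact RegularAt.sum fun p _ => (regularAt_const _ _).mul (RegularAt.prod fun i _ => hA _ _)

theorem RegularAt.matrix_inv {ι : Type*} [Fintype ι] [DecidableEq ι] {A : V → Matrix ι ι ℝ} {x : V}
    (hA : ∀ i j, RegularAt (fun y => A y i j) x) (hx : (A x).det ≠ 0) (i j : ι) :
    RegularAt (fun y => (A y)⁻¹ i j) x := by
  simp only [Matrix.inv_def, Ring.inverse_eq_inv', Matrix.smul_apply, smul_eq_mul,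
    Matrix.adjugate_apply]
  refine ((RegularAt.det hA).inv hx).mul (RegularAt.det fun k l => ?_)
  by_cases hk : k = j
  · subst hk
    simpa using regularAt_const _ _
  · simpa [Matrix.updateRow_apply, hk] using hA k l

/-- Polynomials in regular functions are regular. -/
theorem RegularAt.eval {g : V → τ → ℝ} {x : V} (hg : ∀ j, RegularAt (fun y => g y j) x)
    (P : MvPolynomial τ ℝ) : RegularAt (fun y => MvPolynomial.eval (g y) P) x := by
  induction P using MvPolynomial.induction_on with
  | C a => simpa using regularAt_const a x
  | add p q hp hq => simpa using hp.add hq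
  | mul_X p i hp => simpa using hp.mul (hg i)

theorem RegularAt.comp {W : Set (τ → ℝ)} {g : V → W} {f : W → ℝ} {x : V}
    (hg : ∀ j, RegularAt (fun y => (g y : τ → ℝ) j) x) (hf : RegularAt f (g x)) :
    RegularAt (fun y => f (g y)) x := by
  obtain ⟨P, Q, hQ, hf⟩ := hf
  obtain ⟨A, B, hB, hAB⟩ := RegularAt.eval hg Q
  -- `Q ∘ g` is itself only locally a fraction `A / B`; where `A * B` is nonzero, so is `Q ∘ g`.
  refine ((RegularAt.eval hg P).div (RegularAt.eval hg Q) hQ).congr (A * B) ?_ fun y hy => ?_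
  · have := hAB x hB
    simp only at this
    rw [this] at hQ
    simp only [map_mul, mul_ne_zero_iff]
    exact ⟨fun h => hQ (by rw [h, zero_div]), hB⟩
  · simp only [map_mul, mul_ne_zero_iff] at hy
    refine hf _ ?_
    have := hAB y hy.2
    simp only at this
    rw [this]
    exact div_ne_zero hy.1 hy.2

theorem IsRegularMap.comp {V : Set (σ → ℝ)} {W : Set (τ → ℝ)} {Z : Set (υ → ℝ)} {f : W → Z}
    {g : V → W} (hf : IsRegularMap f) (hg : IsRegularMap g) : IsRegularMap fun x => f (g x) :=
  fun j x => RegularAt.comp (f := fun w => (f w : υ → ℝ) j) (fun i => hg i x) (hf j (g x))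

end Regular

/-! ### Polynomials and regular maps as smooth maps; extension to ambient space. -/

section Smooth

variable {σ τ : Type*} [Fintype σ] [Fintype τ] {V : Set (σ → ℝ)}

theorem contDiff_mvPolynomial_eval {n : WithTop ℕ∞} (P : MvPolynomial σ ℝ) :
    ContDiff ℝ n fun x : σ → ℝ => MvPolynomial.eval x P := by
  induction P using MvPolynomial.induction_on with
  | C a => simpa using contDiff_const
  | add p q hp hq => simpa using hp.add hq
  | mul_X p i hp => simpa using hp.mul (contDiff_apply ℝ ℝ i)

theorem fderiv_mvPolynomial_eval (P : MvPolynomial σ ℝ) (x v : σ → ℝ) :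
    fderiv ℝ (fun x : σ → ℝ => MvPolynomial.eval x P) x v = gradAt P x ⬝ᵥ v := by
  have hd : ∀ p : MvPolynomial σ ℝ,
      DifferentiableAt ℝ (fun x : σ → ℝ => MvPolynomial.eval x p) x := fun p =>
    (contDiff_mvPolynomial_eval (n := 1) p).differentiable (by simp) x
  induction P using MvPolynomial.induction_on with
  | C a => simp [gradAt, dotProduct]
  | add p q hp hq =>
    simp only [map_add]
    rw [fderiv_fun_add (hd p) (hd q), add_apply, hp, hq]
    simp [gradAt, dotProduct, add_mul, Finset.sum_add_distrib]
  | mul_X p i hp =>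
    have hi : DifferentiableAt ℝ (fun x : σ → ℝ => x i) x := differentiableAt_apply i x
    simp only [map_mul, MvPolynomial.eval_X]
    rw [fderiv_fun_mul (hd p) hi, (hasFDerivAt_apply i x).fderiv]
    classical
    simp only [add_apply, smul_apply, hp,
      ContinuousLinearMap.proj_apply, smul_eq_mul]
    simp only [gradAt, dotProduct, Derivation.leibniz, MvPolynomial.pderiv_X, smul_eq_mul, map_add,
      map_mul, MvPolynomial.eval_X, add_mul, Finset.sum_add_distrib, Finset.mul_sum]
    congr 1
    · simp [Pi.single_apply, ite_mul, apply_ite]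
    · exact Finset.sum_congr rfl fun j _ => by ring

theorem IsRegularFun.isSmoothOn {f : V → τ → ℝ} (hf : IsRegularFun f) :
    IsSmoothOn f Set.univ := by
  intro x _
  choose P Q hQ h using fun j => hf j x
  refine ⟨⋂ j, {y | MvPolynomial.eval y (Q j) ≠ 0},
    fun y j => MvPolynomial.eval y (P j) / MvPolynomial.eval y (Q j), ?_, ?_, ?_, ?_⟩
  · exact isOpen_iInter_of_finite fun j =>
      isOpen_ne_fun (MvPolynomial.continuous_eval _) continuous_const
  · exact Set.mem_iInter.2 hQ
  · refine contDiffOn_pi.2 fun j => ?_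
    exact (contDiff_mvPolynomial_eval _).contDiffOn.div (contDiff_mvPolynomial_eval _).contDiffOn
      fun y hy => Set.mem_iInter.1 hy j
  · intro y _ hy
    exact funext fun j => (h j y (Set.mem_iInter.1 hy j)).symm

/-- The extension by zero of a function on a subset of affine space. -/
noncomputable def extendZero (f : V → τ → ℝ) : (σ → ℝ) → τ → ℝ :=
  Function.extend Subtype.val f 0

omit [Fintype σ] [Fintype τ] in
@[simp]
theorem extendZero_coe (f : V → τ → ℝ) (x : V) : extendZero f x = f x :=
  Subtype.val_injective.extend_apply _ _ _

omit [Fintype σ] [Fintype τ] in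
theorem extendZero_of_mem (f : V → τ → ℝ) {x : σ → ℝ} (hx : x ∈ V) :
    extendZero f x = f ⟨x, hx⟩ :=
  extendZero_coe f ⟨x, hx⟩

/-- The values of `extendZero f` off `V` are never seen, because `u` lands in `V`; near each point a
smooth local extension can be used instead. With `u` a retraction onto `V`, this produces smooth
ambient extensions. -/
theorem IsSmoothOn.contDiffOn_comp {f : V → τ → ℝ} (hf : IsSmoothOn f Set.univ) {E : Type*}
    [NormedAddCommGroup E] [NormedSpace ℝ E] {u : E → σ → ℝ} {O : Set E} (hO : IsOpen O)
    (hu : ContDiffOn ℝ ∞ u O) (hV : Set.MapsTo u O V) :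
    ContDiffOn ℝ ∞ (fun x => extendZero f (u x)) O := by
  intro x hx
  obtain ⟨U, F, hU, hxU, hF, h⟩ := hf ⟨u x, hV hx⟩ (Set.mem_univ _)
  have hux := hu.contDiffAt (hO.mem_nhds hx)
  have h1 : ContDiffAt ℝ ∞ (fun y => F (u y)) x :=
    (hF.contDiffAt (hU.mem_nhds hxU)).comp x hux
  refine (h1.congr_of_eventuallyEq ?_).contDiffWithinAt
  filter_upwards [hO.mem_nhds hx, hux.continuousAt.preimage_mem_nhds (hU.mem_nhds hxU)] with y hy hyU
  rw [extendZero_of_mem f (hV hy), h ⟨u y, hV hy⟩ (Set.mem_univ _) hyU]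

end Smooth

/-! ### Orthogonal projection onto the fibers of an algebraic vector bundle. -/

section Projection

variable {τ : Type*} {Y : Set (τ → ℝ)}

-- The Gram matrix of a linearly independent family is positive definite, hence invertible, so the
-- projection onto the span is a rational expression in the frame. This is what makes it regular
-- over a regular frame.
open Matrix in
theorem frame_orthogonal_projection {r d : ℕ} {e : Matrix (Fin r) (Fin d) ℝ}
    (he : LinearIndependent ℝ fun i => e i) :
    (e * eᵀ).det ≠ 0 ∧ ∀ v : Fin d → ℝ,
      ((e * eᵀ)⁻¹ *ᵥ (e *ᵥ v)) ᵥ* e ∈ Submodule.span ℝ (Set.range fun i => e i) ∧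
      ∀ w ∈ Submodule.span ℝ (Set.range fun i => e i),
        (v - ((e * eᵀ)⁻¹ *ᵥ (e *ᵥ v)) ᵥ* e) ⬝ᵥ w = 0 := by
  have hdet : (e * eᵀ).det ≠ 0 := by
    have := (Matrix.PosDef.mul_conjTranspose_self (A := e)
      (Matrix.vecMul_injective_iff.2 he)).det_pos
    simpa using this.ne'
  refine ⟨hdet, fun v => ⟨?_, fun w hw => ?_⟩⟩
  · rw [Matrix.vecMul_eq_sum]
    exact Submodule.sum_mem _ fun i _ => Submodule.smul_mem _ _ (Submodule.subset_span ⟨i, rfl⟩)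
  · have h0 : e *ᵥ (v - ((e * eᵀ)⁻¹ *ᵥ (e *ᵥ v)) ᵥ* e) = 0 := by
      rw [Matrix.mulVec_sub, ← Matrix.mulVec_transpose, Matrix.mulVec_mulVec, Matrix.mulVec_mulVec,
        Matrix.mul_nonsing_inv _ (isUnit_iff_ne_zero.2 hdet), Matrix.one_mulVec, sub_self]
    induction hw using Submodule.span_induction with
    | mem w hw =>
      obtain ⟨i, rfl⟩ := hw
      rw [dotProduct_comm]
      exact congrFun h0 i
    | zero => simp
    | add a b _ _ ha hb => rw [dotProduct_add, ha, hb, add_zero]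
    | smul c a _ ha => rw [dotProduct_smul, ha, smul_zero]

namespace AlgVectorBundle

variable (E : AlgVectorBundle Y)

theorem exists_orthogonal_projection (y : Y) (v : Fin E.dim → ℝ) :
    ∃ p : E.fiber y, ∀ w ∈ E.fiber y, (v - (p : Fin E.dim → ℝ)) ⬝ᵥ w = 0 := by
  obtain ⟨Q, r, e, hQ, -, h⟩ := E.locally_trivial y
  obtain ⟨hli, hsp⟩ := h ⟨y, y.2, hQ⟩
  obtain ⟨-, h2⟩ := frame_orthogonal_projection
    (e := Matrix.of fun i => e i ⟨y, y.2, hQ⟩) hli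
  refine ⟨⟨_, hsp ▸ (h2 v).1⟩, fun w hw => (h2 v).2 w ?_⟩
  rw [← hsp] at hw
  exact hw

/-- The orthogonal projection onto the fiber of `E` over `y`. -/
noncomputable def proj (y : Y) (v : Fin E.dim → ℝ) : E.fiber y :=
  (E.exists_orthogonal_projection y v).choose

/-- Two candidates differ by a vector of the fiber that is orthogonal to the fiber, hence to itself.
-/
theorem proj_eq {y : Y} {v p : Fin E.dim → ℝ} (hp : p ∈ E.fiber y)
    (h : ∀ w ∈ E.fiber y, (v - p) ⬝ᵥ w = 0) : (E.proj y v : Fin E.dim → ℝ) = p := by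
  have h1 := (E.exists_orthogonal_projection y v).choose_spec
  have hm : (E.proj y v : Fin E.dim → ℝ) - p ∈ E.fiber y := sub_mem (E.proj y v).2 hp
  have h2 := h1 _ hm
  have h3 := h _ hm
  rw [← sub_eq_zero, ← dotProduct_self_eq_zero]
  have : (E.proj y v : Fin E.dim → ℝ) - p = (v - p) - (v - E.proj y v) := by abel
  nth_rewrite 1 [this]
  rw [sub_dotProduct, h3]
  exact (zero_sub _).trans (neg_eq_zero.2 h2)

theorem proj_coe (y : Y) (v : E.fiber y) : E.proj y v = v :=
  Subtype.ext (E.proj_eq v.2 fun w _ => by simp)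

/-- The product `Y × ℝᴹ` as a subset of affine space. -/
def _root_.RealAlg.prodAffine (Y : Set (τ → ℝ)) (M : ℕ) : Set (τ ⊕ Fin M → ℝ) :=
  {z | (fun i => z (Sum.inl i)) ∈ Y}

open Matrix in
theorem regularAt_proj (z : prodAffine Y E.dim) (k : Fin E.dim) :
    RegularAt (fun z : prodAffine Y E.dim =>
      (E.proj ⟨_, z.2⟩ (fun i => (z : τ ⊕ Fin E.dim → ℝ) (Sum.inr i)) : Fin E.dim → ℝ) k) z := by
  classical
  set y₀ : Y := ⟨_, z.2⟩ with hy₀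
  obtain ⟨Q, r, e, hQ, hreg, h⟩ := E.locally_trivial y₀
  -- The frame is extended by zero to all of `Y`, so that regularity at a point can be discussed
  -- without changing the domain.
  let e' : Y → Matrix (Fin r) (Fin E.dim) ℝ := fun y =>
    if hy : MvPolynomial.eval (y : τ → ℝ) Q ≠ 0 then Matrix.of fun i => e i ⟨y, y.2, hy⟩ else 0
  have he' : ∀ i j, RegularAt (fun y => e' y i j) y₀ := by
    intro i j
    obtain ⟨A, B, hB, hAB⟩ := hreg i j ⟨y₀, y₀.2, hQ⟩
    refine RegularAt.congr (f := fun y : Y => MvPolynomial.eval (y : τ → ℝ) A /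
      MvPolynomial.eval (y : τ → ℝ) B) ⟨A, B, hB, fun y _ => rfl⟩ (B * Q) (by simp [hB, hQ])
      fun y hy => ?_
    simp only [map_mul, mul_ne_zero_iff] at hy
    simp only [e', dif_pos hy.2, Matrix.of_apply]
    exact hAB ⟨y, y.2, hy.2⟩ hy.1
  let b : prodAffine Y E.dim → Y := fun z => ⟨_, z.2⟩
  have hb : ∀ i, RegularAt (fun z => (b z : τ → ℝ) i) z := fun i => regularAt_coord (Sum.inl i) z
  have hE : ∀ i j, RegularAt (fun z => e' (b z) i j) z := fun i j =>
    RegularAt.comp hb (he' i j)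
  have hG : ∀ i j, RegularAt (fun z => (e' (b z) * (e' (b z))ᵀ) i j) z := fun i j => by
    simp only [Matrix.mul_apply, Matrix.transpose_apply]
    exact RegularAt.sum fun l _ => (hE _ _).mul (hE _ _)
  have key : ∀ y : Y, MvPolynomial.eval (y : τ → ℝ) Q ≠ 0 →
      (e' y * (e' y)ᵀ).det ≠ 0 ∧ ∀ v, (E.proj y v : Fin E.dim → ℝ) =
        ((e' y * (e' y)ᵀ)⁻¹ *ᵥ (e' y *ᵥ v)) ᵥ* e' y := by
    intro y hy
    obtain ⟨hli, hsp⟩ := h ⟨y, y.2, hy⟩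
    have hey : e' y = Matrix.of fun i => e i ⟨y, y.2, hy⟩ := dif_pos hy
    rw [hey]
    obtain ⟨h1, h2⟩ := frame_orthogonal_projection
      (e := Matrix.of fun i => e i ⟨y, y.2, hy⟩) hli
    refine ⟨h1, fun v => E.proj_eq (hsp ▸ (h2 v).1) fun w hw => (h2 v).2 w ?_⟩
    rw [← hsp] at hw
    exact hw
  have hmain : RegularAt (fun z : prodAffine Y E.dim =>
      (((e' (b z) * (e' (b z))ᵀ)⁻¹ *ᵥ (e' (b z) *ᵥ fun i => (z : τ ⊕ Fin E.dim → ℝ) (Sum.inr i)))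
        ᵥ* e' (b z)) k) z := by
    simp only [Matrix.vecMul, Matrix.mulVec, dotProduct]
    refine RegularAt.sum fun i _ => (RegularAt.sum fun j _ => ?_).mul (hE _ _)
    refine (RegularAt.matrix_inv hG (key y₀ hQ).1 i j).mul (RegularAt.sum fun l _ => ?_)
    exact (hE _ _).mul (regularAt_coord _ _)
  refine hmain.congr (MvPolynomial.rename Sum.inl Q) ?_ fun z hz => ?_
  · rw [MvPolynomial.eval_rename]
    exact hQ
  · rw [MvPolynomial.eval_rename] at hz
    exact congrFun ((key (b z) hz).2 _) k

end AlgVectorBundle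

end Projection

/-! ### Reduction to sprays on trivial bundles. -/

section Spray

variable {σ τ : Type*} [Fintype σ] [Fintype τ]

/-- `S` is a dominating spray on the trivial bundle `Y × ℝᴹ`. -/
structure IsTrivialSpray {Y : Set (τ → ℝ)} {M : ℕ} (S : Y → (Fin M → ℝ) → Y) : Prop where
  regular : IsRegularMap fun z : prodAffine Y M =>
    S ⟨_, z.2⟩ fun i => (z : τ ⊕ Fin M → ℝ) (Sum.inr i)
  zero : ∀ y, S y 0 = y
  dominating : ∀ y : Y, ∀ t ∈ tangentSpace Y (y : τ → ℝ),
    ∃ v, fderiv ℝ (fun v => (S y v : τ → ℝ)) 0 v = t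

namespace IsTrivialSpray

variable {Y : Set (τ → ℝ)} {M : ℕ} {S : Y → (Fin M → ℝ) → Y}

omit [Fintype σ] in
theorem regular_comp (hS : IsTrivialSpray S) {X : Set (σ → ℝ)} {g : X → Y} (hg : IsRegularMap g)
    {p : X → Fin M → ℝ} (hp : IsRegularFun p) : IsRegularMap fun x => S (g x) (p x) := by
  let q : X → prodAffine Y M := fun x => ⟨Sum.elim (g x : τ → ℝ) (p x), (g x).2⟩
  have hq : IsRegularMap q := by
    rintro (i | i) x
    · exact hg i x
    · exact hp i x
  exact IsRegularMap.comp hS.regular hq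

/-- The spray composed with maps `a` to `Y` and `b` to `ℝᴹ`, as an ambient function. -/
theorem contDiffOn_comp (hS : IsTrivialSpray S) {E : Type*} [NormedAddCommGroup E]
    [NormedSpace ℝ E] {O : Set E} (hO : IsOpen O) {a : E → τ → ℝ} {b : E → Fin M → ℝ}
    (ha : ContDiffOn ℝ ∞ a O) (hb : ContDiffOn ℝ ∞ b O) (haY : Set.MapsTo a O Y) :
    ContDiffOn ℝ ∞ (fun x => extendZero (fun y => (S y (b x) : τ → ℝ)) (a x)) O := by
  have h1 := (IsRegularFun.isSmoothOn hS.regular).contDiffOn_comp hO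
    (u := fun x => Sum.elim (a x) (b x)) (contDiffOn_pi.2 (by
      rintro (i | i)
      · exact contDiffOn_pi.1 ha i
      · exact contDiffOn_pi.1 hb i)) (fun x hx => haY hx)
  refine h1.congr fun x hx => ?_
  rw [extendZero_of_mem _ (haY hx), extendZero_of_mem _ (show _ ∈ prodAffine Y M from haY hx)]
  rfl

theorem contDiff_fiber (hS : IsTrivialSpray S) (y : Y) :
    ContDiff ℝ ∞ fun v => (S y v : τ → ℝ) := by
  rw [← contDiffOn_univ]
  simpa using hS.contDiffOn_comp isOpen_univ (a := fun _ => (y : τ → ℝ)) (b := id)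
    contDiffOn_const contDiffOn_id (fun _ _ => y.2)

end IsTrivialSpray

/-- The new spray is `s` after orthogonal projection `ℝᵐ → E_y`. The projection fixes `E_y`, so the
derivative at zero keeps every value taken on `E_y`, and domination survives. The gain is that spray
parameters become plain vectors, which polynomials can approximate. -/
theorem IsMalleable.exists_isTrivialSpray {Y : Set (τ → ℝ)} (hY : IsMalleable Y) :
    ∃ (M : ℕ) (S : Y → (Fin M → ℝ) → Y), IsTrivialSpray S := by
  obtain ⟨E, s, ⟨hreg, hzero⟩, hdom⟩ := hY
  let S : Y → (Fin E.dim → ℝ) → Y := fun y v => s (E.point y (E.proj y v))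
  have hSreg : IsRegularMap fun z : prodAffine Y E.dim =>
      S ⟨_, z.2⟩ fun i => (z : τ ⊕ Fin E.dim → ℝ) (Sum.inr i) := by
    refine IsRegularMap.comp hreg (g := fun z : prodAffine Y E.dim =>
      E.point ⟨_, z.2⟩ (E.proj ⟨_, z.2⟩ fun i => (z : τ ⊕ Fin E.dim → ℝ) (Sum.inr i))) ?_
    rintro (i | i) z
    · exact regularAt_coord (Sum.inl i) z
    · exact E.regularAt_proj z i
  have hS0 : ∀ y, S y 0 = y := fun y => by
    have : E.proj y 0 = 0 := E.proj_coe y 0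
    simp only [S, this, hzero]
  refine ⟨E.dim, S, hSreg, hS0, fun y t ht => ?_⟩
  have hsm : ContDiff ℝ ∞ fun v => (S y v : τ → ℝ) := by
    rw [← contDiffOn_univ]
    have h1 := (IsRegularFun.isSmoothOn hSreg).contDiffOn_comp (E := Fin E.dim → ℝ) isOpen_univ
      (u := fun x => Sum.elim (y : τ → ℝ) x) (contDiffOn_pi.2 (by
        rintro (i | i)
        · exact contDiffOn_const
        · exact contDiffOn_pi.1 contDiffOn_id i)) (fun x _ => y.2)
    refine h1.congr fun x _ => ?_
    rw [extendZero_of_mem _ (show _ ∈ prodAffine Y E.dim from y.2)]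
    rfl
  rw [← hdom y] at ht
  obtain ⟨v, hv⟩ := ht
  refine ⟨v, ?_⟩
  rw [← hv]
  have hcomp : (fun v : E.fiber y => (s (E.point y v) : τ → ℝ)) =
      (fun v => (S y v : τ → ℝ)) ∘ (E.fiber y).subtypeL := by
    funext w
    simp [S, E.proj_coe]
  rw [hcomp]
  have h1 : HasFDerivAt (fun v => (S y v : τ → ℝ))
      (fderiv ℝ (fun v => (S y v : τ → ℝ)) 0) ((E.fiber y).subtypeL 0) := by
    rw [map_zero]
    exact ((hsm.differentiable (by simp)) 0).hasFDerivAt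
  have h2 := (h1.comp (0 : E.fiber y) (E.fiber y).subtypeL.hasFDerivAt).fderiv
  exact (DFunLike.congr_fun h2 v).symm

end Spray

end RealAlg

namespace RealAlg

/-! ### A smooth inverse function theorem. -/

section InverseFunction

/-- Smooth inverse function theorem, with smoothness of the inverse on its whole domain. -/
theorem exists_smooth_local_inverse {E F : Type*} [NormedAddCommGroup E] [NormedSpace ℝ E]
    [CompleteSpace E] [NormedAddCommGroup F] [NormedSpace ℝ F] {f : E → F} {U : Set E}
    (hU : IsOpen U) (hf : ContDiffOn ℝ ∞ f U) {a : E} (ha : a ∈ U) {f' : E ≃L[ℝ] F}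
    (hf' : HasFDerivAt f (f' : E →L[ℝ] F) a) :
    ∃ e : OpenPartialHomeomorph E F, a ∈ e.source ∧ e.source ⊆ U ∧ (∀ x, e x = f x) ∧
      ContDiffOn ℝ ∞ e.symm e.target := by
  have hfa : ContDiffAt ℝ 1 f a := (hf.contDiffAt (hU.mem_nhds ha)).of_le (by simp)
  let e₀ := hfa.toOpenPartialHomeomorph f hf' (by simp)
  have hcont : ContinuousOn (fderiv ℝ f) U := hf.continuousOn_fderiv_of_isOpen hU (by simp)
  -- Invertible operators form an open set; restricting to points with invertible derivative makes
  -- the inverse smooth on its whole domain and not just at `f a`.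
  let W : Set E := U ∩ fderiv ℝ f ⁻¹' Set.range ((↑) : (E ≃L[ℝ] F) → E →L[ℝ] F)
  have hW : IsOpen W := hcont.isOpen_inter_preimage hU ContinuousLinearEquiv.isOpen
  refine ⟨e₀.restrOpen W hW, ?_, ?_, fun x => rfl, ?_⟩
  · rw [OpenPartialHomeomorph.restrOpen_source]
    exact ⟨hfa.mem_toOpenPartialHomeomorph_source hf' (by simp), ha, f', hf'.fderiv.symm⟩
  · rw [OpenPartialHomeomorph.restrOpen_source]
    exact fun x hx => hx.2.1
  · intro y hy
    have hx := (e₀.restrOpen W hW).map_target hy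
    rw [OpenPartialHomeomorph.restrOpen_source] at hx
    obtain ⟨-, hxU, g, hg⟩ := hx
    have hd : HasFDerivAt f (g : E →L[ℝ] F) ((e₀.restrOpen W hW).symm y) := by
      rw [hg]
      exact ((hf.contDiffAt (hU.mem_nhds hxU)).differentiableAt (by simp)).hasFDerivAt
    exact ((e₀.restrOpen W hW).contDiffAt_symm hy hd
      (hf.contDiffAt (hU.mem_nhds hxU))).contDiffWithinAt

end InverseFunction

/-! ### Smooth retraction of a neighborhood onto a nonsingular algebraic set. -/

section Retraction

variable {σ : Type*} [Fintype σ] {V : Set (σ → ℝ)}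

/-- `r` is a smooth retraction onto `V` of its open neighborhood `O`, whose derivative is the
identity on tangent vectors. -/
structure IsSmoothRetraction (V O : Set (σ → ℝ)) (r : (σ → ℝ) → σ → ℝ) : Prop where
  isOpen : IsOpen O
  subset : V ⊆ O
  contDiffOn : ContDiffOn ℝ ∞ r O
  mapsTo : Set.MapsTo r O V
  apply_eq : ∀ y ∈ V, r y = y
  fderiv_apply : ∀ y ∈ V, ∀ v ∈ tangentSpace V y, fderiv ℝ r y v = v

omit [Fintype σ] in
theorem IsAlgebraicSet.isClosed (hV : IsAlgebraicSet V) : IsClosed V := by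
  obtain ⟨I, rfl⟩ := hV
  have : MvPolynomial.zeroLocus ℝ I = ⋂ p ∈ I, {x : σ → ℝ | MvPolynomial.eval x p = 0} := by
    ext x
    simp [MvPolynomial.mem_zeroLocus_iff, MvPolynomial.aeval_eq_eval]
  rw [this]
  exact isClosed_biInter fun p _ =>
    isClosed_eq (MvPolynomial.continuous_eval p) continuous_const

/-- The norm on `σ → ℝ` is the supremum norm, whereas nearest points and orthogonality are Euclidean
and expressed by `⬝ᵥ`; this compares the two. -/
theorem norm_sq_le_dotProduct_self (w : σ → ℝ) : ‖w‖ ^ 2 ≤ w ⬝ᵥ w := by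
  have h0 : 0 ≤ w ⬝ᵥ w := Finset.sum_nonneg fun i _ => mul_self_nonneg _
  have : ‖w‖ ≤ Real.sqrt (w ⬝ᵥ w) := by
    refine (pi_norm_le_iff_of_nonneg (Real.sqrt_nonneg _)).2 fun i => ?_
    refine Real.le_sqrt_of_sq_le ?_
    rw [Real.norm_eq_abs, sq_abs, sq]
    exact Finset.single_le_sum (f := fun i => w i * w i) (fun i _ => mul_self_nonneg _)
      (Finset.mem_univ i)
  calc ‖w‖ ^ 2 ≤ Real.sqrt (w ⬝ᵥ w) ^ 2 := by gcongr
    _ = _ := Real.sq_sqrt h0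

theorem exists_nearest_point (hV : IsClosed V) (hne : V.Nonempty) (z : σ → ℝ) :
    ∃ p ∈ V, ∀ q ∈ V, (z - p) ⬝ᵥ (z - p) ≤ (z - q) ⬝ᵥ (z - q) := by
  obtain ⟨q₀, hq₀⟩ := hne
  set R := Real.sqrt ((z - q₀) ⬝ᵥ (z - q₀))
  have hcomp : IsCompact (V ∩ Metric.closedBall z R) := (isCompact_closedBall z R).inter_left hV
  have hnear : ∀ q, (z - q) ⬝ᵥ (z - q) ≤ (z - q₀) ⬝ᵥ (z - q₀) → q ∈ Metric.closedBall z R := by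
    intro q hq
    rw [Metric.mem_closedBall, dist_comm, dist_eq_norm]
    exact Real.le_sqrt_of_sq_le ((norm_sq_le_dotProduct_self _).trans hq)
  obtain ⟨p, hp, hmin⟩ := hcomp.exists_isMinOn ⟨q₀, hq₀, hnear q₀ le_rfl⟩
    (f := fun q => (z - q) ⬝ᵥ (z - q)) (by unfold dotProduct; fun_prop)
  refine ⟨p, hp.1, fun q hq => ?_⟩
  by_cases h : (z - q) ⬝ᵥ (z - q) ≤ (z - q₀) ⬝ᵥ (z - q₀)
  · exact hmin ⟨hq, hnear q h⟩
  · exact (hmin ⟨hq₀, hnear q₀ le_rfl⟩).trans (not_le.1 h).le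

/-- Lagrange multipliers: the difference to a nearest point is a combination of gradients. -/
theorem exists_multipliers_of_nearest {c : ℕ} {P : Fin c → MvPolynomial σ ℝ}
    {Q : MvPolynomial σ ℝ}
    (hQ : ∀ y, MvPolynomial.eval y Q ≠ 0 → (∀ i, MvPolynomial.eval y (P i) = 0) → y ∈ V)
    {z p : σ → ℝ} (hp : ∀ i, MvPolynomial.eval p (P i) = 0) (hpQ : MvPolynomial.eval p Q ≠ 0)
    (hli : LinearIndependent ℝ fun i => gradAt (P i) p)
    (hmin : ∀ q ∈ V, (z - p) ⬝ᵥ (z - p) ≤ (z - q) ⬝ᵥ (z - q)) :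
    ∃ a : Fin c → ℝ, z - p = ∑ i, a i • gradAt (P i) p := by
  classical
  let N : MvPolynomial σ ℝ := ∑ j, (MvPolynomial.C (z j) - MvPolynomial.X j) ^ 2
  have hN : ∀ q, MvPolynomial.eval q N = (z - q) ⬝ᵥ (z - q) := fun q => by
    simp [N, dotProduct, sq]
  have hgrad : gradAt N p = (-2 : ℝ) • (z - p) := by
    funext j
    simp only [gradAt, N, map_sum, Derivation.leibniz_pow, map_sub, MvPolynomial.pderiv_C,
      MvPolynomial.pderiv_X, Pi.single_apply]
    simp [apply_ite]
    ring
  have hs : ∀ R : MvPolynomial σ ℝ, HasStrictFDerivAt (fun x => MvPolynomial.eval x R)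
      (fderiv ℝ (fun x => MvPolynomial.eval x R) p) p := fun R =>
    (contDiff_mvPolynomial_eval (n := 1) R).contDiffAt.hasStrictFDerivAt (by simp)
  have hext : IsLocalExtrOn (fun x => MvPolynomial.eval x N)
      {x | ∀ i, MvPolynomial.eval x (P i) = MvPolynomial.eval p (P i)} p := by
    refine Or.inl ?_
    have : ∀ᶠ x in 𝓝 p, MvPolynomial.eval x Q ≠ 0 :=
      (MvPolynomial.continuous_eval Q).continuousAt.eventually_ne hpQ
    filter_upwards [mem_nhdsWithin_of_mem_nhds this, self_mem_nhdsWithin] with x hx hxP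
    simp only [hN]
    exact hmin x (hQ x hx fun i => (hxP i).trans (hp i))
  obtain ⟨Λ, Λ₀, hne, h⟩ := hext.exists_multipliers_of_hasStrictFDerivAt
    (f := fun i x => MvPolynomial.eval x (P i)) (fun i => hs (P i)) (hs N)
  have h2 : ∑ i, Λ i • gradAt (P i) p = (2 * Λ₀) • (z - p) := by
    refine dotProduct_eq _ _ fun v => ?_
    have := DFunLike.congr_fun h v
    simp only [add_apply, sum_apply, smul_apply, fderiv_mvPolynomial_eval, hgrad,
      zero_apply] at this
    simp only [sum_dotProduct, smul_dotProduct, smul_eq_mul] at this ⊢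
    linarith
  -- If the multiplier of the distance vanished, the others would give a linear relation between the
  -- independent gradients.
  have hΛ₀ : Λ₀ ≠ 0 := by
    rintro rfl
    rw [mul_zero, zero_smul] at h2
    have := Fintype.linearIndependent_iff.1 hli Λ h2
    exact hne (Prod.ext (funext this) rfl)
  refine ⟨fun i => (2 * Λ₀)⁻¹ * Λ i, ?_⟩
  simp only [fun i => mul_smul (2 * Λ₀)⁻¹ (Λ i) (gradAt (P i) p), ← Finset.smul_sum]
  rw [h2, inv_smul_smul₀ (mul_ne_zero two_ne_zero hΛ₀)]

-- By Lagrange multipliers, a nearest point `p` to `z` satisfies `Θ(p, a) = (z, 0)`, where `Θ(p, a)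
-- = (p + ∑ aᵢ ∇Pᵢ(p), P(p))`. As `Θ` is a local diffeomorphism at `(y₀, 0)`, `p` is the first
-- component of `Θ⁻¹(z, 0)`, which is smooth in `z`.
open Matrix in
theorem exists_local_nearest_point (hns : IsNonsingular V) {y₀ : σ → ℝ} (hy₀ : y₀ ∈ V) :
    ∃ (U : Set (σ → ℝ)) (π : (σ → ℝ) → σ → ℝ), IsOpen U ∧ y₀ ∈ U ∧ ContDiffOn ℝ ∞ π U ∧
      (∀ z ∈ U, ∀ p ∈ V, (∀ q ∈ V, (z - p) ⬝ᵥ (z - p) ≤ (z - q) ⬝ᵥ (z - q)) → p = π z) ∧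
      ∀ v ∈ tangentSpace V y₀, fderiv ℝ π y₀ v = v := by
  obtain ⟨c, P, hPV, hli, Q, hQ₀, hQ⟩ := hns y₀ hy₀
  have hPV' : ∀ y ∈ V, ∀ i, MvPolynomial.eval y (P i) = 0 := fun y hy i => by
    simpa [MvPolynomial.aeval_eq_eval] using hPV i y hy
  let γ : (σ → ℝ) → Matrix (Fin c) σ ℝ := fun y i => gradAt (P i) y
  have hγ : ∀ i, ContDiff ℝ ∞ fun y => γ y i := fun i =>
    contDiff_pi.2 fun j => contDiff_mvPolynomial_eval _
  let Θ : (σ → ℝ) × (Fin c → ℝ) → (σ → ℝ) × (Fin c → ℝ) := fun w =>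
    (w.1 + ∑ i, w.2 i • γ w.1 i, fun i => MvPolynomial.eval w.1 (P i))
  have hΘ : ContDiff ℝ ∞ Θ := by
    refine (contDiff_fst.add (ContDiff.sum fun i _ => ?_)).prodMk (contDiff_pi.2 fun i => ?_)
    · exact ((contDiff_apply ℝ ℝ i).comp contDiff_snd).smul ((hγ i).comp contDiff_fst)
    · exact (contDiff_mvPolynomial_eval _).comp contDiff_fst
  have hΘ' : ∀ w, fderiv ℝ Θ (y₀, 0) w = (w.1 + ∑ i, w.2 i • γ y₀ i, γ y₀ *ᵥ w.1) := by
    intro w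
    have h1 : HasFDerivAt Θ (((ContinuousLinearMap.fst ℝ _ _) +
        ∑ i, ((((0 : Fin c → ℝ) i) • (fderiv ℝ (fun y => γ y i) y₀).comp
          (ContinuousLinearMap.fst ℝ (σ → ℝ) (Fin c → ℝ))) +
          ((ContinuousLinearMap.proj i).comp (ContinuousLinearMap.snd ℝ _ _)).smulRight
            (γ y₀ i))).prod
        (ContinuousLinearMap.pi fun i => (fderiv ℝ (fun y => MvPolynomial.eval y (P i)) y₀).comp
          (ContinuousLinearMap.fst ℝ _ _))) (y₀, 0) := by
      refine (hasFDerivAt_fst.add (HasFDerivAt.fun_sum fun i _ => ?_)).prodMk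
        (hasFDerivAt_pi.2 fun i => ?_)
      · have h1 : HasFDerivAt (fun w : (σ → ℝ) × (Fin c → ℝ) => w.2 i)
            ((ContinuousLinearMap.proj (R := ℝ) (φ := fun _ : Fin c => ℝ) i).comp
              (ContinuousLinearMap.snd ℝ (σ → ℝ) (Fin c → ℝ))) (y₀, 0) :=
          ((ContinuousLinearMap.proj (R := ℝ) (φ := fun _ : Fin c => ℝ) i).comp
              (ContinuousLinearMap.snd ℝ (σ → ℝ) (Fin c → ℝ))).hasFDerivAt
        have h2 : HasFDerivAt (fun w : (σ → ℝ) × (Fin c → ℝ) => γ w.1 i)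
            ((fderiv ℝ (fun y => γ y i) y₀).comp
              (ContinuousLinearMap.fst ℝ (σ → ℝ) (Fin c → ℝ))) (y₀, 0) :=
          HasFDerivAt.comp (g := fun y => γ y i) (y₀, (0 : Fin c → ℝ))
            (((hγ i).differentiable (by simp)) y₀).hasFDerivAt hasFDerivAt_fst
        exact h1.fun_smul h2
      · exact HasFDerivAt.comp (g := fun y => MvPolynomial.eval y (P i)) (y₀, (0 : Fin c → ℝ))
            (((contDiff_mvPolynomial_eval (n := 1) (P i)).differentiable
              (by simp)) y₀).hasFDerivAt hasFDerivAt_fst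
    rw [h1.fderiv]
    refine Prod.ext ?_ (funext fun i => ?_)
    · simp
    · simp only [ContinuousLinearMap.prod_apply, ContinuousLinearMap.pi_apply,
        ContinuousLinearMap.comp_apply, ContinuousLinearMap.coe_fst', fderiv_mvPolynomial_eval]
      rfl
  have hvec : ∀ a : Fin c → ℝ, ∑ i, a i • γ y₀ i = (γ y₀)ᵀ *ᵥ a := fun a => by
    rw [Matrix.mulVec_transpose, Matrix.vecMul_eq_sum]
  -- The derivative is `(v, a) ↦ (v + γᵀ a, γ v)`. If it vanishes, `γᵀ a = -v` lies both in the
  -- range of `γᵀ` and in the kernel of `γ`, which are orthogonal.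
  have hinj : Function.Injective (fderiv ℝ Θ (y₀, 0)) := by
    refine (injective_iff_map_eq_zero _).2 fun w hw => ?_
    rw [hΘ', Prod.mk_eq_zero, hvec] at hw
    have h0 : (γ y₀)ᵀ *ᵥ w.2 = 0 := by
      rw [← dotProduct_self_eq_zero]
      have h3 : (γ y₀)ᵀ *ᵥ w.2 = - w.1 := eq_neg_of_add_eq_zero_right hw.1
      nth_rewrite 2 [h3]
      rw [Matrix.mulVec_transpose, dotProduct_neg, ← Matrix.dotProduct_mulVec, hw.2]
      simp
    have h2 : w.2 = 0 := by
      rw [← hvec] at h0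
      exact funext (Fintype.linearIndependent_iff.1 hli w.2 h0)
    refine Prod.ext ?_ h2
    rw [h0, add_zero] at hw
    exact hw.1
  let A : ((σ → ℝ) × (Fin c → ℝ)) ≃L[ℝ] ((σ → ℝ) × (Fin c → ℝ)) :=
    (LinearEquiv.ofInjectiveEndo (fderiv ℝ Θ (y₀, 0)).toLinearMap hinj).toContinuousLinearEquiv
  have hA : ∀ w, A w = fderiv ℝ Θ (y₀, 0) w := fun w => rfl
  have hAΘ : HasFDerivAt Θ (A : _ →L[ℝ] _) (y₀, 0) :=
    ((hΘ.differentiable (by simp)) (y₀, 0)).hasFDerivAt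
  obtain ⟨e, he₀, -, heΘ, hes⟩ :=
    exists_smooth_local_inverse isOpen_univ hΘ.contDiffOn (Set.mem_univ _) hAΘ
  have hΘ₀ : Θ (y₀, 0) = (y₀, 0) := by
    refine Prod.ext ?_ (funext fun i => ?_)
    · simp [Θ]
    · exact hPV' y₀ hy₀ i
  have het : (y₀, (0 : Fin c → ℝ)) ∈ e.target := by
    have := e.map_source he₀
    rwa [heΘ, hΘ₀] at this
  have hesymm : e.symm (y₀, 0) = (y₀, 0) := by
    have := e.left_inv he₀
    rwa [heΘ, hΘ₀] at this
  have hdet : (γ y₀ * (γ y₀)ᵀ).det ≠ 0 := by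
    have := (Matrix.PosDef.mul_conjTranspose_self (A := γ y₀)
      (Matrix.vecMul_injective_iff.2 hli)).det_pos
    simpa using this.ne'
  have hγc : Continuous γ := continuous_pi fun i => (hγ i).continuous
  have hGc : Continuous fun y => γ y * (γ y)ᵀ := hγc.matrix_mul hγc.matrix_transpose
  -- The multipliers are recovered from `p` and `z` as `(γ γᵀ)⁻¹ γ (z - p)`. By continuity they are
  -- small near `(y₀, y₀)`, which puts `(p, a)` into the domain where `Θ` is inverted.
  let α : (σ → ℝ) × (σ → ℝ) → Fin c → ℝ := fun w =>
    ((γ w.1 * (γ w.1)ᵀ).det⁻¹ • (γ w.1 * (γ w.1)ᵀ).adjugate) *ᵥ (γ w.1 *ᵥ (w.2 - w.1))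
  have hα : ContinuousAt α (y₀, y₀) := by
    refine Continuous.continuousAt (X := Matrix (Fin c) (Fin c) ℝ × (Fin c → ℝ))
      (f := fun q => q.1 *ᵥ q.2) (by fun_prop) |>.comp ?_ (f := fun w : (σ → ℝ) × (σ → ℝ) =>
        ((γ w.1 * (γ w.1)ᵀ).det⁻¹ • (γ w.1 * (γ w.1)ᵀ).adjugate, γ w.1 *ᵥ (w.2 - w.1)))
    have h1 : ContinuousAt (fun w : (σ → ℝ) × (σ → ℝ) => (γ w.1 * (γ w.1)ᵀ).det⁻¹) (y₀, y₀) :=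
      ContinuousAt.inv₀ (hGc.matrix_det.comp continuous_fst).continuousAt hdet
    have h2 : ContinuousAt (fun w : (σ → ℝ) × (σ → ℝ) => (γ w.1 * (γ w.1)ᵀ).adjugate) (y₀, y₀) :=
      (hGc.matrix_adjugate.comp continuous_fst).continuousAt
    refine ContinuousAt.prodMk (h1.smul h2) ?_
    · exact ((hγc.comp continuous_fst).matrix_mulVec
        (continuous_snd.sub continuous_fst)).continuousAt
  have hα₀ : α (y₀, y₀) = 0 := by simp [α]
  have hαeq : ∀ p z (a : Fin c → ℝ), (γ p * (γ p)ᵀ).det ≠ 0 → z - p = ∑ i, a i • γ p i →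
      a = α (p, z) := by
    intro p z a hd h
    simp only [α]
    rw [h, show ∑ i, a i • γ p i = (γ p)ᵀ *ᵥ a by
      rw [Matrix.mulVec_transpose, Matrix.vecMul_eq_sum], Matrix.mulVec_mulVec, Matrix.mulVec_mulVec,
      Matrix.mul_assoc, Matrix.smul_mul, Matrix.adjugate_mul, smul_smul, inv_mul_cancel₀ hd, one_smul,
      Matrix.one_mulVec]
  have hev : ∀ᶠ w : (σ → ℝ) × (σ → ℝ) in 𝓝 (y₀, y₀), (w.1, α w) ∈ e.source ∧
      (γ w.1 * (γ w.1)ᵀ).det ≠ 0 ∧ MvPolynomial.eval w.1 Q ≠ 0 := by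
    refine Filter.Eventually.and ?_ (Filter.Eventually.and ?_ ?_)
    · have : ContinuousAt (fun w : (σ → ℝ) × (σ → ℝ) => (w.1, α w)) (y₀, y₀) :=
        continuousAt_fst.prodMk hα
      refine this.preimage_mem_nhds (e.open_source.mem_nhds ?_)
      simpa [hα₀] using he₀
    · exact (hGc.matrix_det.comp continuous_fst).continuousAt.eventually_ne hdet
    · exact ((MvPolynomial.continuous_eval Q).comp continuous_fst).continuousAt.eventually_ne hQ₀
  obtain ⟨ε, hε, hev⟩ := Metric.eventually_nhds_iff_ball.1 hev
  -- The nearest point `p` to `z` is no farther from `z` than `y₀` is, so two bounds by `ε / 2` keep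
  -- `p` within `ε` of `y₀`.
  refine ⟨{z | (z, (0 : Fin c → ℝ)) ∈ e.target} ∩ ({z | (z - y₀) ⬝ᵥ (z - y₀) < (ε / 2) ^ 2} ∩
    Metric.ball y₀ (ε / 2)), fun z => (e.symm (z, 0)).1, ?_, ?_, ?_, ?_, ?_⟩
  · refine (e.open_target.preimage (by fun_prop)).inter (IsOpen.inter ?_ Metric.isOpen_ball)
    exact isOpen_lt (by unfold dotProduct; fun_prop) continuous_const
  · exact ⟨het, by simp [hε], Metric.mem_ball_self (by positivity)⟩
  · refine contDiff_fst.comp_contDiffOn ((hes.comp (t := e.target)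
      (f := fun z : σ → ℝ => (z, (0 : Fin c → ℝ)))
      (contDiff_id.prodMk contDiff_const).contDiffOn) fun z hz => hz.1)
  · rintro z ⟨-, hz2, hz3⟩ p hp hmin
    have hzp : ‖z - p‖ < ε / 2 := by
      refine lt_of_pow_lt_pow_left₀ 2 (by positivity) ?_
      exact ((norm_sq_le_dotProduct_self _).trans (hmin y₀ hy₀)).trans_lt hz2
    have hpt : p ∈ Metric.ball y₀ ε := (by
      have := dist_triangle p z y₀
      rw [dist_comm p z, dist_eq_norm z p] at this
      rw [Metric.mem_ball] at hz3 ⊢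
      linarith)
    have hzt : z ∈ Metric.ball y₀ ε := Metric.ball_subset_ball (by linarith) hz3
    obtain ⟨h1, h2, h3⟩ := hev (p, z) (by rw [← ball_prod_same]; exact ⟨hpt, hzt⟩)
    simp only at h1 h2 h3
    have hlip : LinearIndependent ℝ fun i => gradAt (P i) p := by
      refine Matrix.vecMul_injective_iff.1 (show Function.Injective fun a => a ᵥ* γ p from
        fun a b hab => ?_)
      have hab' : a ᵥ* (γ p * (γ p)ᵀ) = b ᵥ* (γ p * (γ p)ᵀ) := by
        rw [← Matrix.vecMul_vecMul, ← Matrix.vecMul_vecMul]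
        exact congrArg (fun u => u ᵥ* (γ p)ᵀ) hab
      exact Matrix.vecMul_injective_of_isUnit
        ((Matrix.isUnit_iff_isUnit_det _).2 (isUnit_iff_ne_zero.2 h2)) hab'
    obtain ⟨a, ha⟩ := exists_multipliers_of_nearest hQ (hPV' p hp) h3 hlip hmin
    have haα := hαeq p z a h2 ha
    have : e (p, a) = (z, 0) := by
      rw [heΘ]
      refine Prod.ext ?_ (funext fun i => hPV' p hp i)
      change p + ∑ i, a i • gradAt (P i) p = z
      rw [← ha]
      abel
    rw [← haα] at h1
    simp only
    rw [← this, e.left_inv h1]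
  · intro v hv
    have hv0 : γ y₀ *ᵥ v = 0 := funext fun i => hv (P i) (hPV i)
    have h1 : HasFDerivAt e.symm (A.symm : _ →L[ℝ] _) (y₀, 0) := by
      refine e.hasFDerivAt_symm het ?_
      rw [hesymm, show (e : _ → _) = Θ from funext heΘ]
      exact hAΘ
    have h2 : HasFDerivAt (fun z : σ → ℝ => (z, (0 : Fin c → ℝ)))
        (ContinuousLinearMap.inl ℝ (σ → ℝ) (Fin c → ℝ)) y₀ :=
      (ContinuousLinearMap.inl ℝ (σ → ℝ) (Fin c → ℝ)).hasFDerivAt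
    have h3 := hasFDerivAt_fst.comp y₀ (h1.comp y₀ h2)
    have h4 : A.symm (v, 0) = (v, 0) := by
      rw [A.symm_apply_eq, hA, hΘ']
      simp [hv0]
    calc _ = (A.symm (v, 0)).1 := DFunLike.congr_fun h3.fderiv v
      _ = v := by rw [h4]

/-- Nearest points are chosen arbitrarily on the whole space; near `V` the choice is forced to agree
with the local smooth maps, so it is smooth there. -/
theorem exists_isSmoothRetraction (hV : IsAlgebraicSet V) (hns : IsNonsingular V) :
    ∃ O r, IsSmoothRetraction V O r := by
  rcases V.eq_empty_or_nonempty with rfl | hne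
  · exact ⟨∅, id, isOpen_empty, subset_rfl, contDiffOn_id, fun _ h => h, by simp, by simp⟩
  choose r hrV hr using exists_nearest_point hV.isClosed hne
  choose! U π hU hyU hπ hπr hπ' using fun y (hy : y ∈ V) => exists_local_nearest_point hns hy
  have heq : ∀ y ∈ V, ∀ z ∈ U y, r z = π y z := fun y hy z hz =>
    hπr y hy z hz (r z) (hrV z) (hr z)
  refine ⟨⋃ y ∈ V, U y, r, isOpen_biUnion hU, fun y hy => Set.mem_biUnion hy (hyU y hy), ?_,
    fun z _ => hrV z, fun y hy => ?_, fun y hy v hv => ?_⟩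
  · intro z hz
    obtain ⟨y, hy, hzy⟩ := Set.mem_iUnion₂.1 hz
    refine (((hπ y hy).contDiffAt ((hU y hy).mem_nhds hzy)).congr_of_eventuallyEq
      ?_).contDiffWithinAt
    filter_upwards [(hU y hy).mem_nhds hzy] with w hw using heq y hy w hw
  · have h1 := hr y y hy
    rw [sub_self, dotProduct_zero] at h1
    have h2 : (y - r y) ⬝ᵥ (y - r y) = 0 :=
      le_antisymm h1 (Finset.sum_nonneg fun i _ => mul_self_nonneg _)
    exact (sub_eq_zero.1 (dotProduct_self_eq_zero.1 h2)).symm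
  · have : r =ᶠ[𝓝 y] π y := by
      filter_upwards [(hU y hy).mem_nhds (hyU y hy)] with w hw using heq y hy w hw
    rw [this.fderiv_eq]
    exact hπ' y hy v hv

namespace IsSmoothRetraction

variable {O : Set (σ → ℝ)} {r : (σ → ℝ) → σ → ℝ}

/-- Differentiate `P ∘ r = 0` at `y`, for `P` vanishing on `V`. -/
theorem fderiv_mem_tangentSpace (h : IsSmoothRetraction V O r) {y : σ → ℝ} (hy : y ∈ V)
    (v : σ → ℝ) : fderiv ℝ r y v ∈ tangentSpace V y := by
  intro P hP
  have h1 : (fun x => MvPolynomial.eval (r x) P) =ᶠ[𝓝 y] fun _ => 0 := by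
    filter_upwards [h.isOpen.mem_nhds (h.subset hy)] with x hx
    have := hP (r x) (h.mapsTo hx)
    rwa [MvPolynomial.aeval_eq_eval] at this
  have hr : HasFDerivAt r (fderiv ℝ r y) y :=
    ((h.contDiffOn.contDiffAt (h.isOpen.mem_nhds (h.subset hy))).differentiableAt
      (by simp)).hasFDerivAt
  have h2 := HasFDerivAt.comp (g := fun x => MvPolynomial.eval x P) y
    (((contDiff_mvPolynomial_eval (n := 1) P).differentiable (by simp)) (r y)).hasFDerivAt hr
  have h3 := DFunLike.congr_fun (h2.fderiv.symm.trans h1.fderiv_eq) v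
  rw [ContinuousLinearMap.comp_apply, fderiv_mvPolynomial_eval, h.apply_eq y hy] at h3
  simpa [dotProduct] using h3

theorem fderiv_fderiv (h : IsSmoothRetraction V O r) {y : σ → ℝ} (hy : y ∈ V) (v : σ → ℝ) :
    fderiv ℝ r y (fderiv ℝ r y v) = fderiv ℝ r y v :=
  h.fderiv_apply y hy _ (h.fderiv_mem_tangentSpace hy v)

theorem hasStrictFDerivAt (h : IsSmoothRetraction V O r) {y : σ → ℝ} (hy : y ∈ V) :
    HasStrictFDerivAt r (fderiv ℝ r y) y :=
  ((h.contDiffOn.contDiffAt (h.isOpen.mem_nhds (h.subset hy))).hasStrictFDerivAt (by simp))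

theorem continuousOn_fderiv (h : IsSmoothRetraction V O r) : ContinuousOn (fderiv ℝ r) O :=
  h.contDiffOn.continuousOn_fderiv_of_isOpen h.isOpen (by simp)

theorem contDiffOn_fderiv (h : IsSmoothRetraction V O r) : ContDiffOn ℝ ∞ (fderiv ℝ r) O :=
  h.contDiffOn.fderiv_of_isOpen h.isOpen (by simp)

/-- Near a point of `V`, distinct points of `V` do not differ by a vector normal to `V`. -/
theorem eventually_eq_of_fderiv_sub_eq_zero (h : IsSmoothRetraction V O r) {y₀ : σ → ℝ}
    (hy₀ : y₀ ∈ V) : ∀ᶠ w : (σ → ℝ) × (σ → ℝ) × (σ → ℝ) in 𝓝 (y₀, y₀, y₀),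
      w.2.1 ∈ V → w.2.2 ∈ V → fderiv ℝ r w.1 (w.2.1 - w.2.2) = 0 → w.2.1 = w.2.2 := by
  -- With `d` the difference of the two points, strict differentiability gives `‖d - Dr(y₀) d‖ ≤ ‖d‖
  -- / 4`, and continuity of `Dr` with `Dr(w.1) d = 0` gives `‖Dr(y₀) d‖ ≤ ‖d‖ / 4`; together these
  -- force `d = 0`.
  have h1 := (h.hasStrictFDerivAt hy₀).isLittleO.def (c := 1 / 4) (by norm_num)
  have h2 : ∀ᶠ y in 𝓝 y₀, ‖fderiv ℝ r y₀ - fderiv ℝ r y‖ < 1 / 4 := by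
    have := ((h.continuousOn_fderiv.continuousAt (h.isOpen.mem_nhds (h.subset hy₀))).const_sub
      (fderiv ℝ r y₀)).norm
    exact this.eventually_lt continuousAt_const (by simp)
  have h3 : Filter.Tendsto (fun w : (σ → ℝ) × (σ → ℝ) × (σ → ℝ) => w.2) (𝓝 (y₀, y₀, y₀))
    (𝓝 (y₀, y₀)) := continuous_snd.tendsto _
  have h4 : Filter.Tendsto (fun w : (σ → ℝ) × (σ → ℝ) × (σ → ℝ) => w.1) (𝓝 (y₀, y₀, y₀))
    (𝓝 y₀) := continuous_fst.tendsto _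
  filter_upwards [h3.eventually h1, h4.eventually h2] with w hw1 hw2 ha hb hd
  rw [h.apply_eq _ ha, h.apply_eq _ hb] at hw1
  set d := w.2.1 - w.2.2 with hd'
  have h5 : ‖fderiv ℝ r y₀ d‖ ≤ 1 / 4 * ‖d‖ := by
    have : fderiv ℝ r y₀ d = (fderiv ℝ r y₀ - fderiv ℝ r w.1) d := by simp [hd]
    rw [this]
    exact (ContinuousLinearMap.le_opNorm _ _).trans (by gcongr)
  have h6 : ‖d‖ ≤ ‖d - fderiv ℝ r y₀ d‖ + ‖fderiv ℝ r y₀ d‖ := by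
    simpa using norm_add_le (d - fderiv ℝ r y₀ d) (fderiv ℝ r y₀ d)
  have h7 : ‖d‖ = 0 := by
    have := norm_nonneg d
    linarith
  exact sub_eq_zero.1 (norm_eq_zero.1 h7)

end IsSmoothRetraction

end Retraction

end RealAlg

namespace RealAlg

/-! ### Derivations of function fields. -/

section Derivations

/-- In characteristic zero, a transcendental element is not killed by all derivations. -/
theorem exists_derivation_eq_one {k K : Type*} [Field k] [CharZero k] [Field K] [Algebra k K]
    [Algebra.EssFiniteType k K] {x : K} (hx : Transcendental k x) :
    ∃ D : Derivation k K K, D x = 1 := by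
  let A := Polynomial k
  let φ : A →ₐ[k] K := Polynomial.aeval x
  let : Algebra A K := φ.toAlgebra
  have hφ : ∀ a : A, algebraMap A K a = φ a := fun _ => rfl
  have : IsScalarTower k A K := IsScalarTower.of_algebraMap_eq fun r => (φ.commutes r).symm
  have : FaithfulSMul A K := (faithfulSMul_iff_algebraMap_injective A K).2
    (transcendental_iff_injective.1 hx)
  let F := FractionRing A
  let : Algebra F K := FractionRing.liftAlgebra A K
  have : IsScalarTower A F K := FractionRing.isScalarTower_liftAlgebra A K
  have : IsScalarTower k F K := IsScalarTower.of_algebraMap_eq fun r => by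
    rw [IsScalarTower.algebraMap_apply k A K, IsScalarTower.algebraMap_apply A F K,
      ← IsScalarTower.algebraMap_apply k A F]
  have : CharZero F := charZero_of_injective_algebraMap (algebraMap k F).injective
  have : Algebra.EssFiniteType F K := Algebra.EssFiniteType.of_comp k F K
  -- In characteristic zero `K` is formally smooth over `k(x)`, and so is the localization `k(x)`
  -- over `k[x]`; hence infinitesimal lifting is available over `k[x]`.
  have : Algebra.FormallySmooth F K := inferInstance
  have : Algebra.FormallySmooth A F := .of_isLocalization (nonZeroDivisors A)
  have : Algebra.FormallySmooth A K := .comp A F K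
  -- The polynomial variable acts on the dual numbers as `x + ε`. A lift `K → K[ε]` of the identity
  -- that is linear over `k[x]` then sends `x` to `x + ε`, and its `ε`-part is the desired
  -- derivation.
  let ψ : A →ₐ[k] DualNumber K := Polynomial.aeval (TrivSqZeroExt.inl x + DualNumber.eps)
  let : Algebra A (DualNumber K) := ψ.toAlgebra
  have hψ : ∀ a : A, algebraMap A (DualNumber K) a = ψ a := fun _ => rfl
  let π : DualNumber K →ₐ[A] K :=
    { (TrivSqZeroExt.fstHom k K K).toRingHom with
      commutes' := fun a => by
        have : (TrivSqZeroExt.fstHom k K K).comp ψ = φ := by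
          ext
          simp [ψ, φ]
        exact DFunLike.congr_fun this a }
  have hπ : ∀ z, π z = z.fst := fun _ => rfl
  have hπs : Function.Surjective π := fun y => ⟨TrivSqZeroExt.inl y, rfl⟩
  have hnil : IsNilpotent (RingHom.ker (π : DualNumber K →+* K)) := by
    refine ⟨2, ?_⟩
    rw [Ideal.zero_eq_bot, eq_bot_iff, pow_two (RingHom.ker (π : DualNumber K →+* K)),
      Ideal.mul_le]
    intro a ha b hb
    have ha' : a.fst = 0 := ha
    have hb' : b.fst = 0 := hb
    rw [Ideal.mem_bot]
    ext <;> simp [ha', hb']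
  let L : K →ₐ[A] DualNumber K :=
    Algebra.FormallySmooth.liftOfSurjective (AlgHom.id A K) π hπs hnil
  have hL : ∀ y, (L y).fst = y := fun y =>
    Algebra.FormallySmooth.liftOfSurjective_apply (AlgHom.id A K) π hπs hnil y
  refine ⟨Derivation.mk' { toFun := fun y => (L y).snd, map_add' := by simp, map_smul' := ?_ }
    ?_, ?_⟩
  · intro c y
    have : c • y = algebraMap A K (Polynomial.C c) * y := by
      rw [hφ, Polynomial.aeval_C, Algebra.smul_def]
    have hc : ψ (Polynomial.C c) = TrivSqZeroExt.inl (algebraMap k K c) :=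
      (Polynomial.aeval_C _ c).trans rfl
    rw [this, map_mul, L.commutes, hψ, hc]
    simp [Algebra.smul_def]
  · intro a b
    simp [hL, mul_comm]
  · have h1 : L x = ψ Polynomial.X := by
      rw [← hψ, ← L.commutes, hφ]
      exact congrArg L (Polynomial.aeval_X x).symm
    have h2 : ψ Polynomial.X = TrivSqZeroExt.inl x + DualNumber.eps := Polynomial.aeval_X _
    simp [h1, h2]

theorem derivation_aeval_eq_sum {σ k K : Type*} [Fintype σ] [CommRing k] [CommRing K]
    [Algebra k K] (D : Derivation k K K) (x : σ → K) (p : MvPolynomial σ k) :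
    D (MvPolynomial.aeval x p) =
      ∑ j, MvPolynomial.aeval x (MvPolynomial.pderiv j p) * D (x j) := by
  classical
  induction p using MvPolynomial.induction_on with
  | C a => simp
  | add p q hp hq => simp [hp, hq, add_mul, Finset.sum_add_distrib]
  | mul_X p i hp =>
    simp only [map_mul, MvPolynomial.aeval_X, Derivation.leibniz, hp, MvPolynomial.pderiv_X,
      map_add, smul_eq_mul, add_mul, Finset.sum_add_distrib, Finset.mul_sum]
    congr 1
    · simp [Pi.single_apply, apply_ite]
    · exact Finset.sum_congr rfl fun j _ => by ring

end Derivations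

/-! ### The squared norm has finitely many critical values. -/

section CriticalValues

variable {σ : Type*} [Fintype σ] {X : Set (σ → ℝ)}

/-- Let `ρ = |x|²` in the function field of `Z`. If `ρ` is algebraic over `ℝ`, its values on `Z` are
roots of one nonzero polynomial. Otherwise some derivation `D` has `D ρ = 1`. Clearing denominators
by `B` turns `D` into a polynomial vector field, tangent to `X` along `Z`, whose derivative of `ρ`
on `Z` is `B`. Criticality forces `B = 0` on `Z`, contradicting that `B` is a nonzero denominator.
-/
theorem finite_critical_values_of_isPrime {Z : Set (σ → ℝ)} (hZX : Z ⊆ X)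
    (hZ : ∀ x ∈ Z, ∀ v ∈ tangentSpace X x, x ⬝ᵥ v = 0)
    (hI : (MvPolynomial.vanishingIdeal ℝ Z).IsPrime) :
    ((fun x : σ → ℝ => x ⬝ᵥ x) '' Z).Finite := by
  set I := MvPolynomial.vanishingIdeal ℝ Z
  let R := MvPolynomial σ ℝ ⧸ I
  let K := FractionRing R
  let ρ : MvPolynomial σ ℝ := ∑ j, MvPolynomial.X j ^ 2
  let ι : MvPolynomial σ ℝ →ₐ[ℝ] K := (Algebra.ofId R K).restrictScalars ℝ |>.comp
    (Ideal.Quotient.mkₐ ℝ I)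
  have hι : ∀ p, ι p = 0 ↔ p ∈ I := fun p => by
    change algebraMap R K (Ideal.Quotient.mk I p) = 0 ↔ _
    rw [map_eq_zero_iff _ (IsFractionRing.injective R K), Ideal.Quotient.eq_zero_iff_mem]
  by_cases hρ : Transcendental ℝ (ι ρ)
  · exfalso
    have : Algebra.EssFiniteType R K := .of_isLocalization K (nonZeroDivisors R)
    have : Algebra.EssFiniteType ℝ K := .comp ℝ R K
    obtain ⟨D, hD⟩ := exists_derivation_eq_one hρ
    have hιx : ∀ p, ι p = MvPolynomial.aeval (fun j => ι (MvPolynomial.X j)) p := fun p => by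
      exact DFunLike.congr_fun (MvPolynomial.aeval_unique ι) p
    have hDp : ∀ p, D (ι p) = ∑ j, ι (MvPolynomial.pderiv j p) * D (ι (MvPolynomial.X j)) := by
      intro p
      rw [hιx p, derivation_aeval_eq_sum]
      exact Finset.sum_congr rfl fun j _ => by rw [← hιx]
    obtain ⟨b, hb⟩ := IsLocalization.exist_integer_multiples_of_finite (nonZeroDivisors R)
      fun j => D (ι (MvPolynomial.X j))
    choose a' ha' using hb
    choose a ha using fun j => Ideal.Quotient.mk_surjective (I := I) (a' j)
    obtain ⟨B, hB⟩ := Ideal.Quotient.mk_surjective (I := I) (b : R)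
    have hιB : ι B = algebraMap R K b := by rw [← hB]; rfl
    have hιa : ∀ j, ι (a j) = ι B * D (ι (MvPolynomial.X j)) := fun j => by
      rw [hιB, ← Algebra.smul_def]
      refine Eq.trans ?_ (ha' j)
      rw [← ha j]
      rfl
    have hBI : B ∉ I := by
      rw [← hι, hιB, map_eq_zero_iff _ (IsFractionRing.injective R K)]
      exact nonZeroDivisors.ne_zero b.2
    have hsum : ∀ p, ι (∑ j, MvPolynomial.pderiv j p * a j) = ι B * D (ι p) := fun p => by
      rw [hDp, Finset.mul_sum, map_sum]
      exact Finset.sum_congr rfl fun j _ => by rw [map_mul, hιa]; ring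
    obtain ⟨x, hxZ, hx⟩ : ∃ x ∈ Z, MvPolynomial.eval x B ≠ 0 := by
      by_contra! h
      exact hBI fun x hx => by rw [MvPolynomial.aeval_eq_eval]; exact h x hx
    have hv : (fun j => MvPolynomial.eval x (a j)) ∈ tangentSpace X x := by
      intro P hP
      have h1 : ∑ j, MvPolynomial.pderiv j P * a j ∈ I := by
        have : ι P = 0 := (hι P).2 (MvPolynomial.vanishingIdeal_anti_mono hZX hP)
        rw [← hι, hsum, this, map_zero, mul_zero]
      have h2 := h1 x hxZ
      rw [MvPolynomial.aeval_eq_eval] at h2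
      simpa [gradAt] using h2
    have h3 := hZ x hxZ _ hv
    have h4 : ∑ j, MvPolynomial.pderiv j ρ * a j - B ∈ I := by
      rw [← hι, map_sub, hsum, hD, mul_one, sub_self]
    have h5 := h4 x hxZ
    rw [MvPolynomial.aeval_eq_eval, map_sub] at h5
    have h6 : ∀ j, MvPolynomial.pderiv j ρ = 2 * MvPolynomial.X j := fun j => by
      classical
      simp [ρ, Derivation.leibniz_pow, MvPolynomial.pderiv_X, Pi.single_apply]
    have h7 : MvPolynomial.eval x (∑ j, MvPolynomial.pderiv j ρ * a j) =
        2 * (x ⬝ᵥ fun j => MvPolynomial.eval x (a j)) := by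
      simp [h6, dotProduct, Finset.mul_sum, mul_assoc]
    rw [h7, h3, mul_zero, zero_sub, neg_eq_zero] at h5
    exact hx h5
  · obtain ⟨q, hq0, hq⟩ := not_not.1 hρ
    refine (q.rootSet_finite ℝ).subset ?_
    rintro _ ⟨x, hx, rfl⟩
    rw [Polynomial.mem_rootSet]
    refine ⟨hq0, ?_⟩
    rw [Polynomial.aeval_algHom_apply, hι] at hq
    have h1 := hq x hx
    rw [← Polynomial.aeval_algHom_apply] at h1
    have h2 : MvPolynomial.aeval x ρ = x ⬝ᵥ x := by
      simp [ρ, dotProduct, sq]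
    rwa [h2] at h1

/-- Noetherian induction on the vanishing ideal: if `f * g` lies in it but neither factor does, `Z`
is the union of its zero sets of `f` and `g`, both with strictly larger ideals. -/
theorem finite_critical_values {Z : Set (σ → ℝ)} (hZX : Z ⊆ X)
    (hZ : ∀ x ∈ Z, ∀ v ∈ tangentSpace X x, x ⬝ᵥ v = 0) :
    ((fun x : σ → ℝ => x ⬝ᵥ x) '' Z).Finite := by
  induction hI : MvPolynomial.vanishingIdeal ℝ Z using WellFoundedGT.induction generalizing Z with
  | ind I ih =>
  subst hI
  by_cases hp : (MvPolynomial.vanishingIdeal ℝ Z).IsPrime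
  · exact finite_critical_values_of_isPrime hZX hZ hp
  rw [Ideal.isPrime_iff] at hp
  push Not at hp
  by_cases htop : MvPolynomial.vanishingIdeal ℝ Z = ⊤
  · have : Z = ∅ := by
      refine Set.eq_empty_of_forall_notMem fun x hx => ?_
      have : (1 : MvPolynomial σ ℝ) ∈ MvPolynomial.vanishingIdeal ℝ Z := htop ▸ trivial
      simpa using this x hx
    simp [this]
  obtain ⟨f, g, hfg, hf, hg⟩ := hp htop
  have key : ∀ f : MvPolynomial σ ℝ, f ∉ MvPolynomial.vanishingIdeal ℝ Z →
      ((fun x : σ → ℝ => x ⬝ᵥ x) '' (Z ∩ {x | MvPolynomial.aeval x f = 0})).Finite := by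
    intro f hf
    refine ih _ ?_ (Set.inter_subset_left.trans hZX) (fun x hx => hZ x hx.1) rfl
    refine lt_of_le_of_ne (MvPolynomial.vanishingIdeal_anti_mono Set.inter_subset_left) fun h => ?_
    rw [h] at hf
    exact hf fun x hx => hx.2
  refine ((key f hf).union (key g hg)).subset ?_
  rintro _ ⟨x, hx, rfl⟩
  have := hfg x hx
  rw [map_mul, mul_eq_zero] at this
  exact this.imp (fun h => ⟨x, ⟨hx, h⟩, rfl⟩) (fun h => ⟨x, ⟨hx, h⟩, rfl⟩)

/-- Outside of a large ball, no point `x` of `X` is orthogonal to the tangent space at `x`. -/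
theorem exists_forall_dotProduct_ne_zero (X : Set (σ → ℝ)) :
    ∃ R : ℝ, 0 < R ∧ ∀ x ∈ X, R ≤ x ⬝ᵥ x → ∃ v ∈ tangentSpace X x, x ⬝ᵥ v ≠ 0 := by
  have hfin := finite_critical_values (X := X)
    (Z := {x ∈ X | ∀ v ∈ tangentSpace X x, x ⬝ᵥ v = 0}) (fun x hx => hx.1) (fun x hx => hx.2)
  obtain ⟨C, hC⟩ := hfin.bddAbove
  refine ⟨max C 0 + 1, by positivity, fun x hx hR => ?_⟩
  by_contra! h
  have := hC ⟨x, ⟨hx, h⟩, rfl⟩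
  have h2 := le_max_left C 0
  simp only at this
  linarith

end CriticalValues

end RealAlg

namespace RealAlg

/-! ### Iterating a deformation that decreases a proper function. -/

section Iteration

variable {X : Type*} [TopologicalSpace X]

/-- The concatenation of `k` copies of the deformation `h`, run in unit time each. -/
def concatDeformation (h : C(ℝ × X, X)) : ℕ → C(ℝ × X, X)
  | 0 => ⟨Prod.snd, continuous_snd⟩
  | k + 1 => ⟨fun p => h (max 0 (min 1 (p.1 - k)), concatDeformation h k p), by fun_prop⟩

variable {h : C(ℝ × X, X)} {ρ : X → ℝ}

theorem concatDeformation_succ (k : ℕ) (s : ℝ) (x : X) : concatDeformation h (k + 1) (s, x) =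
    h (max 0 (min 1 (s - k)), concatDeformation h k (s, x)) := rfl

/-- Up to time `N`, the copies after the `N`-th have not started. Hence the number of copies may be
changed without affecting continuity. -/
theorem concatDeformation_eq_of_le (h0 : ∀ x, h (0, x) = x) {N k : ℕ} (hk : N ≤ k) {s : ℝ}
    (hs : s ≤ N) (x : X) : concatDeformation h k (s, x) = concatDeformation h N (s, x) := by
  induction k, hk using Nat.le_induction with
  | base => rfl
  | succ k hk ih =>
    have : (N : ℝ) ≤ k := by exact_mod_cast hk
    rw [concatDeformation_succ, max_eq_left ((min_le_right _ _).trans (by linarith)), h0, ih]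

theorem concatDeformation_eq_iterate {N : ℕ} {s : ℝ} (hs : N ≤ s) (x : X) :
    concatDeformation h N (s, x) = (fun x => h (1, x))^[N] x := by
  induction N with
  | zero => rfl
  | succ N ih =>
    push_cast at hs
    rw [concatDeformation_succ, ih (by linarith), Function.iterate_succ_apply',
      min_eq_left (by linarith), max_eq_right zero_le_one]

theorem concatDeformation_antitone (hle : ∀ t ∈ Set.Icc (0 : ℝ) 1, ∀ x, ρ (h (t, x)) ≤ ρ x)
    (s : ℝ) (x : X) : Antitone fun k => ρ (concatDeformation h k (s, x)) :=
  antitone_nat_of_succ_le fun k => by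
    rw [concatDeformation_succ]
    exact hle _ ⟨le_max_left _ _, max_le zero_le_one (min_le_left _ _)⟩ _

/-- Otherwise the orbit stays in the compact set `{C + 1 ≤ ρ ≤ ρ x}`, on which one step decreases
`ρ` by at least a fixed `δ > 0`; this cannot go on forever. -/
theorem exists_iterate_lt (hρ : Continuous ρ) (hcpt : ∀ C, IsCompact {x | ρ x ≤ C}) {C : ℝ}
    (hle : ∀ x, ρ (h (1, x)) ≤ ρ x) (hlt : ∀ x, C < ρ x → ρ (h (1, x)) < ρ x) (x : X) :
    ∃ N : ℕ, ρ ((fun x => h (1, x))^[N] x) < C + 1 := by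
  by_contra! hcon
  set g : X → X := fun x => h (1, x) with hg
  have hgc : Continuous g := by fun_prop
  have hxK : ∀ N : ℕ, g^[N] x ∈ {y | ρ y ≤ ρ x} ∩ {y | C + 1 ≤ ρ y} := by
    refine fun N => ⟨?_, hcon N⟩
    induction N with
    | zero => simp
    | succ N ih =>
      rw [Function.iterate_succ_apply']
      exact (hle _).trans ih
  have hK : IsCompact ({y | ρ y ≤ ρ x} ∩ {y | C + 1 ≤ ρ y}) :=
    (hcpt _).inter_right (isClosed_le continuous_const hρ)
  obtain ⟨z, hz, hmin⟩ := hK.exists_isMinOn ⟨x, hxK 0⟩ (f := fun y => ρ y - ρ (g y))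
    (by fun_prop)
  set δ := ρ z - ρ (g z)
  have hδ : 0 < δ := sub_pos.2 (hlt z (by have := hz.2; rw [Set.mem_ofPred_eq] at this; linarith))
  have hdec : ∀ N : ℕ, ρ (g^[N] x) ≤ ρ x - N * δ := by
    intro N
    induction N with
    | zero => simp
    | succ N ih =>
      have h1 : δ ≤ ρ (g^[N] x) - ρ (g (g^[N] x)) := hmin (hxK N)
      rw [Function.iterate_succ_apply']
      push_cast
      linarith
  obtain ⟨N, hN⟩ := exists_nat_gt ((ρ x - C) / δ)
  rw [div_lt_iff₀ hδ] at hN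
  have h1 := hdec N
  have h2 : C + 1 ≤ ρ (g^[N] x) := (hxK N).2
  linarith

/-- If a deformation strictly decreases a proper function `ρ` where it exceeds `C`, then iterating
it deforms the identity to a map with values in `{ρ ≤ C + 1}`. -/
theorem exists_homotopic_id_le [NormalSpace X] [ParacompactSpace X] [T2Space X]
    (hρ : Continuous ρ) (hcpt : ∀ C, IsCompact {x | ρ x ≤ C}) {C : ℝ} (h0 : ∀ x, h (0, x) = x)
    (hle : ∀ t ∈ Set.Icc (0 : ℝ) 1, ∀ x, ρ (h (t, x)) ≤ ρ x)
    (hlt : ∀ x, C < ρ x → ρ (h (1, x)) < ρ x) :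
    ∃ κ : C(X, X), (ContinuousMap.id X).Homotopic κ ∧ ∀ x, ρ (κ x) ≤ C + 1 := by
  set g : X → X := fun x => h (1, x) with hg
  have hgc : Continuous g := by fun_prop
  obtain ⟨T, hT⟩ := exists_continuous_forall_mem_convex_of_local_const
    (t := fun x => {T : ℝ | ∃ N : ℕ, (N : ℝ) ≤ T ∧ ρ (g^[N] x) < C + 1}) (fun x => by
      rintro a ⟨N, hN, hNx⟩ b ⟨M, hM, hMx⟩ α β hα hβ hαβ
      rcases le_total a b with hab | hab
      · refine ⟨N, hN.trans ?_, hNx⟩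
        simp only [smul_eq_mul]
        nlinarith
      · refine ⟨M, hM.trans ?_, hMx⟩
        simp only [smul_eq_mul]
        nlinarith) (fun x => by
      obtain ⟨N, hN⟩ := exists_iterate_lt hρ hcpt (hle 1 ⟨zero_le_one, le_rfl⟩) hlt x
      refine ⟨N, ?_⟩
      filter_upwards [(hρ.comp (hgc.iterate N)).continuousAt.eventually_lt continuousAt_const hN]
        with y hy
      exact ⟨N, le_rfl, hy⟩)
  have hT0 : ∀ x, 0 ≤ T x := fun x => by
    obtain ⟨N, hN, -⟩ := hT x
    exact (Nat.cast_nonneg N).trans hN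
  let F : unitInterval × X → X := fun p => concatDeformation h ⌈T p.2⌉₊ (p.1 * T p.2, p.2)
  have hF : Continuous F := by
    refine continuous_iff_continuousAt.2 fun p => ?_
    -- The number of copies `⌈T⌉₊` jumps, but locally it can be replaced by one fixed larger `N`.
    obtain ⟨N, hN⟩ := exists_nat_gt (T p.2)
    have h1 : Continuous fun p : unitInterval × X => concatDeformation h N (p.1 * T p.2, p.2) := by fun_prop
    refine h1.continuousAt.congr ?_
    have h2 : Continuous fun p : unitInterval × X => T p.2 := by fun_prop
    filter_upwards [h2.continuousAt.eventually_lt continuousAt_const hN] with q hq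
    refine concatDeformation_eq_of_le h0 (Nat.ceil_le.2 hq.le) ?_ _
    exact (mul_le_of_le_one_left (hT0 _) q.1.2.2).trans (Nat.le_ceil _)
  refine ⟨⟨fun x => F (1, x), by fun_prop⟩, ⟨⟨⟨F, hF⟩, fun x => ?_, fun x => rfl⟩⟩, fun x => ?_⟩
  · simp only [F, Set.Icc.coe_zero, zero_mul]
    rw [concatDeformation_eq_of_le h0 (Nat.zero_le _) (by simp)]
    rfl
  · obtain ⟨N, hN, hNx⟩ := hT x
    simp only [F, ContinuousMap.coe_mk, Set.Icc.coe_one, one_mul]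
    have h1 := concatDeformation_antitone hle (T x) x
      (show N ≤ ⌈T x⌉₊ by exact_mod_cast hN.trans (Nat.le_ceil _))
    rw [← concatDeformation_eq_iterate hN] at hNx
    exact h1.trans hNx.le

end Iteration

/-! ### Transposes with respect to the dot product. -/

section Adjoint

variable {σ τ : Type*} [Fintype σ] [Fintype τ]

open Classical in
/-- The transpose of a linear map between coordinate spaces. -/
noncomputable def transposeMap (A : (σ → ℝ) →L[ℝ] (τ → ℝ)) (w : τ → ℝ) : σ → ℝ :=
  fun j => A (Pi.single j 1) ⬝ᵥ w

theorem apply_dotProduct (A : (σ → ℝ) →L[ℝ] (τ → ℝ)) (v : σ → ℝ) (w : τ → ℝ) :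
    A v ⬝ᵥ w = v ⬝ᵥ transposeMap A w := by
  classical
  have hv : v = ∑ j, v j • Pi.single (M := fun _ => ℝ) j 1 := by
    simp [← Pi.single_smul, Finset.univ_sum_single]
  nth_rewrite 1 [hv]
  simp only [map_sum, map_smul, sum_dotProduct, smul_dotProduct, smul_eq_mul]
  refine Finset.sum_congr rfl fun j _ => ?_
  unfold transposeMap
  congr!

omit [Fintype σ] in
theorem transposeMap_add (A : (σ → ℝ) →L[ℝ] (τ → ℝ)) (v w : τ → ℝ) :
    transposeMap A (v + w) = transposeMap A v + transposeMap A w :=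
  funext fun _ => dotProduct_add _ _ _

omit [Fintype σ] in
theorem transposeMap_smul (A : (σ → ℝ) →L[ℝ] (τ → ℝ)) (c : ℝ) (w : τ → ℝ) :
    transposeMap A (c • w) = c • transposeMap A w :=
  funext fun _ => dotProduct_smul _ _ _

omit [Fintype σ] in
@[simp]
theorem transposeMap_zero (A : (σ → ℝ) →L[ℝ] (τ → ℝ)) : transposeMap A 0 = 0 :=
  funext fun _ => dotProduct_zero _

theorem ContDiffOn.transposeMap {E : Type*} [NormedAddCommGroup E] [NormedSpace ℝ E]
    {n : WithTop ℕ∞} {s : Set E} {A : E → (σ → ℝ) →L[ℝ] (τ → ℝ)} {w : E → τ → ℝ}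
    (hA : ContDiffOn ℝ n A s) (hw : ContDiffOn ℝ n w s) :
    ContDiffOn ℝ n (fun x => transposeMap (A x) (w x)) s := by
  refine contDiffOn_pi.2 fun j => ContDiffOn.sum fun i _ => ?_
  exact (contDiffOn_pi.1 (hA.clm_apply contDiffOn_const) i).mul (contDiffOn_pi.1 hw i)

end Adjoint

/-! ### Compressing a nonsingular algebraic set into a bounded part of itself. -/

section Deformation

variable {σ : Type*} [Fintype σ] {X O : Set (σ → ℝ)} {r : (σ → ℝ) → σ → ℝ}

/-- The vector `u = (Dr)ᵀ x` pairs with tangent vectors as `x` does, so it is nonzero when `x` is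
not normal to `X`. Along `x - s u` the function `|r|²` has derivative `-2 |u|²` at `s = 0`; strict
differentiability makes the decrease uniform near `x₀`. -/
theorem IsSmoothRetraction.eventually_dotProduct_lt (hr : IsSmoothRetraction X O r) {x₀ : σ → ℝ}
    (hx₀ : x₀ ∈ X) (hne : ∃ v ∈ tangentSpace X x₀, x₀ ⬝ᵥ v ≠ 0) :
    ∀ᶠ p : (σ → ℝ) × ℝ in 𝓝 (x₀, 0), p.1 ∈ X → 0 < p.2 →
      r (p.1 - p.2 • transposeMap (fderiv ℝ r p.1) p.1) ⬝ᵥ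
        r (p.1 - p.2 • transposeMap (fderiv ℝ r p.1) p.1) < p.1 ⬝ᵥ p.1 := by
  have hx₀O := hr.subset hx₀
  have hO := hr.isOpen.mem_nhds hx₀O
  let u : (σ → ℝ) → σ → ℝ := fun x => transposeMap (fderiv ℝ r x) x
  have hu : ContDiffAt ℝ ∞ u x₀ :=
    (ContDiffOn.transposeMap hr.contDiffOn_fderiv contDiffOn_id).contDiffAt hO
  let Ψ : (σ → ℝ) × ℝ → σ → ℝ := fun p => r (p.1 - p.2 • u p.1)
  have hΨ : ContDiffAt ℝ ∞ Ψ (x₀, 0) := by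
    refine ContDiffAt.comp (g := r) (f := fun p : (σ → ℝ) × ℝ => p.1 - p.2 • u p.1) (x₀, 0) ?_ ?_
    · simpa using hr.contDiffOn.contDiffAt hO
    · exact contDiffAt_fst.sub (contDiffAt_snd.smul
        (ContDiffAt.comp (g := u) (x₀, (0 : ℝ)) hu contDiffAt_fst))
  let Φ : (σ → ℝ) × ℝ → ℝ := fun p => Ψ p ⬝ᵥ Ψ p
  have hΦ : ContDiffAt ℝ ∞ Φ (x₀, 0) :=
    ContDiffAt.sum fun i _ => (contDiffAt_pi.1 hΨ i).mul (contDiffAt_pi.1 hΨ i)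
  have hstrict := hΦ.hasStrictFDerivAt (by simp)
  have hu0 : 0 < u x₀ ⬝ᵥ u x₀ := by
    refine lt_of_le_of_ne (Finset.sum_nonneg fun i _ => mul_self_nonneg _) fun h => ?_
    obtain ⟨v, hv, hne⟩ := hne
    refine hne ?_
    rw [dotProduct_comm, ← hr.fderiv_apply x₀ hx₀ v hv, apply_dotProduct]
    rw [show transposeMap (fderiv ℝ r x₀) x₀ = 0 from dotProduct_self_eq_zero.1 h.symm,
      dotProduct_zero]
  set c := u x₀ ⬝ᵥ u x₀ with hc
  have hL : fderiv ℝ Φ (x₀, 0) (0, 1) = -2 * c := by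
    have h1 : HasDerivAt (fun s : ℝ => (x₀, s)) ((0 : σ → ℝ), (1 : ℝ)) 0 :=
      (hasDerivAt_const _ _).prodMk (hasDerivAt_id _)
    have h2 := (hstrict.hasFDerivAt.comp_hasDerivAt (0 : ℝ) h1).deriv
    have h3 : HasDerivAt (fun s : ℝ => x₀ - s • u x₀) (-u x₀) 0 := by
      simpa using ((hasDerivAt_id (0 : ℝ)).smul_const (u x₀)).const_sub x₀
    have h4 : HasDerivAt (fun s : ℝ => r (x₀ - s • u x₀)) (fderiv ℝ r x₀ (-u x₀)) 0 := by
      refine HasFDerivAt.comp_hasDerivAt (l := r) (0 : ℝ) ?_ h3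
      simpa using (hr.hasStrictFDerivAt hx₀).hasFDerivAt
    have h5 : HasDerivAt (fun s : ℝ => r (x₀ - s • u x₀) ⬝ᵥ r (x₀ - s • u x₀))
        (∑ i, (fderiv ℝ r x₀ (-u x₀) i * x₀ i + x₀ i * fderiv ℝ r x₀ (-u x₀) i)) 0 := by
      refine HasDerivAt.fun_sum fun i _ => ?_
      simpa [hr.apply_eq x₀ hx₀] using (hasDerivAt_pi.1 h4 i).fun_mul (hasDerivAt_pi.1 h4 i)
    rw [← h2]
    refine h5.deriv.trans ?_
    have h6 : fderiv ℝ r x₀ (-u x₀) ⬝ᵥ x₀ = -c := by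
      rw [apply_dotProduct, neg_dotProduct]
    rw [Finset.sum_add_distrib]
    have h7 : ∑ i, x₀ i * fderiv ℝ r x₀ (-u x₀) i = -c := by
      rw [← h6, dotProduct_comm]
      rfl
    change fderiv ℝ r x₀ (-u x₀) ⬝ᵥ x₀ + _ = _
    rw [h7, h6]
    ring
  -- The error is at most `c s`, which leaves at least half of the first order decrease `2 c s`.
  have h1 := hstrict.isLittleO.def (c := c) hu0
  have h2 : Filter.Tendsto (fun p : (σ → ℝ) × ℝ => (p, (p.1, (0 : ℝ)))) (𝓝 (x₀, 0))
      (𝓝 ((x₀, 0), (x₀, 0))) := Continuous.tendsto (by fun_prop) _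
  filter_upwards [h2.eventually h1] with p hp hpX hp0
  have h3 : Φ (p.1, 0) = p.1 ⬝ᵥ p.1 := by simp [Φ, Ψ, hr.apply_eq _ hpX]
  have h4 : p - (p.1, (0 : ℝ)) = p.2 • ((0 : σ → ℝ), (1 : ℝ)) := by ext <;> simp
  rw [h3, h4, map_smul, hL, norm_smul, Prod.norm_mk, norm_zero, norm_one, Real.norm_eq_abs,
    Real.norm_eq_abs, abs_of_pos hp0] at hp
  have h5 := (abs_le.1 hp).2
  simp only [smul_eq_mul, max_eq_right zero_le_one, mul_one] at h5
  have : 0 < p.2 * c := by positivity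
  change Φ p < _
  linarith

/-- The identity of a nonsingular algebraic set is homotopic to a map with bounded image. -/
theorem exists_homotopic_id_bounded (hX : IsAlgebraicSet X) (hr : IsSmoothRetraction X O r) :
    ∃ (κ : C(X, X)) (R : ℝ), (ContinuousMap.id X).Homotopic κ ∧
      ∀ x, (κ x : σ → ℝ) ⬝ᵥ (κ x : σ → ℝ) ≤ R := by
  obtain ⟨R, hR, hcrit⟩ := exists_forall_dotProduct_ne_zero X
  let ρ : X → ℝ := fun x => (x : σ → ℝ) ⬝ᵥ (x : σ → ℝ)
  have hρ : Continuous ρ := by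
    have h : Continuous fun x : σ → ℝ => x ⬝ᵥ x := by
      unfold dotProduct
      fun_prop
    exact h.comp continuous_subtype_val
  let u : X → σ → ℝ := fun x => transposeMap (fderiv ℝ r x) x
  have huc : Continuous u := by
    have h1 : ContinuousOn (fun x => transposeMap (fderiv ℝ r x) x) O :=
      (ContDiffOn.transposeMap hr.contDiffOn_fderiv contDiffOn_id).continuousOn
    exact h1.comp_continuous continuous_subtype_val fun x => hr.subset x.2
  -- Admissible step lengths form an interval starting at `0`, so a continuous choice exists.
  -- Nothing but positivity is asked where `ρ < R`, since no motion takes place there.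
  obtain ⟨ε, hε⟩ := exists_continuous_forall_mem_convex_of_local_const
    (t := fun x : X => {c : ℝ | 0 < c ∧ (R ≤ ρ x → ∀ s, 0 < s → s ≤ c →
      (x : σ → ℝ) - s • u x ∈ O ∧
        r ((x : σ → ℝ) - s • u x) ⬝ᵥ r ((x : σ → ℝ) - s • u x) < ρ x)}) (fun x => by
      rintro a ⟨ha, ha'⟩ b ⟨hb, hb'⟩ α β hα hβ hαβ
      simp only [smul_eq_mul]
      rcases le_total a b with hab | hab
      · refine ⟨?_, fun hRx s hs0 hs => hb' hRx s hs0 (hs.trans ?_)⟩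
        · have : a ≤ α * a + β * b := by nlinarith
          linarith
        · nlinarith
      · refine ⟨?_, fun hRx s hs0 hs => ha' hRx s hs0 (hs.trans ?_)⟩
        · have : b ≤ α * a + β * b := by nlinarith
          linarith
        · nlinarith) (fun x => by
      rcases lt_or_ge (ρ x) R with hx | hx
      · refine ⟨1, ?_⟩
        filter_upwards [hρ.continuousAt.eventually_lt continuousAt_const hx] with y hy
        exact ⟨one_pos, fun h => absurd h (not_le.2 hy)⟩
      · have h1 := hr.eventually_dotProduct_lt x.2 (hcrit x x.2 hx)
        have h2 : ∀ᶠ p : X × ℝ in 𝓝 (x, 0), (p.1 : σ → ℝ) - p.2 • u p.1 ∈ O := by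
          have : Continuous fun p : X × ℝ => (p.1 : σ → ℝ) - p.2 • u p.1 := by fun_prop
          refine this.continuousAt.preimage_mem_nhds (hr.isOpen.mem_nhds ?_)
          simpa using hr.subset x.2
        have h3 : Filter.Tendsto (fun p : X × ℝ => ((p.1 : σ → ℝ), p.2)) (𝓝 (x, 0))
          (𝓝 ((x : σ → ℝ), 0)) := Continuous.tendsto (by fun_prop) _
        have h4 := (h3.eventually h1).and h2
        rw [nhds_prod_eq, Filter.eventually_prod_iff] at h4
        obtain ⟨p, hp, q, hq, hpq⟩ := h4
        obtain ⟨c, hc, hcq⟩ := Metric.eventually_nhds_iff.1 hq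
        refine ⟨c / 2, ?_⟩
        filter_upwards [hp] with y hy
        refine ⟨by positivity, fun _ s hs hsc => ?_⟩
        have h5 := hpq hy (hcq (y := s) (by rw [Real.dist_eq, sub_zero, abs_of_pos hs]; linarith))
        exact ⟨h5.2, h5.1 y.2 hs⟩)
  -- The factor `lam` stops the motion on `{ρ ≤ R}`, where critical points may occur.
  let lam : X → ℝ := fun x => max 0 (min 1 (ρ x - R))
  have hlam : Continuous lam := by fun_prop
  have hlam0 : ∀ x, 0 ≤ lam x := fun x => le_max_left _ _
  have hlam1 : ∀ x, lam x ≤ 1 := fun x => max_le zero_le_one (min_le_left _ _)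
  have hlam_pos : ∀ x, 0 < lam x → R ≤ ρ x := fun x hx => by
    by_contra! hlt
    refine hx.ne' (max_eq_left ((min_le_right _ _).trans ?_))
    linarith
  let clamp : ℝ → ℝ := fun t => max 0 (min 1 t)
  have hclamp0 : ∀ t, 0 ≤ clamp t := fun x => le_max_left _ _
  have hclamp1 : ∀ t, clamp t ≤ 1 := fun x => max_le zero_le_one (min_le_left _ _)
  let step : ℝ × X → ℝ := fun p => clamp p.1 * lam p.2 * ε p.2
  have hstep : Continuous step := by fun_prop
  have hstep0 : ∀ p, 0 ≤ step p := fun p =>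
    mul_nonneg (mul_nonneg (hclamp0 _) (hlam0 _)) (hε p.2).1.le
  have hstepε : ∀ p, step p ≤ ε p.2 := fun p =>
    mul_le_of_le_one_left (hε p.2).1.le
      (mul_le_one₀ (hclamp1 _) (hlam0 _) (hlam1 _))
  have hstepR : ∀ p, 0 < step p → R ≤ ρ p.2 := fun p hp => hlam_pos _ <| by
    refine lt_of_le_of_ne (hlam0 _) fun h => hp.ne' ?_
    simp only [step]
    rw [← h, mul_zero, zero_mul]
  have hmemO : ∀ p : ℝ × X, (p.2 : σ → ℝ) - step p • u p.2 ∈ O := fun p => by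
    rcases (hstep0 p).eq_or_lt with h | h
    · rw [← h, zero_smul, sub_zero]
      exact hr.subset p.2.2
    · exact ((hε p.2).2 (hstepR p h) _ h (hstepε p)).1
  have hcont : Continuous fun p : ℝ × X => r ((p.2 : σ → ℝ) - step p • u p.2) :=
    hr.contDiffOn.continuousOn.comp_continuous (by fun_prop) hmemO
  let h : C(ℝ × X, X) := ⟨fun p => ⟨r ((p.2 : σ → ℝ) - step p • u p.2), hr.mapsTo (hmemO p)⟩,
    hcont.subtype_mk _⟩
  have hle : ∀ p, ρ (h p) ≤ ρ p.2 := fun p => by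
    rcases (hstep0 p).eq_or_lt with h' | h'
    · refine le_of_eq ?_
      simp only [ρ, h, ContinuousMap.coe_mk]
      rw [← h', zero_smul, sub_zero, hr.apply_eq _ p.2.2]
    · exact ((hε p.2).2 (hstepR p h') _ h' (hstepε p)).2.le
  have hcpt : ∀ C, IsCompact {x : X | ρ x ≤ C} := fun C => by
    rw [Subtype.isCompact_iff]
    refine Metric.isCompact_of_isClosed_isBounded ?_ ?_
    · refine hX.isClosed.isClosedEmbedding_subtypeVal.isClosedMap _
        (isClosed_le hρ continuous_const)
    · refine Metric.isBounded_closedBall (x := (0 : σ → ℝ)) (r := Real.sqrt C) |>.subset ?_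
      rintro _ ⟨x, hx, rfl⟩
      rw [mem_closedBall_zero_iff]
      exact Real.le_sqrt_of_sq_le ((norm_sq_le_dotProduct_self _).trans hx)
  have h0 : ∀ x, h (0, x) = x := fun x => Subtype.ext <| by
    simp [h, step, clamp, hr.apply_eq _ x.2]
  have hlt : ∀ x, R < ρ x → ρ (h (1, x)) < ρ x := fun x hx => by
    have h1 : 0 < step (1, x) := by
      have : 0 < lam x := lt_max_of_lt_right (lt_min one_pos (sub_pos.2 hx))
      simpa [step, clamp] using mul_pos this (hε x).1
    exact ((hε x).2 hx.le _ h1 (hstepε (1, x))).2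
  obtain ⟨κ, hκ, hκR⟩ := exists_homotopic_id_le hρ hcpt h0 (fun t _ x => hle (t, x)) hlt
  exact ⟨κ, _, hκ, hκR⟩

end Deformation

end RealAlg

namespace RealAlg

/-! ### Inverse functions near a compact set. -/

section InverseNearCompact

/-- Smooth inverse function theorem in the neighborhood of a compact set. -/
theorem exists_smooth_inverse_near_compact {E F : Type*} [NormedAddCommGroup E] [NormedSpace ℝ E]
    [CompleteSpace E] [NormedAddCommGroup F] [NormedSpace ℝ F] {f : E → F} {U K G : Set E}
    (hU : IsOpen U) (hf : ContDiffOn ℝ ∞ f U) (hK : IsCompact K) (hKU : K ⊆ U)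
    (hinj : Set.InjOn f K) (hf' : ∀ x ∈ K, ∃ f' : E ≃L[ℝ] F, HasFDerivAt f (f' : E →L[ℝ] F) x)
    (hG : ∀ x ∈ K, G ∈ 𝓝 x) :
    ∃ (Ω : Set F) (g : F → E), IsOpen Ω ∧ f '' K ⊆ Ω ∧ ContDiffOn ℝ ∞ g Ω ∧
      ∀ p ∈ Ω, g p ∈ U ∧ g p ∈ G ∧ f (g p) = p := by
  -- Injectivity on the compact `K` together with local injectivity at its points gives injectivity
  -- on a neighborhood of `K`.
  obtain ⟨t, ht, htinj⟩ := hinj.exists_mem_nhdsSet hK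
    (fun x hx => (hf.contDiffAt (hU.mem_nhds (hKU hx))).continuousAt) (fun x hx => by
      obtain ⟨f', hf'⟩ := hf' x hx
      obtain ⟨e, hxe, -, hef, -⟩ := exists_smooth_local_inverse hU hf (hKU hx) hf'
      refine ⟨e.source, e.open_source.mem_nhds hxe, ?_⟩
      rw [← show (e : E → F) = f from funext hef]
      exact e.injOn)
  have hcont : ContinuousOn (fderiv ℝ f) U := hf.continuousOn_fderiv_of_isOpen hU (by simp)
  let W : Set E := (U ∩ fderiv ℝ f ⁻¹' Set.range ((↑) : (E ≃L[ℝ] F) → E →L[ℝ] F)) ∩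
    (interior t ∩ interior G)
  have hW : IsOpen W := (hcont.isOpen_inter_preimage hU ContinuousLinearEquiv.isOpen).inter
    (isOpen_interior.inter isOpen_interior)
  have hKW : K ⊆ W := fun x hx => by
    obtain ⟨f', hf'⟩ := hf' x hx
    exact ⟨⟨hKU hx, f', hf'.fderiv.symm⟩, mem_interior_iff_mem_nhds.2
      (mem_nhdsSet_iff_forall.1 ht x hx), mem_interior_iff_mem_nhds.2 (hG x hx)⟩
  have hWinj : Set.InjOn f W := htinj.mono fun x hx => interior_subset hx.2.1
  have hloc : ∀ x ∈ W, ∃ e : OpenPartialHomeomorph E F, x ∈ e.source ∧ e.source ⊆ W ∧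
      (∀ x, e x = f x) ∧ ContDiffOn ℝ ∞ e.symm e.target := fun x hx => by
    obtain ⟨f', hf'⟩ := hx.1.2
    refine exists_smooth_local_inverse (f' := f') hW (hf.mono fun y hy => hy.1.1) hx ?_
    rw [hf']
    exact ((hf.contDiffAt (hU.mem_nhds hx.1.1)).differentiableAt (by simp)).hasFDerivAt
  rcases isEmpty_or_nonempty E with hE | hE
  · have : K = ∅ := Set.eq_empty_of_isEmpty K
    exact ⟨∅, fun _ => 0, isOpen_empty, by simp [this], contDiffOn_const, by simp⟩
  refine ⟨f '' W, Function.invFunOn f W, ?_, Set.image_mono hKW, ?_, ?_⟩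
  · refine isOpen_iff_mem_nhds.2 ?_
    rintro _ ⟨x, hx, rfl⟩
    obtain ⟨e, hxe, heW, hef, -⟩ := hloc x hx
    refine Filter.mem_of_superset (e.open_target.mem_nhds (hef x ▸ e.map_source hxe)) fun q hq => ?_
    exact ⟨e.symm q, heW (e.map_target hq), by rw [← hef, e.right_inv hq]⟩
  · rintro _ ⟨x, hx, rfl⟩
    obtain ⟨e, hxe, heW, hef, hes⟩ := hloc x hx
    have hmem : f x ∈ e.target := hef x ▸ e.map_source hxe
    refine ((hes.contDiffAt (e.open_target.mem_nhds hmem)).congr_of_eventuallyEq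
      ?_).contDiffWithinAt
    filter_upwards [e.open_target.mem_nhds hmem] with q hq
    have hq' : f (e.symm q) = q := by rw [← hef, e.right_inv hq]
    have hqW : q ∈ f '' W := ⟨e.symm q, heW (e.map_target hq), hq'⟩
    refine hWinj (Function.invFunOn_mem hqW) (heW (e.map_target hq)) ?_
    rw [Function.invFunOn_eq hqW, hq']
  · intro p hp
    have h := Function.invFunOn_mem hp
    exact ⟨h.1.1, interior_subset h.2.2, Function.invFunOn_eq hp⟩

end InverseNearCompact

/-! ### Inverting a dominating spray near the diagonal. -/

section NearDiagonal

variable {τ : Type*} [Fintype τ] {Y O : Set (τ → ℝ)} {r : (τ → ℝ) → τ → ℝ} {M : ℕ}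
  {S : Y → (Fin M → ℝ) → Y}

/-- The transpose as a continuous linear map. -/
noncomputable def transposeCLM {σ : Type*} [Fintype σ] (A : (σ → ℝ) →L[ℝ] (τ → ℝ)) :
    (τ → ℝ) →L[ℝ] (σ → ℝ) :=
  LinearMap.toContinuousLinearMap
    { toFun := transposeMap A
      map_add' := transposeMap_add A
      map_smul' := transposeMap_smul A }

theorem IsTrivialSpray.fderiv_fderiv (hS : IsTrivialSpray S) (hr : IsSmoothRetraction Y O r)
    (y : Y) (v : Fin M → ℝ) : fderiv ℝ r y (fderiv ℝ (fun v => (S y v : τ → ℝ)) 0 v) =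
      fderiv ℝ (fun v => (S y v : τ → ℝ)) 0 v := by
  have h1 : HasFDerivAt (fun v => (S y v : τ → ℝ)) (fderiv ℝ (fun v => (S y v : τ → ℝ)) 0) 0 :=
    ((hS.contDiff_fiber y).differentiable (by simp) 0).hasFDerivAt
  have h2 : HasFDerivAt r (fderiv ℝ r y) (S y 0 : τ → ℝ) := by
    rw [hS.zero]
    exact (hr.hasStrictFDerivAt y.2).hasFDerivAt
  have h3 := (h2.comp (0 : Fin M → ℝ) h1).fderiv
  have h4 : r ∘ (fun v => (S y v : τ → ℝ)) = fun v => (S y v : τ → ℝ) :=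
    funext fun v => hr.apply_eq _ (S y v).2
  rw [h4] at h3
  exact (DFunLike.congr_fun h3 v).symm

/-- Let `A` be the fiber derivative of the spray at zero. Applying the idempotent `Dr` gives `A Aᵀ w
= 0`, so `Aᵀ w = 0`. Then `w = Dr w` is tangent, hence `w = A v` by domination, and `|w|² = v ⬝ᵥ Aᵀ
w = 0`. -/
theorem IsTrivialSpray.eq_zero_of_normal_eq_zero (hS : IsTrivialSpray S)
    (hr : IsSmoothRetraction Y O r) (y : Y) {w : τ → ℝ}
    (hw : fderiv ℝ (fun v => (S y v : τ → ℝ)) 0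
      (transposeMap (fderiv ℝ (fun v => (S y v : τ → ℝ)) 0) w) + (w - fderiv ℝ r y w) = 0) :
    w = 0 := by
  set A := fderiv ℝ (fun v => (S y v : τ → ℝ)) 0 with hA
  have h1 : A (transposeMap A w) = 0 := by
    have := congrArg (fderiv ℝ r y) hw
    rw [map_add, map_sub, hr.fderiv_fderiv y.2, sub_self, add_zero, map_zero,
      hS.fderiv_fderiv hr] at this
    exact this
  have h2 : transposeMap A w = 0 := by
    rw [← dotProduct_self_eq_zero, ← apply_dotProduct, h1, zero_dotProduct]
  rw [h1, zero_add, sub_eq_zero] at hw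
  obtain ⟨v, hv⟩ := hS.dominating y w (hw ▸ hr.fderiv_mem_tangentSpace y.2 w)
  rw [← dotProduct_self_eq_zero]
  nth_rewrite 1 [← hv]
  rw [apply_dotProduct, h2, dotProduct_zero]

/-- A dominating spray is smoothly invertible near the diagonal. -/
theorem IsTrivialSpray.exists_inverse_near_diagonal (hS : IsTrivialSpray S)
    (hr : IsSmoothRetraction Y O r) {L : Set (τ → ℝ)} (hL : IsCompact L) (hLY : L ⊆ Y) :
    ∃ (Ω : Set ((τ → ℝ) × (τ → ℝ))) (ν : (τ → ℝ) × (τ → ℝ) → Fin M → ℝ), IsOpen Ω ∧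
      (∀ y ∈ L, (y, y) ∈ Ω) ∧ ContDiffOn ℝ ∞ ν Ω ∧
      ∀ y z : Y, ((y : τ → ℝ), (z : τ → ℝ)) ∈ Ω → S y (ν (y, z)) = z := by
  let T : (τ → ℝ) × (Fin M → ℝ) → τ → ℝ := fun p =>
    extendZero (fun y => (S y p.2 : τ → ℝ)) (r p.1)
  have hTY : ∀ (y : Y) v, T (y, v) = S y v := fun y v => by
    simp only [T]
    rw [hr.apply_eq y y.2, extendZero_coe]
  have hTmem : ∀ y ∈ O, ∀ v, T (y, v) ∈ Y := fun y hy v => by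
    simp only [T]
    rw [extendZero_of_mem _ (hr.mapsTo hy)]
    exact Subtype.coe_prop _
  have hT : ContDiffOn ℝ ∞ T (O ×ˢ Set.univ) :=
    hS.contDiffOn_comp (hr.isOpen.prod isOpen_univ)
      (hr.contDiffOn.comp contDiffOn_fst fun p hp => hp.1) contDiffOn_snd
      (fun p hp => hr.mapsTo hp.1)
  let A : (τ → ℝ) → (Fin M → ℝ) →L[ℝ] (τ → ℝ) := fun y =>
    (fderiv ℝ T (y, 0)).comp (ContinuousLinearMap.inr ℝ (τ → ℝ) (Fin M → ℝ))
  have hA : ContDiffOn ℝ ∞ A O :=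
    ((hT.fderiv_of_isOpen (m := ∞) (hr.isOpen.prod isOpen_univ) (by simp)).comp
      (f := fun y : τ → ℝ => (y, (0 : Fin M → ℝ)))
      (contDiff_id.prodMk contDiff_const).contDiffOn
      fun y hy => ⟨hy, trivial⟩).clm_comp contDiffOn_const
  have hAY : ∀ y : Y, A y = fderiv ℝ (fun v => (S y v : τ → ℝ)) 0 := fun y => by
    have h1 : HasFDerivAt T (fderiv ℝ T ((y : τ → ℝ), 0)) ((y : τ → ℝ), 0) :=
      ((hT.contDiffAt ((hr.isOpen.prod isOpen_univ).mem_nhds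
        ⟨hr.subset y.2, trivial⟩)).differentiableAt (by simp)).hasFDerivAt
    have h2 := (h1.comp (0 : Fin M → ℝ) (hasFDerivAt_prodMk_right (y : τ → ℝ) 0)).fderiv
    rw [← show T ∘ (fun v => ((y : τ → ℝ), v)) = fun v => (S y v : τ → ℝ) from
      funext fun v => hTY y v]
    exact h2.symm
  let N : (τ → ℝ) × (τ → ℝ) → τ → ℝ := fun p => T (p.1, transposeMap (A p.1) p.2)
  -- Restricting the parameters to the range of `Aᵀ` removes the redundancy of the spray, and adding
  -- the normal part `w - Dr w` makes both sides equidimensional. At `(y, 0)` the `w`-derivative of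
  -- the second component is `A Aᵀ + (1 - Dr)`.
  let Θ : (τ → ℝ) × (τ → ℝ) → (τ → ℝ) × (τ → ℝ) := fun p =>
    (p.1, N p + (p.2 - fderiv ℝ r p.1 p.2))
  have hU : IsOpen (O ×ˢ (Set.univ : Set (τ → ℝ))) := hr.isOpen.prod isOpen_univ
  have hν₀ : ContDiffOn ℝ ∞ (fun p : (τ → ℝ) × (τ → ℝ) => transposeMap (A p.1) p.2)
      (O ×ˢ Set.univ) :=
    ContDiffOn.transposeMap (hA.comp contDiffOn_fst fun p hp => hp.1) contDiffOn_snd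
  have hN : ContDiffOn ℝ ∞ N (O ×ˢ Set.univ) :=
    hT.comp (contDiffOn_fst.prodMk hν₀) fun p hp => ⟨hp.1, trivial⟩
  have hΘ : ContDiffOn ℝ ∞ Θ (O ×ˢ Set.univ) := by
    refine contDiffOn_fst.prodMk (hN.add (contDiffOn_snd.sub ?_))
    exact (hr.contDiffOn_fderiv.comp contDiffOn_fst fun p hp => hp.1).clm_apply contDiffOn_snd
  have hN0 : ∀ y ∈ Y, N (y, 0) = y := fun y hy => by
    simp only [N, transposeMap_zero]
    exact (hTY ⟨y, hy⟩ 0).trans (congrArg _ (hS.zero _))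
  have hΘ0 : ∀ y ∈ Y, Θ (y, 0) = (y, y) := fun y hy => by
    simp [Θ, hN0 y hy]
  have hder : ∀ y ∈ Y, Function.Injective (fderiv ℝ Θ (y, 0)) := fun y hy => by
    have hd : HasFDerivAt Θ (fderiv ℝ Θ (y, 0)) (y, 0) :=
      ((hΘ.contDiffAt (hU.mem_nhds ⟨hr.subset hy, trivial⟩)).differentiableAt
        (by simp)).hasFDerivAt
    refine (injective_iff_map_eq_zero _).2 fun p hp => ?_
    have h1 : p.1 = 0 := by
      have h := (hasFDerivAt_fst (𝕜 := ℝ) (E := τ → ℝ) (F := τ → ℝ)).comp (y, (0 : τ → ℝ)) hd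
      have h' := DFunLike.congr_fun (h.unique (hasFDerivAt_fst (𝕜 := ℝ))) p
      rw [ContinuousLinearMap.comp_apply, hp] at h'
      exact h'.symm
    have h2 := (hd.comp (0 : τ → ℝ) (hasFDerivAt_prodMk_right y 0))
    set B := fderiv ℝ (fun v => (S ⟨y, hy⟩ v : τ → ℝ)) 0 with hB
    have h3 : HasFDerivAt (fun w => (S ⟨y, hy⟩ (transposeCLM B w) : τ → ℝ))
        (B.comp (transposeCLM B)) 0 := by
      refine HasFDerivAt.comp (g := fun v => (S ⟨y, hy⟩ v : τ → ℝ)) (0 : τ → ℝ) ?_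
        (transposeCLM B).hasFDerivAt
      rw [map_zero]
      exact ((hS.contDiff_fiber ⟨y, hy⟩).differentiable (by simp) 0).hasFDerivAt
    have h4 : HasFDerivAt (fun w => Θ (y, w)) ((0 : (τ → ℝ) →L[ℝ] (τ → ℝ)).prod
        (B.comp (transposeCLM B) + (ContinuousLinearMap.id ℝ _ - fderiv ℝ r y))) 0 := by
      refine (hasFDerivAt_const _ _).prodMk (HasFDerivAt.add ?_
        ((hasFDerivAt_id _).sub (fderiv ℝ r y).hasFDerivAt))
      refine h3.congr_of_eventuallyEq (Filter.Eventually.of_forall fun w => ?_)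
      simp only [N]
      rw [hAY ⟨y, hy⟩]
      exact hTY ⟨y, hy⟩ _
    have h5 := DFunLike.congr_fun (h2.unique h4) p.2
    have h6 : (fderiv ℝ Θ (y, 0)) (0, p.2) = 0 := by
      rw [← hp]
      exact congrArg _ (Prod.ext h1.symm rfl)
    have h7 := h5.symm.trans h6
    have h8 : p.2 = 0 :=
      hS.eq_zero_of_normal_eq_zero hr ⟨y, hy⟩ (congrArg Prod.snd h7)
    exact Prod.ext h1 h8
  -- If `Θ p = (y, z)` with `y, z` in `Y`, then `z` and the spray value `N p`, both in `Y`, differ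
  -- by a vector killed by `Dr(y)`. Near the diagonal they coincide, so the normal part vanishes and
  -- `N p = z`.
  have hgood : ∀ y₀ ∈ Y, ∀ᶠ p in 𝓝 (y₀, (0 : τ → ℝ)), p.1 ∈ Y → (Θ p).2 ∈ Y →
      p.2 - fderiv ℝ r p.1 p.2 = 0 := fun y₀ hy₀ => by
    have h1 := hr.eventually_eq_of_fderiv_sub_eq_zero hy₀
    have hmem : O ×ˢ (Set.univ : Set (τ → ℝ)) ∈ 𝓝 (y₀, (0 : τ → ℝ)) :=
      hU.mem_nhds ⟨hr.subset hy₀, trivial⟩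
    have h2 : Filter.Tendsto (fun p => (p.1, (Θ p).2, N p)) (𝓝 (y₀, (0 : τ → ℝ)))
        (𝓝 (y₀, y₀, y₀)) := by
      have hc : ContinuousAt (fun p => (p.1, (Θ p).2, N p)) (y₀, (0 : τ → ℝ)) :=
        continuousAt_fst.prodMk ((hΘ.contDiffAt hmem).continuousAt.snd.prodMk
          (hN.contDiffAt hmem).continuousAt)
      have := hc.tendsto
      rwa [hΘ0 y₀ hy₀, hN0 y₀ hy₀] at this
    filter_upwards [h2.eventually h1, hmem] with p hp hpU hpY hpΘ
    have h3 : (Θ p).2 - N p = p.2 - fderiv ℝ r p.1 p.2 := by simp [Θ]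
    rw [← h3, sub_eq_zero]
    refine hp hpΘ (hTmem _ hpU.1 _) ?_
    simp only [h3, map_sub]
    rw [hr.fderiv_fderiv hpY, sub_self]
  obtain ⟨Ω, g, hΩ, hLΩ, hg, hgΩ⟩ := exists_smooth_inverse_near_compact
    (K := (fun y : τ → ℝ => (y, (0 : τ → ℝ))) '' L)
    (G := {p | p.1 ∈ Y → (Θ p).2 ∈ Y → p.2 - fderiv ℝ r p.1 p.2 = 0}) hU hΘ
    (hL.image (by fun_prop)) (by
      rintro _ ⟨y, hy, rfl⟩
      exact ⟨hr.subset (hLY hy), trivial⟩) (by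
      rintro _ ⟨y, hy, rfl⟩ _ ⟨z, hz, rfl⟩ h
      have h' : y = z := (Prod.ext_iff.1 h).1
      rw [h']) (by
      rintro _ ⟨y, hy, rfl⟩
      refine ⟨(LinearEquiv.ofInjectiveEndo (fderiv ℝ Θ (y, 0)).toLinearMap
        (hder y (hLY hy))).toContinuousLinearEquiv, ?_⟩
      exact ((hΘ.contDiffAt (hU.mem_nhds ⟨hr.subset (hLY hy), trivial⟩)).differentiableAt
        (by simp)).hasFDerivAt) (by
      rintro _ ⟨y, hy, rfl⟩
      exact hgood y (hLY hy))
  refine ⟨Ω, fun p => transposeMap (A (g p).1) (g p).2, hΩ, fun y hy => hLΩ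
    ⟨(y, 0), ⟨y, hy, rfl⟩, hΘ0 y (hLY hy)⟩, hν₀.comp hg fun p hp => (hgΩ p hp).1, ?_⟩
  intro y z hyz
  obtain ⟨-, h2, h3⟩ := hgΩ _ hyz
  have h4 : (g (y, z)).1 = y := congrArg Prod.fst h3
  have h5 : N (g (y, z)) + ((g (y, z)).2 - fderiv ℝ r (g (y, z)).1 (g (y, z)).2) = z :=
    congrArg Prod.snd h3
  have h6 := h2 (by rw [h4]; exact y.2) (by rw [h3]; exact z.2)
  rw [h6, add_zero] at h5
  refine Subtype.ext ((hTY _ _).symm.trans (Eq.trans ?_ h5))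
  change T (y, transposeMap (A (g (y, z)).1) (g (y, z)).2) = T ((g (y, z)).1, _)
  rw [h4]

end NearDiagonal

end RealAlg

namespace RealAlg

/-! ### Convergence with all derivatives, and its stability under composition. -/

section SmoothConvergence

universe w

variable {ι : Type*} {E F F' : Type w} [NormedAddCommGroup E] [NormedSpace ℝ E]
  [NormedAddCommGroup F] [NormedSpace ℝ F] [NormedAddCommGroup F'] [NormedSpace ℝ F']

/-- The functions `u i` and their derivatives of order at most `k` converge to those of `v` along
`l`, continuously at the point `x`. -/
def TendstoSmoothlyAt (l : Filter ι) (x : E) : ℕ → ∀ {F : Type w} [NormedAddCommGroup F]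
    [NormedSpace ℝ F], (ι → E → F) → (E → F) → Prop
  | 0, _, _, _, u, v => Filter.Tendsto (fun p : ι × E => u p.1 p.2) (l ×ˢ 𝓝 x) (𝓝 (v x))
  | k + 1, _, _, _, u, v =>
    Filter.Tendsto (fun p : ι × E => u p.1 p.2) (l ×ˢ 𝓝 x) (𝓝 (v x)) ∧
      ((∀ᶠ p : ι × E in l ×ˢ 𝓝 x, DifferentiableAt ℝ (u p.1) p.2) ∧
        ∀ᶠ y in 𝓝 x, DifferentiableAt ℝ v y) ∧
        TendstoSmoothlyAt l x k (fun i => fderiv ℝ (u i)) (fderiv ℝ v)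

theorem _root_.ContDiffAt.eventually_differentiableAt {v : E → F} {x : E}
    (hv : ContDiffAt ℝ ∞ v x) : ∀ᶠ y in 𝓝 x, DifferentiableAt ℝ v y :=
  ((hv.of_le (m := 1) (by simp)).eventually (by simp)).mono fun _ hy =>
    hy.differentiableAt (by simp)

omit [NormedSpace ℝ E] in
theorem eventually_eventually_nhds_prod {l : Filter ι} {x : E} {P : ι → E → Prop}
    (h : ∀ᶠ p : ι × E in l ×ˢ 𝓝 x, P p.1 p.2) :
    ∀ᶠ p : ι × E in l ×ˢ 𝓝 x, ∀ᶠ y in 𝓝 p.2, P p.1 y := by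
  obtain ⟨a, ha, b, hb, hab⟩ := Filter.eventually_prod_iff.1 h
  exact Filter.eventually_prod_iff.2 ⟨a, ha, _, eventually_eventually_nhds.2 hb,
    fun hi y hy => hy.mono fun z hz => hab hi hz⟩

namespace TendstoSmoothlyAt

variable {l : Filter ι} {x : E} {k : ℕ} {u u' : ι → E → F} {v v' : E → F}

theorem tendsto (h : TendstoSmoothlyAt l x k u v) :
    Filter.Tendsto (fun p : ι × E => u p.1 p.2) (l ×ˢ 𝓝 x) (𝓝 (v x)) := by
  cases k with
  | zero => exact h
  | succ k => exact h.1

theorem of_succ (h : TendstoSmoothlyAt l x (k + 1) u v) : TendstoSmoothlyAt l x k u v := by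
  induction k generalizing F with
  | zero => exact h.1
  | succ k ih => exact ⟨h.1, h.2.1, ih h.2.2⟩

theorem congr (h : TendstoSmoothlyAt l x k u v)
    (hu : ∀ᶠ p : ι × E in l ×ˢ 𝓝 x, u' p.1 p.2 = u p.1 p.2) (hv : v' =ᶠ[𝓝 x] v) :
    TendstoSmoothlyAt l x k u' v' := by
  induction k generalizing F with
  | zero =>
    change Filter.Tendsto _ _ _
    rw [hv.eq_of_nhds]
    exact (Filter.Tendsto.congr' (hu.mono fun p hp => hp.symm) h)
  | succ k ih =>
    have hu' := eventually_eventually_nhds_prod (P := fun i y => u' i y = u i y) hu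
    refine ⟨?_, ⟨?_, ?_⟩, ih h.2.2 ?_ hv.fderiv⟩
    · rw [hv.eq_of_nhds]
      exact (Filter.Tendsto.congr' (hu.mono fun p hp => hp.symm) h.1)
    · filter_upwards [hu', h.2.1.1] with p hp hd
      exact hd.congr_of_eventuallyEq hp
    · filter_upwards [hv.eventually_nhds, h.2.1.2] with y hy hd
      exact hd.congr_of_eventuallyEq hy
    · filter_upwards [hu'] with p hp
      exact Filter.EventuallyEq.fderiv_eq hp

theorem const (hv : ContDiffAt ℝ ∞ v x) : TendstoSmoothlyAt l x k (fun _ => v) v := by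
  induction k generalizing F with
  | zero => exact hv.continuousAt.tendsto.comp Filter.tendsto_snd
  | succ k ih =>
    have hd := hv.eventually_differentiableAt
    exact ⟨hv.continuousAt.tendsto.comp Filter.tendsto_snd,
      ⟨Filter.tendsto_snd.eventually hd, hd⟩, ih (hv.fderiv_right (by simp))⟩

theorem clm_comp (L : F →L[ℝ] F') (h : TendstoSmoothlyAt l x k u v) :
    TendstoSmoothlyAt l x k (fun i y => L (u i y)) (fun y => L (v y)) := by
  induction k generalizing F F' with
  | zero => exact (L.continuous.tendsto _).comp h
  | succ k ih =>
    refine ⟨(L.continuous.tendsto _).comp h.1,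
      ⟨h.2.1.1.mono fun p hp => L.differentiableAt.comp p.2 hp,
        h.2.1.2.mono fun y hy => L.differentiableAt.comp y hy⟩, ?_⟩
    refine (ih (ContinuousLinearMap.compL ℝ E F F' L) h.2.2).congr ?_ ?_
    · filter_upwards [h.2.1.1] with p hp
      exact (L.hasFDerivAt.comp p.2 hp.hasFDerivAt).fderiv
    · filter_upwards [h.2.1.2] with y hy
      exact (L.hasFDerivAt.comp y hy.hasFDerivAt).fderiv

theorem prodMk {w : ι → E → F'} {z : E → F'} (h : TendstoSmoothlyAt l x k u v)
    (h' : TendstoSmoothlyAt l x k w z) :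
    TendstoSmoothlyAt l x k (fun i y => (u i y, w i y)) (fun y => (v y, z y)) := by
  induction k generalizing F F' with
  | zero => exact Filter.Tendsto.prodMk_nhds h h'
  | succ k ih =>
    refine ⟨h.1.prodMk_nhds h'.1, ⟨?_, ?_⟩, ?_⟩
    · filter_upwards [h.2.1.1, h'.2.1.1] with p hp hp' using hp.prodMk hp'
    · filter_upwards [h.2.1.2, h'.2.1.2] with p hp hp' using hp.prodMk hp'
    refine ((ih h.2.2 h'.2.2).clm_comp
      (ContinuousLinearMap.prodₗᵢ ℝ :
        (E →L[ℝ] F) × (E →L[ℝ] F') ≃ₗᵢ[ℝ] (E →L[ℝ] F × F')).toContinuousLinearEquiv).congr ?_ ?_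
    · filter_upwards [h.2.1.1, h'.2.1.1] with p hp hp'
      exact (hp.hasFDerivAt.prodMk hp'.hasFDerivAt).fderiv
    · filter_upwards [h.2.1.2, h'.2.1.2] with p hp hp'
      exact (hp.hasFDerivAt.prodMk hp'.hasFDerivAt).fderiv

/-- Composition with a smooth map is continuous for smooth convergence. -/
theorem contDiffAt_comp {H : F → F'} (hH : ContDiffAt ℝ ∞ H (v x))
    (h : TendstoSmoothlyAt l x k u v) (hv : ContDiffAt ℝ ∞ v x) :
    TendstoSmoothlyAt l x k (fun i y => H (u i y)) (fun y => H (v y)) := by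
  induction k generalizing F F' with
  | zero => exact hH.continuousAt.tendsto.comp h
  | succ k ih =>
    have hd := hH.eventually_differentiableAt
    have hd1 := h.1.eventually hd
    have hd2 := hv.continuousAt.eventually hd
    refine ⟨hH.continuousAt.tendsto.comp h.1, ⟨?_, ?_⟩, ?_⟩
    · filter_upwards [h.2.1.1, hd1] with p hp hp' using hp'.comp p.2 hp
    · filter_upwards [h.2.1.2, hd2] with p hp hp' using hp'.comp p hp
    have hH' : ContDiffAt ℝ ∞ (fderiv ℝ H) (v x) := hH.fderiv_right (by simp)
    -- By the chain rule the derivative is the bilinear composition of `DH ∘ u` and `Du`; the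
    -- induction hypothesis applies to `DH ∘ u` and then to this composition.
    have hc : ContDiff ℝ ∞ fun q : (F →L[ℝ] F') × (E →L[ℝ] F) => q.1.comp q.2 :=
      isBoundedBilinearMap_comp.contDiff
    refine (ih (v := fun y => (fderiv ℝ H (v y), fderiv ℝ v y)) hc.contDiffAt
      ((ih hH' h.of_succ hv).prodMk h.2.2)
      ((hH'.comp x hv).prodMk (hv.fderiv_right (by simp)))).congr ?_ ?_
    · filter_upwards [h.2.1.1, hd1] with p hp hp'
      exact (hp'.hasFDerivAt.comp p.2 hp.hasFDerivAt).fderiv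
    · filter_upwards [h.2.1.2, hd2] with p hp hp'
      exact (hp'.hasFDerivAt.comp p hp.hasFDerivAt).fderiv

/-- Precomposition with a smooth map preserves smooth convergence. -/
theorem comp_contDiffAt {E' : Type w} [NormedAddCommGroup E'] [NormedSpace ℝ E'] {φ : E' → E}
    {z : E'} (hφ : ContDiffAt ℝ ∞ φ z) (h : TendstoSmoothlyAt l (φ z) k u v)
    (hv : ContDiffAt ℝ ∞ v (φ z)) :
    TendstoSmoothlyAt l z k (fun i y => u i (φ y)) (fun y => v (φ y)) := by
  have ht : Filter.Tendsto (fun p : ι × E' => (p.1, φ p.2)) (l ×ˢ 𝓝 z) (l ×ˢ 𝓝 (φ z)) :=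
    Filter.tendsto_fst.prodMk (hφ.continuousAt.tendsto.comp Filter.tendsto_snd)
  induction k generalizing F with
  | zero => exact Filter.Tendsto.comp h ht
  | succ k ih =>
    have hd := hφ.eventually_differentiableAt
    have hd1 := ht.eventually h.2.1.1
    have hd2 := hφ.continuousAt.eventually h.2.1.2
    have hd3 := Filter.tendsto_snd (f := l) |>.eventually hd
    refine ⟨Filter.Tendsto.comp h.1 ht, ⟨?_, ?_⟩, ?_⟩
    · filter_upwards [hd1, hd3] with p hp hp' using hp.comp p.2 hp'
    · filter_upwards [hd2, hd] with p hp hp' using hp.comp p hp'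
    have hc : ContDiff ℝ ∞ fun q : (E →L[ℝ] F) × (E' →L[ℝ] E) => q.1.comp q.2 :=
      isBoundedBilinearMap_comp.contDiff
    have hv' : ContDiffAt ℝ ∞ (fderiv ℝ v) (φ z) := hv.fderiv_right (by simp)
    have hφ' : ContDiffAt ℝ ∞ (fderiv ℝ φ) z := hφ.fderiv_right (by simp)
    refine (contDiffAt_comp (v := fun y => (fderiv ℝ v (φ y), fderiv ℝ φ y)) hc.contDiffAt
      ((ih h.2.2 hv').prodMk (const hφ')) ((hv'.comp z hφ).prodMk hφ')).congr ?_ ?_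
    · filter_upwards [hd1, hd3] with p hp hp'
      exact (hp.hasFDerivAt.comp p.2 hp'.hasFDerivAt).fderiv
    · filter_upwards [hd2, hd] with p hp hp'
      exact (hp.hasFDerivAt.comp p hp'.hasFDerivAt).fderiv

theorem tendsto_iteratedFDeriv (h : TendstoSmoothlyAt l x k u v) {j : ℕ} (hj : j ≤ k) :
    Filter.Tendsto (fun p : ι × E => iteratedFDeriv ℝ j (u p.1) p.2) (l ×ˢ 𝓝 x)
      (𝓝 (iteratedFDeriv ℝ j v x)) := by
  induction j generalizing F k with
  | zero =>
    simp only [iteratedFDeriv_zero_eq_comp, Function.comp_apply]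
    exact ((continuousMultilinearCurryFin0 ℝ E F).symm.continuous.tendsto _).comp h.tendsto
  | succ j ih =>
    obtain ⟨k, rfl⟩ : ∃ k', k = k' + 1 := ⟨k - 1, by omega⟩
    simp only [iteratedFDeriv_succ_eq_comp_right, Function.comp_apply]
    exact ((continuousMultilinearCurryRightEquiv' ℝ j E F).symm.continuous.tendsto _).comp
      (ih h.2.2 (by omega))

/-- A strict bound on the distance between the derivatives of `v₀` and `v` over a compact set is
inherited by smooth approximations of `v`. -/
theorem eventually_norm_iteratedFDeriv_sub_lt {K : Set E} (hK : IsCompact K) {v₀ : E → F}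
    (hv₀ : ∀ x ∈ K, ContDiffAt ℝ ∞ v₀ x) (h : ∀ x ∈ K, TendstoSmoothlyAt l x k u v) {ε : ℝ}
    (hε : ∀ j ≤ k, ∀ x ∈ K, ‖iteratedFDeriv ℝ j v₀ x - iteratedFDeriv ℝ j v x‖ < ε) :
    ∀ᶠ i in l, ∀ j ≤ k, ∀ x ∈ K,
      ‖iteratedFDeriv ℝ j v₀ x - iteratedFDeriv ℝ j (u i) x‖ < ε := by
  have key : ∀ j ≤ k, ∀ᶠ i in l, ∀ x ∈ K,
      ‖iteratedFDeriv ℝ j v₀ x - iteratedFDeriv ℝ j (u i) x‖ < ε := fun j hj => by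
    have hloc : ∀ x ∈ K, ∀ᶠ p : ι × E in l ×ˢ 𝓝 x,
        ‖iteratedFDeriv ℝ j v₀ p.2 - iteratedFDeriv ℝ j (u p.1) p.2‖ < ε := fun x hx => by
      have h1 : Filter.Tendsto (fun p : ι × E => iteratedFDeriv ℝ j v₀ p.2) (l ×ˢ 𝓝 x)
          (𝓝 (iteratedFDeriv ℝ j v₀ x)) :=
        ((const (hv₀ x hx)).tendsto_iteratedFDeriv hj)
      have h2 := (h1.sub ((h x hx).tendsto_iteratedFDeriv hj)).norm
      exact h2.eventually (gt_mem_nhds (hε j hj x hx))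
    have h3 : ∀ᶠ p : ι × E in l ×ˢ 𝓝ˢ K,
        ‖iteratedFDeriv ℝ j v₀ p.2 - iteratedFDeriv ℝ j (u p.1) p.2‖ < ε :=
      hK.mem_prod_nhdsSet_of_forall hloc
    obtain ⟨a, ha, b, hb, hab⟩ := Filter.eventually_prod_iff.1 h3
    filter_upwards [ha] with i hi x hx
    exact hab hi (hb.self_of_nhdsSet x hx)
  exact (Filter.eventually_all_finite (Set.finite_Iic k)).2 key

end TendstoSmoothlyAt
end SmoothConvergence
end RealAlg

namespace RealAlg

/-! ### Uniform polynomial approximation. -/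

section Weierstrass

/-- The Weierstrass approximation theorem on a compact space embedded into affine space. -/
theorem exists_mvPolynomial_near {σ K : Type*} [TopologicalSpace K] [CompactSpace K]
    (c : C(K, σ → ℝ)) (hc : Function.Injective c) (f : C(K, ℝ)) {ε : ℝ} (hε : 0 < ε) :
    ∃ P : MvPolynomial σ ℝ, ∀ x, |MvPolynomial.eval (c x) P - f x| < ε := by
  let Φ : MvPolynomial σ ℝ →ₐ[ℝ] C(K, ℝ) :=
    MvPolynomial.aeval fun i => ⟨fun x => c x i, by fun_prop⟩
  have hΦ : ∀ P x, Φ P x = MvPolynomial.eval (c x) P := fun P x => by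
    induction P using MvPolynomial.induction_on with
    | C a => simp [Φ]
    | add p q hp hq => simp [hp, hq]
    | mul_X p i hp => simp only [map_mul, ContinuousMap.mul_apply, hp]; simp [Φ]
  have hsep : Φ.range.SeparatesPoints := fun x y hxy => by
    obtain ⟨i, hi⟩ := Function.ne_iff.1 (hc.ne hxy)
    refine ⟨Φ (MvPolynomial.X i), ⟨Φ (MvPolynomial.X i), ⟨MvPolynomial.X i, rfl⟩, rfl⟩, ?_⟩
    simpa [hΦ] using hi
  obtain ⟨⟨_, P, rfl⟩, hP⟩ :=
    ContinuousMap.exists_mem_subalgebra_near_continuous_of_separatesPoints Φ.range hsep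
      f f.continuous ε hε
  refine ⟨P, fun x => ?_⟩
  rw [← hΦ P x]
  exact hP x

end Weierstrass

/-! ### Polynomial approximation with all derivatives, by convolution. -/

section SmoothWeierstrass

open MeasureTheory Convolution

universe w

variable {σ : Type w} [Fintype σ] {F : Type w} [NormedAddCommGroup F] [NormedSpace ℝ F]

/-- The integrand is a polynomial in `x` whose coefficients are polynomials in `t` times `g`;
integration leaves moments of `g` as coefficients. -/
theorem exists_eval_eq_integral (q : MvPolynomial σ ℝ) {g : (σ → ℝ) → ℝ} (hg : Continuous g)
    (hgc : HasCompactSupport g) : ∃ P : MvPolynomial σ ℝ, ∀ x,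
      MvPolynomial.eval x P = ∫ t, MvPolynomial.eval (x - t) q * g t := by
  have hint : ∀ (q : MvPolynomial σ ℝ) {g : (σ → ℝ) → ℝ}, Continuous g → HasCompactSupport g →
      ∀ x, Integrable fun t => MvPolynomial.eval (x - t) q * g t := fun q g hg hgc x =>
    Continuous.integrable_of_hasCompactSupport
      (((MvPolynomial.continuous_eval q).comp (by fun_prop)).mul hg) hgc.mul_left
  induction q using MvPolynomial.induction_on generalizing g with
  | C a =>
    refine ⟨MvPolynomial.C (∫ t, a * g t), fun x => by simp⟩
  | add p q hp hq =>
    obtain ⟨P, hP⟩ := hp hg hgc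
    obtain ⟨Q, hQ⟩ := hq hg hgc
    refine ⟨P + Q, fun x => ?_⟩
    rw [map_add, hP, hQ, ← integral_add (hint _ hg hgc x) (hint _ hg hgc x)]
    simp [add_mul]
  | mul_X p i hp =>
    -- In the factor `xᵢ - tᵢ`, the part `tᵢ` is absorbed into `g`, which is why the induction lets
    -- `g` vary.
    have hg' : Continuous fun t : σ → ℝ => t i * g t := by fun_prop
    have hgc' : HasCompactSupport fun t : σ → ℝ => t i * g t := hgc.mul_left
    obtain ⟨P, hP⟩ := hp hg hgc
    obtain ⟨Q, hQ⟩ := hp hg' hgc'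
    refine ⟨MvPolynomial.X i * P - Q, fun x => ?_⟩
    rw [map_sub, map_mul, MvPolynomial.eval_X, hP, hQ, ← integral_const_mul,
      ← integral_sub ((hint _ hg hgc x).const_mul _) (hint _ hg' hgc' x)]
    refine integral_congr_ae (Filter.Eventually.of_forall fun t => ?_)
    simp only [map_mul, MvPolynomial.eval_X, Pi.sub_apply]
    ring

theorem fderiv_lsmul_convolution {q : (σ → ℝ) → ℝ} (hq : Continuous q) {g : (σ → ℝ) → F}
    (hg : ContDiff ℝ 1 g) (hgc : HasCompactSupport g) :
    (∀ x, DifferentiableAt ℝ (q ⋆[ContinuousLinearMap.lsmul ℝ ℝ, volume] g) x) ∧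
    fderiv ℝ (q ⋆[ContinuousLinearMap.lsmul ℝ ℝ, volume] g) =
      (q ⋆[ContinuousLinearMap.lsmul ℝ ℝ, volume] fderiv ℝ g) := by
  have h := fun x => hgc.hasFDerivAt_convolution_right (ContinuousLinearMap.lsmul ℝ ℝ)
    (μ := volume) hq.locallyIntegrable hg x
  refine ⟨fun x => (h x).differentiableAt, funext fun x => (h x).fderiv.trans ?_⟩
  rfl

/-- A sequence of polynomials that is an approximate identity for functions supported in the ball
of radius `R` around the origin. -/
structure IsPolyApproxIdentity (R : ℝ) (φ : ℕ → ContDiffBump (0 : σ → ℝ))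
    (q : ℕ → MvPolynomial σ ℝ) : Prop where
  tendsto : Filter.Tendsto (fun k => (φ k).rOut) Filter.atTop (𝓝 0)
  near : ∀ k, ∀ x ∈ Metric.closedBall (0 : σ → ℝ) (2 * R),
    |MvPolynomial.eval x (q k) - (φ k).normed volume x| < 1 / ((k : ℝ) + 1)

theorem exists_isPolyApproxIdentity (R : ℝ) :
    ∃ (φ : ℕ → ContDiffBump (0 : σ → ℝ)) (q : ℕ → MvPolynomial σ ℝ),
      IsPolyApproxIdentity R φ q := by
  let φ : ℕ → ContDiffBump (0 : σ → ℝ) := fun k =>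
    ⟨1 / ((k : ℝ) + 1) / 2, 1 / ((k : ℝ) + 1), by positivity, half_lt_self (by positivity)⟩
  have := isCompact_iff_compactSpace.1 (isCompact_closedBall (0 : σ → ℝ) (2 * R))
  choose q hq using fun k : ℕ => exists_mvPolynomial_near
    (⟨Subtype.val, continuous_subtype_val⟩ : C(Metric.closedBall (0 : σ → ℝ) (2 * R), σ → ℝ))
    Subtype.val_injective ⟨fun x => (φ k).normed volume x,
      ((φ k).continuous_normed (μ := volume)).comp continuous_subtype_val⟩
    (ε := 1 / ((k : ℝ) + 1)) (by positivity)
  exact ⟨φ, q, tendsto_one_div_add_atTop_nhds_zero_nat, fun k x hx => hq k ⟨x, hx⟩⟩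

/-- Convolution with the shrinking bumps converges to `g`; replacing the `k`-th bump by its
polynomial costs at most `∫ ‖g‖ / (k + 1)`. -/
theorem IsPolyApproxIdentity.tendsto_convolution [CompleteSpace F] {R : ℝ}
    {φ : ℕ → ContDiffBump (0 : σ → ℝ)} {q : ℕ → MvPolynomial σ ℝ} (hq : IsPolyApproxIdentity R φ q)
    {g : (σ → ℝ) → F} (hg : Continuous g) (hgc : HasCompactSupport g)
    (hgR : ∀ x, g x ≠ 0 → x ∈ Metric.ball (0 : σ → ℝ) R) {x : σ → ℝ}
    (hx : x ∈ Metric.ball (0 : σ → ℝ) R) :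
    Filter.Tendsto (fun p : ℕ × (σ → ℝ) => ((fun y => MvPolynomial.eval y (q p.1))
      ⋆[ContinuousLinearMap.lsmul ℝ ℝ, volume] g) p.2) (Filter.atTop ×ˢ 𝓝 x) (𝓝 (g x)) := by
  have h1 : Filter.Tendsto (fun p : ℕ × (σ → ℝ) => ((φ p.1).normed volume
      ⋆[ContinuousLinearMap.lsmul ℝ ℝ, volume] g) p.2) (Filter.atTop ×ˢ 𝓝 x) (𝓝 (g x)) :=
    ContDiffBump.convolution_tendsto_right (φ := fun p : ℕ × (σ → ℝ) => φ p.1)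
      (g := fun _ => g) (hq.tendsto.comp Filter.tendsto_fst)
      (Filter.Eventually.of_forall fun _ => hg.aestronglyMeasurable)
      ((hg.tendsto x).comp Filter.tendsto_snd) Filter.tendsto_snd
  have h2 : Filter.Tendsto (fun p : ℕ × (σ → ℝ) => ((fun y => MvPolynomial.eval y (q p.1))
      ⋆[ContinuousLinearMap.lsmul ℝ ℝ, volume] g) p.2 - ((φ p.1).normed volume
      ⋆[ContinuousLinearMap.lsmul ℝ ℝ, volume] g) p.2) (Filter.atTop ×ˢ 𝓝 x) (𝓝 0) := by
    have h3 : Filter.Tendsto (fun p : ℕ × (σ → ℝ) => 1 / ((p.1 : ℝ) + 1) * ∫ t, ‖g t‖)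
        (Filter.atTop ×ˢ 𝓝 x) (𝓝 0) := by
      have := (tendsto_one_div_add_atTop_nhds_zero_nat (𝕜 := ℝ)).comp
        (Filter.tendsto_fst (f := Filter.atTop) (g := 𝓝 x))
      simpa using this.mul_const (∫ t, ‖g t‖)
    refine squeeze_zero_norm' ?_ h3
    filter_upwards [Filter.tendsto_snd.eventually (Metric.isOpen_ball.mem_nhds hx)] with p hp
    have e1 := hgc.convolutionExists_right (ContinuousLinearMap.lsmul ℝ ℝ) (μ := volume)
      (MvPolynomial.continuous_eval (q p.1)).locallyIntegrable hg p.2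
    have e2 := hgc.convolutionExists_right (ContinuousLinearMap.lsmul ℝ ℝ) (μ := volume)
      ((φ p.1).continuous_normed (μ := volume)).locallyIntegrable hg p.2
    rw [convolution_def, convolution_def, ← integral_sub e1.integrable e2.integrable]
    have hgi : Integrable fun t => ‖g (p.2 - t)‖ :=
      (hg.integrable_of_hasCompactSupport hgc).norm.comp_sub_left p.2
    rw [← integral_sub_left_eq_self (fun t => ‖g t‖) volume p.2, ← integral_const_mul]
    refine norm_integral_le_of_norm_le (hgi.const_mul _) (Filter.Eventually.of_forall fun t => ?_)
    simp only [ContinuousLinearMap.lsmul_apply]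
    rw [← sub_smul, norm_smul]
    by_cases hgt : g (p.2 - t) = 0
    · simp [hgt]
    have h4 := hgR _ hgt
    rw [mem_ball_zero_iff] at h4
    rw [dist_zero_right] at hp
    -- Both `p.2` and `p.2 - t` lie in the ball of radius `R`, so `t` has norm at most `2 * R`,
    -- where the polynomial is close to the bump.
    refine mul_le_mul_of_nonneg_right (hq.near p.1 t ?_).le (norm_nonneg _)
    rw [mem_closedBall_zero_iff]
    have : t = p.2 - (p.2 - t) := by abel
    rw [this]
    exact (norm_sub_le _ _).trans (by linarith)
  simpa using h2.add h1

/-- Derivatives of the convolution fall on `g`, and `fderiv ℝ g` is again smooth with support in the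
same ball, so the uniform statement applies to each order in turn. -/
theorem IsPolyApproxIdentity.tendstoSmoothlyAt [CompleteSpace F] {R : ℝ}
    {φ : ℕ → ContDiffBump (0 : σ → ℝ)} {q : ℕ → MvPolynomial σ ℝ} (hq : IsPolyApproxIdentity R φ q)
    {g : (σ → ℝ) → F} (hg : ContDiff ℝ ∞ g) (hgc : HasCompactSupport g)
    (hgR : tsupport g ⊆ Metric.ball (0 : σ → ℝ) R) {x : σ → ℝ}
    (hx : x ∈ Metric.ball (0 : σ → ℝ) R) (k : ℕ) :
    TendstoSmoothlyAt Filter.atTop x k (fun i => ((fun y => MvPolynomial.eval y (q i))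
      ⋆[ContinuousLinearMap.lsmul ℝ ℝ, volume] g)) g := by
  have h0 := hq.tendsto_convolution hg.continuous hgc
    (fun y hy => hgR (subset_tsupport g hy)) hx
  induction k generalizing F with
  | zero => exact h0
  | succ k ih =>
    have hd := fun i => fderiv_lsmul_convolution (MvPolynomial.continuous_eval (q i))
      (hg.of_le (by simp)) hgc
    refine ⟨h0, ⟨Filter.Eventually.of_forall fun p => (hd p.1).1 p.2,
      Filter.Eventually.of_forall fun y => hg.differentiable (by simp) y⟩, ?_⟩
    simp only [fun i => (hd i).2]
    have h1 : ContDiff ℝ ∞ (fderiv ℝ g) := hg.fderiv_right (by simp)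
    have h2 := (tsupport_fderiv_subset ℝ (f := g)).trans hgR
    exact ih h1 (hgc.fderiv ℝ) h2 (hq.tendsto_convolution h1.continuous (hgc.fderiv ℝ)
      (fun y hy => h2 (subset_tsupport _ hy)) hx)

/-- Polynomial maps approximate a compactly supported smooth map, with all its derivatives. -/
theorem exists_mvPolynomial_tendstoSmoothlyAt {τ : Type w} [Fintype τ] {g : (σ → ℝ) → τ → ℝ}
    (hg : ContDiff ℝ ∞ g) (hgc : HasCompactSupport g) {R : ℝ}
    (hgR : tsupport g ⊆ Metric.ball (0 : σ → ℝ) R) :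
    ∃ P : ℕ → τ → MvPolynomial σ ℝ, ∀ x ∈ Metric.ball (0 : σ → ℝ) R, ∀ k,
      TendstoSmoothlyAt Filter.atTop x k (fun i y j => MvPolynomial.eval y (P i j)) g := by
  obtain ⟨φ, q, hq⟩ := exists_isPolyApproxIdentity (σ := σ) R
  have hgj : ∀ j, Continuous fun x => g x j := fun j =>
    (continuous_apply j).comp hg.continuous
  have hgcj : ∀ j, HasCompactSupport fun x => g x j := fun j =>
    hgc.comp_left (g := fun v : τ → ℝ => v j) rfl
  choose P hP using fun i j => exists_eval_eq_integral (q i) (hgj j) (hgcj j)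
  refine ⟨P, fun x hx k => ?_⟩
  have heq : (fun i y j => MvPolynomial.eval y (P i j)) = fun i =>
      ((fun y => MvPolynomial.eval y (q i)) ⋆[ContinuousLinearMap.lsmul ℝ ℝ, volume] g) := by
    funext i y j
    rw [hP, convolution_lsmul_swap, eval_integral]
    · rfl
    · intro j
      exact Continuous.integrable_of_hasCompactSupport
        (((MvPolynomial.continuous_eval (q i)).comp (by fun_prop)).mul (hgj j)) (hgcj j).mul_left
  rw [heq]
  exact hq.tendstoSmoothlyAt hg hgc hgR hx k

end SmoothWeierstrass

end RealAlg

namespace RealAlg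

/-! ### Smooth charts of nonsingular algebraic sets. -/

section Charts

variable {σ : Type*} [Fintype σ] {V O : Set (σ → ℝ)} {r : (σ → ℝ) → σ → ℝ}

/-- A nonsingular algebraic set has smooth charts around all of its points. -/
theorem IsSmoothRetraction.exists_smoothChart (hr : IsSmoothRetraction V O r) (y₀ : V) :
    ∃ (d : ℕ) (φ : SmoothChart V d), y₀ ∈ φ.toHomeo.source := by
  classical
  set D := fderiv ℝ r y₀ with hD
  let T : Submodule ℝ (σ → ℝ) := LinearMap.range (D : (σ → ℝ) →ₗ[ℝ] (σ → ℝ))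
  let d := Module.finrank ℝ T
  let b : T ≃L[ℝ] (Fin d → ℝ) := ContinuousLinearEquiv.ofFinrankEq (by simp [d])
  let Λ : (σ → ℝ) →L[ℝ] (Fin d → ℝ) :=
    b.toContinuousLinearMap.comp (D.codRestrict T fun v => ⟨v, rfl⟩)
  have hΛ : ∀ v, Λ v = b ⟨D v, ⟨v, rfl⟩⟩ := fun v => rfl
  have hΛ0 : ∀ v, Λ v = 0 → D v = 0 := fun v hv => by
    rw [hΛ, map_eq_zero_iff _ b.injective] at hv
    exact congrArg Subtype.val hv
  let c : (Fin d → ℝ) →L[ℝ] (σ → ℝ) := T.subtypeL.comp b.symm.toContinuousLinearMap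
  have hΛc : ∀ u, Λ (D (c u)) = u := fun u => by
    have hcT : c u ∈ T := (b.symm u).2
    obtain ⟨v, hv⟩ := hcT
    have hDc : D (D (c u)) = c u := by
      rw [← hv]
      exact (congrArg D (hr.fderiv_fderiv y₀.2 v)).trans (hr.fderiv_fderiv y₀.2 v)
    rw [hΛ]
    have : (⟨D (D (c u)), ⟨D (c u), rfl⟩⟩ : T) = b.symm u := Subtype.ext hDc
    rw [this, b.apply_symm_apply]
  let j : (Fin d → ℝ) → σ → ℝ := fun u => r (y₀ + c u)
  let B : Set (Fin d → ℝ) := (fun u => (y₀ : σ → ℝ) + c u) ⁻¹' O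
  have hB : IsOpen B := hr.isOpen.preimage (by fun_prop)
  have h0B : (0 : Fin d → ℝ) ∈ B := by
    change (y₀ : σ → ℝ) + c 0 ∈ O
    simpa using hr.subset y₀.2
  have hj : ContDiffOn ℝ ∞ j B :=
    hr.contDiffOn.comp (contDiff_const.add c.contDiff).contDiffOn fun u hu => hu
  have hjV : ∀ u ∈ B, j u ∈ V := fun u hu => hr.mapsTo hu
  have hj0 : j 0 = y₀ := by simp [j, hr.apply_eq _ y₀.2]
  -- The chart is `y ↦ Λ (y - y₀)`, the tangential coordinates, with inverse `j ∘ h⁻¹`; since `Λ D c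
  -- = id`, the derivative of `h` at `0` is the identity.
  let h : (Fin d → ℝ) → (Fin d → ℝ) := fun u => Λ (j u - y₀)
  have hh : ContDiffOn ℝ ∞ h B := Λ.contDiff.comp_contDiffOn (hj.sub contDiffOn_const)
  have hh' : HasFDerivAt h ((ContinuousLinearEquiv.refl ℝ (Fin d → ℝ) :
      (Fin d → ℝ) ≃L[ℝ] (Fin d → ℝ)) : (Fin d → ℝ) →L[ℝ] (Fin d → ℝ)) 0 := by
    have h1 : HasFDerivAt (fun u => (y₀ : σ → ℝ) + c u) c 0 := c.hasFDerivAt.const_add _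
    have h2 : HasFDerivAt r D ((fun u => (y₀ : σ → ℝ) + c u) 0) := by
      simpa using (hr.hasStrictFDerivAt y₀.2).hasFDerivAt
    have h3 : HasFDerivAt h (Λ.comp (D.comp c)) 0 :=
      Λ.hasFDerivAt.comp (0 : Fin d → ℝ) ((h2.comp (0 : Fin d → ℝ) h1).sub_const (y₀ : σ → ℝ))
    convert h3
    ext1 u
    exact (hΛc u).symm
  obtain ⟨e, he0, heB, heh, hes⟩ := exists_smooth_local_inverse hB hh h0B hh'
  have hh0 : h 0 = 0 := by simp [h, hj0]
  -- On `W` a point of `V` is determined by its tangential coordinates; this yields the left inverse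
  -- property.
  obtain ⟨W, hW, hWo, hyW⟩ : ∃ W : Set (σ → ℝ), (∀ z ∈ W, ∀ z' ∈ W, z ∈ V → z' ∈ V →
      D (z - z') = 0 → z = z') ∧ IsOpen W ∧ (y₀ : σ → ℝ) ∈ W := by
    have h1 := hr.eventually_eq_of_fderiv_sub_eq_zero y₀.2
    obtain ⟨ε, hε, h2⟩ := Metric.eventually_nhds_iff_ball.1 h1
    refine ⟨Metric.ball y₀ ε, fun z hz z' hz' hzV hzV' hd => ?_, Metric.isOpen_ball,
      Metric.mem_ball_self hε⟩
    refine h2 ((y₀ : σ → ℝ), z, z') ?_ hzV hzV' hd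
    rw [← ball_prod_same, ← ball_prod_same]
    exact ⟨Metric.mem_ball_self hε, hz, hz'⟩
  have hsymmB : ∀ u ∈ e.target, e.symm u ∈ B := fun u hu => heB (e.map_target hu)
  have hje : ContDiffOn ℝ ∞ (fun u => j (e.symm u)) e.target := hj.comp hes hsymmB
  let T' : Set (Fin d → ℝ) := e.target ∩ (fun u => j (e.symm u)) ⁻¹' W
  have hT' : IsOpen T' := hje.continuousOn.isOpen_inter_preimage e.open_target hWo
  let inv : (Fin d → ℝ) → V := fun u => if hu : j (e.symm u) ∈ V then ⟨j (e.symm u), hu⟩ else y₀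
  have hinv : ∀ u ∈ e.target, (inv u : σ → ℝ) = j (e.symm u) := fun u hu => by
    simp only [inv, dif_pos (hjV _ (hsymmB u hu))]
  have hΛcont : Continuous fun y : V => Λ (y - y₀) := by fun_prop
  have hright : ∀ u ∈ T', Λ (inv u - y₀) = u := fun u hu => by
    rw [hinv u hu.1]
    exact (heh _).symm.trans (e.right_inv hu.1)
  let Φ : OpenPartialHomeomorph V (Fin d → ℝ) :=
    { toFun := fun y => Λ (y - y₀)
      invFun := inv
      source := {y | (y : σ → ℝ) ∈ W ∧ Λ (y - y₀) ∈ T'}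
      target := T'
      map_source' := fun y hy => hy.2
      map_target' := fun u hu => by
        refine ⟨?_, ?_⟩
        · rw [hinv u hu.1]
          exact hu.2
        · rw [hright u hu]
          exact hu
      left_inv' := fun y hy => by
        refine Subtype.ext (hW _ ?_ _ hy.1 (inv _).2 y.2 (hΛ0 _ ?_))
        · rw [hinv _ hy.2.1]
          exact hy.2.2
        · have h1 := hright _ hy.2
          rw [show (inv (Λ (y - y₀)) : σ → ℝ) - y =
            (inv (Λ (y - y₀)) - y₀) - (y - y₀) by abel, map_sub, h1, sub_self]
      right_inv' := hright
      open_source := (hWo.preimage continuous_subtype_val).inter (hT'.preimage hΛcont)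
      open_target := hT'
      continuousOn_toFun := hΛcont.continuousOn
      continuousOn_invFun := by
        refine continuousOn_iff_continuous_domRestrict.2 (continuous_induced_rng.2 ?_)
        refine (continuousOn_iff_continuous_domRestrict.1
          (hje.continuousOn.mono Set.inter_subset_left)).congr fun u => ?_
        exact (hinv u u.2.1).symm }
  refine ⟨d, ⟨Φ, fun x hx => ⟨Set.univ, fun y => Λ (y - y₀), isOpen_univ, trivial, ?_,
    fun y _ _ => rfl⟩, ?_⟩, ?_⟩
  · exact (Λ.contDiff.comp (contDiff_id.sub contDiff_const)).contDiffOn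
  · exact (hje.mono Set.inter_subset_left).congr fun u hu => hinv u hu.1
  · have h0t : (0 : Fin d → ℝ) ∈ e.target := by
      have := e.map_source he0
      rwa [heh, hh0] at this
    have hsymm0 : e.symm 0 = 0 := by
      have := e.left_inv he0
      rwa [heh, hh0] at this
    refine ⟨hyW, ?_⟩
    rw [sub_self, map_zero]
    refine ⟨h0t, ?_⟩
    change j (e.symm 0) ∈ W
    rw [hsymm0, hj0]
    exact hyW

end Charts

end RealAlg

namespace RealAlg

/-! ### Uniform approximation along a homotopy. -/

section Continuous

variable {σ τ : Type*} [Fintype σ] [Fintype τ] {X : Set (σ → ℝ)} {Y : Set (τ → ℝ)}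

/-- A regular map as a map of class `C^∞`. -/
def IsRegularMap.toSmoothMap {g : X → Y} (hg : IsRegularMap g) : SmoothMap X Y :=
  ⟨g, IsRegularFun.isSmoothOn hg⟩

theorem IsRegularMap.continuous {g : X → Y} (hg : IsRegularMap g) : Continuous g :=
  hg.toSmoothMap.continuous_toFun

omit [Fintype σ] [Fintype τ] in
theorem isRegularFun_eval (P : τ → MvPolynomial σ ℝ) :
    IsRegularFun fun (x : X) j => MvPolynomial.eval (x : σ → ℝ) (P j) :=
  fun j x => regularAt_eval (P j) x

theorem IsTrivialSpray.continuous {M : ℕ} {S : Y → (Fin M → ℝ) → Y} (hS : IsTrivialSpray S) :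
    Continuous fun p : Y × (Fin M → ℝ) => S p.1 p.2 := by
  have h : Continuous fun p : Y × (Fin M → ℝ) =>
      (⟨Sum.elim (p.1 : τ → ℝ) p.2, p.1.2⟩ : prodAffine Y M) := by
    refine Continuous.subtype_mk (continuous_pi ?_) _
    rintro (i | i)
    · exact (continuous_apply i).comp (continuous_subtype_val.comp continuous_fst)
    · exact (continuous_apply i).comp continuous_snd
  exact hS.regular.continuous.comp h

/-- Points close to the diagonal of a compact set `L` lie in a given neighborhood of it. -/
theorem exists_forall_dist_lt_mem {α : Type*} [PseudoMetricSpace α] {L : Set α} (hL : IsCompact L)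
    {Ω : Set (α × α)} (hΩ : IsOpen Ω) (h : ∀ y ∈ L, (y, y) ∈ Ω) :
    ∃ δ > 0, ∀ c ∈ L, ∀ a b, dist a c < δ → dist b c < δ → (a, b) ∈ Ω := by
  obtain ⟨δ, hδ, hs⟩ := (hL.image (f := fun y => (y, y)) (by fun_prop)).exists_thickening_subset_open
    hΩ (Set.image_subset_iff.2 h)
  exact ⟨δ, hδ, fun c hc a b ha hb => hs (Metric.mem_thickening_iff.2
    ⟨(c, c), ⟨c, hc, rfl⟩, max_lt ha hb⟩)⟩

/-- A continuous map close to a regular map is a limit of regular maps on compact sets. -/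
theorem IsTrivialSpray.exists_isRegularMap_dist_lt {M : ℕ} {S : Y → (Fin M → ℝ) → Y}
    (hS : IsTrivialSpray S) {Ω : Set ((τ → ℝ) × (τ → ℝ))}
    {ν : (τ → ℝ) × (τ → ℝ) → Fin M → ℝ} (hν : ContinuousOn ν Ω)
    (hSν : ∀ y z : Y, ((y : τ → ℝ), (z : τ → ℝ)) ∈ Ω → S y (ν (y, z)) = z) {K : Set X}
    (hK : IsCompact K) {g f : X → Y} (hg : IsRegularMap g) (hf : Continuous f)
    (hgf : ∀ x ∈ K, ((g x : τ → ℝ), (f x : τ → ℝ)) ∈ Ω) {ε : ℝ} (hε : 0 < ε) :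
    ∃ g' : X → Y, IsRegularMap g' ∧ ∀ x ∈ K, dist (g' x) (f x) < ε := by
  let ξ : X → Fin M → ℝ := fun x => ν (g x, f x)
  have hξ : ContinuousOn ξ K := hν.comp (by have := hg.continuous; fun_prop) hgf
  -- The parameters with `S(g, ·)` within `ε` of `f` form an open set containing the compact graph
  -- of `ξ` over `K`, so it contains a uniform neighborhood of that graph.
  have hopen : IsOpen {p : X × (Fin M → ℝ) | dist (S (g p.1) p.2) (f p.1) < ε} := by
    refine isOpen_lt (Continuous.dist ?_ (hf.comp continuous_fst)) continuous_const
    exact hS.continuous.comp ((hg.continuous.comp continuous_fst).prodMk continuous_snd)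
  obtain ⟨δ, hδ, hs⟩ := (hK.image_of_continuousOn (f := fun x => (x, ξ x))
    (continuousOn_id.prodMk hξ)).exists_thickening_subset_open hopen (by
      rintro _ ⟨x, hx, rfl⟩
      simp only [Set.mem_ofPred_eq, ξ, hSν _ _ (hgf x hx), dist_self, hε])
  have := isCompact_iff_compactSpace.1 hK
  choose P hP using fun j => exists_mvPolynomial_near
    (⟨fun x : K => ((x : X) : σ → ℝ), by fun_prop⟩ : C(K, σ → ℝ))
    (Subtype.val_injective.comp Subtype.val_injective)
    ⟨fun x : K => ξ x j, (continuous_apply j).comp (continuousOn_iff_continuous_domRestrict.1 hξ)⟩ hδ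
  refine ⟨_, hS.regular_comp hg (isRegularFun_eval P), fun x hx => ?_⟩
  refine hs (a := (x, fun j => MvPolynomial.eval (x : σ → ℝ) (P j)))
    (Metric.mem_thickening_iff.2 ⟨(x, ξ x), ⟨x, hx, rfl⟩, max_lt ?_ ?_⟩)
  · simpa using hδ
  · exact (dist_pi_lt_iff hδ).2 fun j => hP j ⟨x, hx⟩

/-- A continuous map homotopic to a regular map is a limit of regular maps on compact sets. -/
theorem exists_isRegularMap_dist_lt_of_homotopic {M : ℕ} {S : Y → (Fin M → ℝ) → Y}
    (hS : IsTrivialSpray S) {O : Set (τ → ℝ)} {r : (τ → ℝ) → τ → ℝ} (hr : IsSmoothRetraction Y O r)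
    {g f : C(X, Y)} (hg : IsRegularMap g) (hgf : g.Homotopic f) {K : Set X} (hK : IsCompact K)
    {ε : ℝ} (hε : 0 < ε) : ∃ g' : X → Y, IsRegularMap g' ∧ ∀ x ∈ K, dist (g' x) (f x) < ε := by
  obtain ⟨H⟩ := hgf
  let A : Set unitInterval := {t | ∀ ε > 0, ∃ g' : X → Y, IsRegularMap g' ∧
    ∀ x ∈ K, dist (g' x) (H (t, x)) < ε}
  -- Near `t₀`, membership of a single time in `A` passes to all the others, which shows at once
  -- that `A` is open and closed.
  have hloc : ∀ t₀, ∃ N ∈ 𝓝 t₀, ∀ t ∈ N, t ∈ A → ∀ s ∈ N, s ∈ A := by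
    intro t₀
    have hH : ∀ t, Continuous fun x => H (t, x) := fun t => by fun_prop
    have hL : IsCompact ((fun x => (H (t₀, x) : τ → ℝ)) '' K) :=
      hK.image (continuous_subtype_val.comp (hH t₀))
    obtain ⟨Ω, ν, hΩ, hd, hν, hSν⟩ := hS.exists_inverse_near_diagonal hr hL
      (Set.image_subset_iff.2 fun x _ => (H (t₀, x)).2)
    obtain ⟨δ, hδ, hΩδ⟩ := exists_forall_dist_lt_mem hL hΩ hd
    -- A regular map `δ / 2`-close to `H(t, ·)` is then `δ`-close to `H(t₀, ·)`, where `ν` is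
    -- available.
    refine ⟨{t | ∀ x ∈ K, dist (H (t, x)) (H (t₀, x)) < δ / 2}, ?_, fun t ht htA s hs ε hε => ?_⟩
    · refine hK.eventually_forall_of_forall_eventually fun x _ => ?_
      have hc : Continuous fun z : unitInterval × X => dist (H (z.1, z.2)) (H (t₀, z.2)) :=
        H.continuous.dist (H.continuous.comp (continuous_const.prodMk continuous_snd))
      exact hc.continuousAt.eventually (gt_mem_nhds (by simpa using half_pos hδ))
    · obtain ⟨g', hg', hgt⟩ := htA (δ / 2) (half_pos hδ)
      refine hS.exists_isRegularMap_dist_lt hν.continuousOn hSν hK hg' (hH s)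
        (fun x hx => hΩδ _ ⟨x, hx, rfl⟩ _ _ ?_ ?_) hε
      · have h1 := dist_triangle (g' x) (H (t, x)) (H (t₀, x))
        have h2 := hgt x hx
        have h3 := ht x hx
        exact (show dist (g' x) (H (t₀, x)) < δ by linarith)
      · exact (hs x hx).trans (half_lt_self hδ)
  have hclopen : IsClopen A := by
    refine ⟨⟨isOpen_iff_mem_nhds.2 fun t₀ ht₀ => ?_⟩, isOpen_iff_mem_nhds.2 fun t₀ ht₀ => ?_⟩
    · obtain ⟨N, hN, h⟩ := hloc t₀
      exact Filter.mem_of_superset hN fun t ht htA => ht₀ (h t ht htA t₀ (mem_of_mem_nhds hN))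
    · obtain ⟨N, hN, h⟩ := hloc t₀
      exact Filter.mem_of_superset hN fun t ht => h t₀ (mem_of_mem_nhds hN) ht₀ t ht
  have h0 : (0 : unitInterval) ∈ A := fun ε hε => ⟨g, hg, fun x _ => by simpa using hε⟩
  have h1 : (1 : unitInterval) ∈ A := by
    rw [hclopen.eq_univ ⟨0, h0⟩]
    trivial
  simpa using h1 ε hε

end Continuous

/-! ### Comparison of the `C^∞` topology with uniform convergence on compact sets. -/

section Topology

variable {σ τ : Type*} [Fintype σ] [Fintype τ] {X : Set (σ → ℝ)} {Y : Set (τ → ℝ)}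

namespace SmoothMap

theorem basicNhd_mem_nhds (f : SmoothMap X Y) {d e : ℕ} (φ : SmoothChart X d)
    (ψ : SmoothChart Y e) {K : Set X} (r : ℕ) {ε : ℝ} (hK : IsCompact K)
    (hKφ : K ⊆ φ.toHomeo.source) (hKψ : Set.MapsTo f.toFun K ψ.toHomeo.source) (hε : 0 < ε) :
    f.basicNhd φ ψ K r ε ∈ 𝓝 f := by
  refine IsOpen.mem_nhds (TopologicalSpace.isOpen_generateFrom_of_mem
    ⟨f, d, e, φ, ψ, K, r, ε, hK, hKφ, hKψ, hε, rfl⟩) ⟨hKψ, fun k _ x _ => ?_⟩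
  simpa using hε

theorem dist_lt_of_mem_basicNhd {f g : SmoothMap X Y} {d e : ℕ} {φ : SmoothChart X d}
    {ψ : SmoothChart Y e} {K : Set X} {r : ℕ} {ε : ℝ} (hg : g ∈ f.basicNhd φ ψ K r ε) {x : X}
    (hx : x ∈ K) (hxφ : x ∈ φ.toHomeo.source) :
    dist (ψ.toHomeo (g.toFun x)) (ψ.toHomeo (f.toFun x)) < ε := by
  have h := hg.2 0 (Nat.zero_le _) x hx
  simp only [iteratedFDeriv_zero_eq_comp, Function.comp_apply, ← map_sub,
    LinearIsometryEquiv.norm_map, inCharts, φ.toHomeo.left_inv hxφ] at h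
  rwa [dist_comm, dist_eq_norm]

/-- The `C^∞` topology is finer than the compact-open topology. -/
theorem eventually_forall_mem (hX : ∀ x : X, ∃ (d : ℕ) (φ : SmoothChart X d), x ∈ φ.toHomeo.source)
    (hY : ∀ y : Y, ∃ (d : ℕ) (ψ : SmoothChart Y d), y ∈ ψ.toHomeo.source) (f : SmoothMap X Y)
    {K : Set X} (hK : IsCompact K) {Ω : Set (Y × Y)} (hΩ : IsOpen Ω)
    (h : ∀ x ∈ K, (f.toFun x, f.toFun x) ∈ Ω) :
    ∀ᶠ g in 𝓝 f, ∀ x ∈ K, (g.toFun x, f.toFun x) ∈ Ω := by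
  refine hK.induction_on (p := fun s => ∀ᶠ g : SmoothMap X Y in 𝓝 f,
    ∀ x ∈ s, (g.toFun x, f.toFun x) ∈ Ω) (by simp) (fun s t hst ht => ?_) (fun s t hs ht => ?_)
    fun x hx => ?_
  · exact ht.mono fun g hg x hx => hg x (hst hx)
  · filter_upwards [hs, ht] with g h1 h2 x hx using hx.elim (h1 x) (h2 x)
  · obtain ⟨d, φ, hφ⟩ := hX x
    obtain ⟨e, ψ, hψ⟩ := hY (f.toFun x)
    obtain ⟨C, hC, hCc, hCs⟩ := exists_mem_nhds_isClosed_subset (x := x)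
      (s := φ.toHomeo.source ∩ f.toFun ⁻¹' ψ.toHomeo.source)
      ((φ.toHomeo.open_source.inter (ψ.toHomeo.open_source.preimage f.continuous_toFun)).mem_nhds
        ⟨hφ, hψ⟩)
    have hKC : IsCompact (K ∩ C) := hK.inter_right hCc
    have hψC : ∀ y ∈ K ∩ C, f.toFun y ∈ ψ.toHomeo.source := fun y hy => (hCs hy.2).2
    -- `T` is `Ω` read in the chart `ψ`; only derivatives of order zero are needed to stay inside
    -- it.
    let T : Set ((Fin e → ℝ) × (Fin e → ℝ)) := ψ.toHomeo.target ×ˢ ψ.toHomeo.target ∩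
      (fun p => (ψ.toHomeo.symm p.1, ψ.toHomeo.symm p.2)) ⁻¹' Ω
    have hT : IsOpen T := by
      refine ContinuousOn.isOpen_inter_preimage ?_
        (ψ.toHomeo.open_target.prod ψ.toHomeo.open_target) hΩ
      exact ψ.toHomeo.continuousOn_symm.prodMap ψ.toHomeo.continuousOn_symm
    obtain ⟨δ, hδ, hTδ⟩ := exists_forall_dist_lt_mem
      (hKC.image_of_continuousOn (f := fun y => ψ.toHomeo (f.toFun y))
        (ψ.toHomeo.continuousOn.comp f.continuous_toFun.continuousOn hψC)) hT (by
          rintro _ ⟨y, hy, rfl⟩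
          refine ⟨⟨ψ.toHomeo.map_source (hψC y hy), ψ.toHomeo.map_source (hψC y hy)⟩, ?_⟩
          simp only [Set.mem_preimage, ψ.toHomeo.left_inv (hψC y hy)]
          exact h y hy.1)
    refine ⟨C ∩ K, Filter.inter_mem (mem_nhdsWithin_of_mem_nhds hC) self_mem_nhdsWithin, ?_⟩
    filter_upwards [f.basicNhd_mem_nhds φ ψ 0 hKC (fun y hy => (hCs hy.2).1) hψC hδ] with g hg y hy
    have hy' : y ∈ K ∩ C := hy.symm
    have := (hTδ _ ⟨y, hy', rfl⟩ _ (ψ.toHomeo (f.toFun y))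
      (dist_lt_of_mem_basicNhd hg hy' (hCs hy.1).1) (by simpa using hδ)).2
    simpa only [Set.mem_preimage, ψ.toHomeo.left_inv (hψC y hy'),
      ψ.toHomeo.left_inv (hg.1 hy')] using this

end SmoothMap

end Topology

end RealAlg

namespace RealAlg

/-! ### Smooth approximation, homotopy of nearby maps, and the conclusion. -/

section Approximation

variable {σ τ : Type} [Fintype σ] [Fintype τ] {X : Set (σ → ℝ)} {Y : Set (τ → ℝ)}

namespace SmoothChart

variable {d : ℕ} (φ : SmoothChart X d)

theorem exists_contDiffAt {x : X} (hx : x ∈ φ.toHomeo.source) :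
    ∃ H : (σ → ℝ) → (Fin d → ℝ), ContDiffAt ℝ ∞ H x ∧ ∀ᶠ z : X in 𝓝 x, φ.toHomeo z = H z := by
  obtain ⟨U, H, hU, hxU, hH, h⟩ := φ.smooth x hx
  refine ⟨H, hH.contDiffAt (hU.mem_nhds hxU), ?_⟩
  filter_upwards [φ.toHomeo.open_source.mem_nhds hx,
    continuous_subtype_val.continuousAt.preimage_mem_nhds (hU.mem_nhds hxU)] with z h1 h2
  exact (h z h1 h2).symm

theorem contDiffAt_symm {x : X} (hx : x ∈ φ.toHomeo.source) :
    ContDiffAt ℝ ∞ (fun u => (φ.toHomeo.symm u : σ → ℝ)) (φ.toHomeo x) :=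
  φ.smooth_symm.contDiffAt (φ.toHomeo.open_target.mem_nhds (φ.toHomeo.map_source hx))

theorem tendsto_symm {x : X} (hx : x ∈ φ.toHomeo.source) :
    Filter.Tendsto φ.toHomeo.symm (𝓝 (φ.toHomeo x)) (𝓝 x) := by
  have h := (φ.toHomeo.continuousAt_symm (φ.toHomeo.map_source hx)).tendsto
  rwa [φ.toHomeo.left_inv hx] at h

end SmoothChart

namespace SmoothMap

variable {d e : ℕ} {φ : SmoothChart X d} {ψ : SmoothChart Y e}

theorem inCharts_eventuallyEq {f : SmoothMap X Y} {x : X} (hx : x ∈ φ.toHomeo.source)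
    {F : (σ → ℝ) → τ → ℝ} (hF : ∀ᶠ y : X in 𝓝 x, F y = f.toFun y) {H : (τ → ℝ) → (Fin e → ℝ)}
    (hH : ∀ᶠ z : Y in 𝓝 (f.toFun x), ψ.toHomeo z = H z) :
    f.inCharts φ ψ =ᶠ[𝓝 (φ.toHomeo x)] fun u => H (F (φ.toHomeo.symm u)) := by
  have ht := φ.tendsto_symm hx
  filter_upwards [ht.eventually hF,
    ((f.continuous_toFun.tendsto x).comp ht).eventually hH] with u h1 h2
  rw [h1]
  exact h2

theorem contDiffAt_inCharts (f : SmoothMap X Y) {x : X} (hx : x ∈ φ.toHomeo.source)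
    (hfx : f.toFun x ∈ ψ.toHomeo.source) : ContDiffAt ℝ ∞ (f.inCharts φ ψ) (φ.toHomeo x) := by
  obtain ⟨H, hH, hψ⟩ := ψ.exists_contDiffAt hfx
  obtain ⟨U, F, hU, hxU, hF, h⟩ := f.smooth x (Set.mem_univ x)
  have hFe : ∀ᶠ y : X in 𝓝 x, F y = f.toFun y := by
    filter_upwards [continuous_subtype_val.continuousAt.preimage_mem_nhds (hU.mem_nhds hxU)]
      with y hy using h y (Set.mem_univ y) hy
  refine ContDiffAt.congr_of_eventuallyEq ?_ (inCharts_eventuallyEq hx hFe hψ)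
  have hF' : ContDiffAt ℝ ∞ F (φ.toHomeo.symm (φ.toHomeo x) : X) := by
    rw [φ.toHomeo.left_inv hx]
    exact hF.contDiffAt (hU.mem_nhds hxU)
  have h1 := hF'.comp (φ.toHomeo x) (φ.contDiffAt_symm hx)
  refine ContDiffAt.comp (φ.toHomeo x) (g := H) ?_ h1
  simp only [φ.toHomeo.left_inv hx, hFe.self_of_nhds]
  exact hH

/-- `C^∞` convergence of ambient extensions implies convergence in the `C^∞` topology. -/
theorem eventually_mem_basicNhd {ι : Type*} {l : Filter ι} {g : ι → SmoothMap X Y}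
    {f f₀ : SmoothMap X Y} {K : Set X} {k : ℕ} {ε : ℝ} (hK : IsCompact K)
    (hKφ : K ⊆ φ.toHomeo.source) (hf₀ : Set.MapsTo f₀.toFun K ψ.toHomeo.source)
    (hf : f ∈ f₀.basicNhd φ ψ K k ε) {G : ι → (σ → ℝ) → τ → ℝ} {F : (σ → ℝ) → τ → ℝ}
    (hG : ∀ i, ∀ y : X, G i y = (g i).toFun y) (hF : ∀ x ∈ K, ContDiffAt ℝ ∞ F x)
    (hFf : ∀ x ∈ K, ∀ᶠ y : X in 𝓝 x, F y = f.toFun y)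
    (h : ∀ x ∈ K, TendstoSmoothlyAt l (x : σ → ℝ) k G F) :
    ∀ᶠ i in l, g i ∈ f₀.basicNhd φ ψ K k ε := by
  have ht : ∀ x ∈ K, Filter.Tendsto (fun p : ι × X => (g p.1).toFun p.2) (l ×ˢ 𝓝 x)
      (𝓝 (f.toFun x)) := fun x hx => by
    refine tendsto_subtype_rng.2 ?_
    have h1 := (h x hx).tendsto.comp ((Filter.tendsto_id (x := l)).prodMap
      (continuous_subtype_val.tendsto x))
    rw [(hFf x hx).self_of_nhds] at h1
    exact h1.congr fun p => hG _ _
  have hmaps : ∀ᶠ i in l, Set.MapsTo (g i).toFun K ψ.toHomeo.source := by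
    have h1 : ∀ᶠ p : ι × X in l ×ˢ 𝓝ˢ K, (g p.1).toFun p.2 ∈ ψ.toHomeo.source :=
      hK.mem_prod_nhdsSet_of_forall fun x hx =>
        (ht x hx).eventually (ψ.toHomeo.open_source.mem_nhds (hf.1 hx))
    obtain ⟨a, ha, b, hb, hab⟩ := Filter.eventually_prod_iff.1 h1
    filter_upwards [ha] with i hi x hx
    exact hab hi (hb.self_of_nhdsSet x hx)
  have hconv : ∀ u ∈ φ.toHomeo '' K,
      TendstoSmoothlyAt l u k (fun i => (g i).inCharts φ ψ) (f.inCharts φ ψ) := by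
    rintro _ ⟨x, hx, rfl⟩
    have hxφ := hKφ hx
    obtain ⟨H, hH, hψ⟩ := ψ.exists_contDiffAt (hf.1 hx)
    have hinv : (φ.toHomeo.symm (φ.toHomeo x) : σ → ℝ) = x := by rw [φ.toHomeo.left_inv hxφ]
    have hFx := (hFf x hx).self_of_nhds
    have hF' : ContDiffAt ℝ ∞ F (φ.toHomeo.symm (φ.toHomeo x) : X) := by
      rw [hinv]
      exact hF x hx
    have hs := φ.contDiffAt_symm hxφ
    have h1 : TendstoSmoothlyAt l (φ.toHomeo x) k (fun i u => G i (φ.toHomeo.symm u))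
        (fun u => F (φ.toHomeo.symm u)) :=
      TendstoSmoothlyAt.comp_contDiffAt hs (by rw [hinv]; exact h x hx) hF'
    have h2 := TendstoSmoothlyAt.contDiffAt_comp (H := H) (by rw [hinv, hFx]; exact hH) h1
      (hF'.comp (φ.toHomeo x) hs)
    refine h2.congr ?_ (inCharts_eventuallyEq hxφ (hFf x hx) hψ)
    have h3 := ((ht x hx).comp ((Filter.tendsto_id (x := l)).prodMap (φ.tendsto_symm hxφ)))
    filter_upwards [h3.eventually hψ] with p hp
    rw [hG]
    exact hp
  have hfin := TendstoSmoothlyAt.eventually_norm_iteratedFDeriv_sub_lt (v₀ := f₀.inCharts φ ψ)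
    (hK.image_of_continuousOn (φ.toHomeo.continuousOn.mono hKφ))
    (by rintro _ ⟨x, hx, rfl⟩; exact f₀.contDiffAt_inCharts (hKφ hx) (hf₀ hx)) hconv
    (ε := ε) (by rintro j hj _ ⟨x, hx, rfl⟩; exact hf.2 j hj x hx)
  filter_upwards [hmaps, hfin] with i h1 h2
  exact ⟨h1, fun j hj x hx => h2 j hj _ ⟨x, hx, rfl⟩⟩

end SmoothMap

/-- A `C^∞` map that is close to a regular map on a compact set `K` is a limit of regular maps, with
all derivatives, on `K`. -/
theorem IsTrivialSpray.exists_tendstoSmoothlyAt {M : ℕ} {S : Y → (Fin M → ℝ) → Y}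
    (hS : IsTrivialSpray S) {O : Set (σ → ℝ)} {r : (σ → ℝ) → σ → ℝ}
    (hr : IsSmoothRetraction X O r) {Ω : Set ((τ → ℝ) × (τ → ℝ))} (hΩ : IsOpen Ω)
    {ν : (τ → ℝ) × (τ → ℝ) → Fin M → ℝ} (hν : ContDiffOn ℝ ∞ ν Ω)
    (hSν : ∀ y z : Y, ((y : τ → ℝ), (z : τ → ℝ)) ∈ Ω → S y (ν (y, z)) = z)
    {g : X → Y} (hg : IsRegularMap g) (f : SmoothMap X Y) {K : Set (σ → ℝ)} (hK : IsCompact K)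
    (hKX : K ⊆ X) (hgf : ∀ x : X, (x : σ → ℝ) ∈ K → ((g x : τ → ℝ), (f.toFun x : τ → ℝ)) ∈ Ω) :
    ∃ (g' : ℕ → X → Y) (G : ℕ → (σ → ℝ) → τ → ℝ) (F : (σ → ℝ) → τ → ℝ),
      (∀ i, IsRegularMap (g' i)) ∧ (∀ i, ∀ y : X, G i y = g' i y) ∧
      ∀ x : X, (x : σ → ℝ) ∈ K → ContDiffAt ℝ ∞ F x ∧ (∀ᶠ y : X in 𝓝 x, F y = f.toFun y) ∧
        ∀ k, TendstoSmoothlyAt Filter.atTop (x : σ → ℝ) k G F := by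
  let a : (σ → ℝ) → τ → ℝ := fun x => extendZero (fun y => (g y : τ → ℝ)) (r x)
  let b : (σ → ℝ) → τ → ℝ := fun x => extendZero (fun y => (f.toFun y : τ → ℝ)) (r x)
  have ha : ContDiffOn ℝ ∞ a O :=
    (IsRegularFun.isSmoothOn hg).contDiffOn_comp hr.isOpen hr.contDiffOn hr.mapsTo
  have hb : ContDiffOn ℝ ∞ b O := f.smooth.contDiffOn_comp hr.isOpen hr.contDiffOn hr.mapsTo
  have haX : ∀ x : X, a x = g x := fun x => by
    simp only [a, hr.apply_eq x x.2, extendZero_coe]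
  have hbX : ∀ x : X, b x = f.toFun x := fun x => by
    simp only [b, hr.apply_eq x x.2, extendZero_coe]
  have haY : Set.MapsTo a O Y := fun x hx => by
    simp only [a, extendZero_of_mem _ (hr.mapsTo hx), Subtype.coe_prop]
  let B : Set (σ → ℝ) := O ∩ (fun x => (a x, b x)) ⁻¹' Ω
  have hB : IsOpen B :=
    (ha.continuousOn.prodMk hb.continuousOn).isOpen_inter_preimage hr.isOpen hΩ
  have hKB : K ⊆ B := fun x hx => ⟨hr.subset (hKX hx), by
    have h := hgf ⟨x, hKX hx⟩ hx
    rw [← haX, ← hbX] at h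
    exact h⟩
  have hξ : ContDiffOn ℝ ∞ (fun x => ν (a x, b x)) B :=
    hν.comp ((ha.prodMk hb).mono Set.inter_subset_left) fun x hx => hx.2
  obtain ⟨C, hC, hKC, hCB⟩ := exists_compact_between hK hB hKB
  obtain ⟨χ, hχ1, hχ0, -⟩ := exists_contMDiffMap_one_nhds_of_subset_interior (n := (⊤ : ℕ∞))
    (modelWithCornersSelf ℝ (σ → ℝ)) hK.isClosed hKC
  have hχ : ContDiff ℝ ∞ χ := χ.contMDiff.contDiff
  have hχC : tsupport χ ⊆ C := closure_minimal
    (fun x hx => by_contra fun h => hx (hχ0 x h)) hC.isClosed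
  -- The cutoff makes the spray parameter a compactly supported smooth map on the ambient space; as
  -- `χ = 1` near `K`, it still reproduces `f` there.
  let θ : (σ → ℝ) → Fin M → ℝ := fun x => χ x • ν (a x, b x)
  have hθC : tsupport θ ⊆ C := (closure_mono (Function.support_smul_subset_left _ _)).trans hχC
  have hθ : ContDiff ℝ ∞ θ := by
    refine contDiff_iff_contDiffAt.2 fun x => ?_
    by_cases hx : x ∈ B
    · exact hχ.contDiffAt.smul (hξ.contDiffAt (hB.mem_nhds hx))
    · refine contDiffAt_const (c := (0 : Fin M → ℝ)) |>.congr_of_eventuallyEq ?_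
      exact notMem_tsupport_iff_eventuallyEq.1 fun h => hx (hCB (hθC h))
  have hθc : HasCompactSupport θ := HasCompactSupport.intro' hC hC.isClosed fun x hx => by
    simp only [θ, hχ0 x hx, zero_smul]
  obtain ⟨R, hR⟩ := (hC.union hK).isBounded.subset_ball 0
  obtain ⟨P, hP⟩ := exists_mvPolynomial_tendstoSmoothlyAt hθ hθc
    (hθC.trans (Set.subset_union_left.trans hR))
  let W : (σ → ℝ) × (Fin M → ℝ) → τ → ℝ := fun p =>
    extendZero (fun y => (S y p.2 : τ → ℝ)) (a p.1)
  have hW : ContDiffOn ℝ ∞ W (Prod.fst ⁻¹' O) :=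
    hS.contDiffOn_comp (hr.isOpen.preimage continuous_fst)
      (ha.comp contDiffOn_fst fun _ h => h) contDiffOn_snd fun _ h => haY h
  have hWX : ∀ (x : X) v, W (x, v) = S (g x) v := fun x v => by
    simp only [W, haX, extendZero_coe]
  have hWat : ∀ x : X, ∀ v, ContDiffAt ℝ ∞ W ((x : σ → ℝ), v) := fun x v =>
    hW.contDiffAt ((hr.isOpen.preimage continuous_fst).mem_nhds (hr.subset x.2))
  refine ⟨fun i x => S (g x) fun j => MvPolynomial.eval (x : σ → ℝ) (P i j),
    fun i x => W (x, fun j => MvPolynomial.eval x (P i j)), fun x => W (x, θ x),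
    fun i => hS.regular_comp hg (isRegularFun_eval (P i)), fun i y => hWX _ _, fun x hx => ?_⟩
  have hid : ContDiffAt ℝ ∞ (fun y : σ → ℝ => (y, θ y)) x :=
    contDiffAt_id.prodMk hθ.contDiffAt
  refine ⟨ContDiffAt.comp (x : σ → ℝ) (g := W) (hWat x _) hid, ?_, fun k => ?_⟩
  · have h1 := continuous_subtype_val.continuousAt.eventually
      (Filter.Eventually.filter_mono (nhds_le_nhdsSet hx) hχ1)
    filter_upwards [h1, continuous_subtype_val.continuousAt.preimage_mem_nhds
      (hB.mem_nhds (hKB hx))] with y hy hyB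
    have hyΩ : ((g y : τ → ℝ), (f.toFun y : τ → ℝ)) ∈ Ω := by
      rw [← haX, ← hbX]
      exact hyB.2
    rw [hWX]
    simp only [θ, hy, one_smul, haX, hbX, hSν _ _ hyΩ]
  · exact TendstoSmoothlyAt.contDiffAt_comp (hWat x _)
      ((TendstoSmoothlyAt.const contDiffAt_id).prodMk (hP x (hR (Or.inr hx)) k)) hid

/-- On each ball of integer radius there is a regular map close to `f`, hence a sequence of regular
maps converging to `f` there with all derivatives. Every compact subset of `X` lies in all
sufficiently large balls. -/
theorem exists_isRegularMap_mem_of_homotopic {M : ℕ} {S : Y → (Fin M → ℝ) → Y}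
    (hS : IsTrivialSpray S) (hX : IsClosed X) {O : Set (σ → ℝ)} {r : (σ → ℝ) → σ → ℝ}
    (hr : IsSmoothRetraction X O r) {O' : Set (τ → ℝ)} {r' : (τ → ℝ) → τ → ℝ}
    (hr' : IsSmoothRetraction Y O' r') {f : SmoothMap X Y} {g : C(X, Y)} (hg : IsRegularMap g)
    (hgf : g.Homotopic f.toContinuousMap) {U : Set (SmoothMap X Y)} (hU : U ∈ 𝓝 f) :
    ∃ g' ∈ U, IsRegularMap g'.toFun := by
  have key : ∀ R : ℕ, ∃ (g' : ℕ → X → Y) (G : ℕ → (σ → ℝ) → τ → ℝ) (F : (σ → ℝ) → τ → ℝ),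
      (∀ i, IsRegularMap (g' i)) ∧ (∀ i, ∀ y : X, G i y = g' i y) ∧
      ∀ x : X, (x : σ → ℝ) ∈ X ∩ Metric.closedBall 0 R → ContDiffAt ℝ ∞ F x ∧
        (∀ᶠ y : X in 𝓝 x, F y = f.toFun y) ∧
        ∀ k, TendstoSmoothlyAt Filter.atTop (x : σ → ℝ) k G F := by
    intro R
    have hK : IsCompact (X ∩ Metric.closedBall (0 : σ → ℝ) R) :=
      (isCompact_closedBall _ _).inter_left hX
    have hK' : IsCompact (Subtype.val ⁻¹' (X ∩ Metric.closedBall (0 : σ → ℝ) R) : Set X) :=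
      hX.isClosedEmbedding_subtypeVal.isCompact_preimage hK
    have hL := hK'.image (continuous_subtype_val.comp f.continuous_toFun)
    obtain ⟨Ω, ν, hΩ, hd, hν, hSν⟩ := hS.exists_inverse_near_diagonal hr' hL
      (Set.image_subset_iff.2 fun x _ => (f.toFun x).2)
    obtain ⟨δ, hδ, hΩδ⟩ := exists_forall_dist_lt_mem hL hΩ hd
    obtain ⟨g', hg', hgf'⟩ := exists_isRegularMap_dist_lt_of_homotopic hS hr' hg hgf hK' hδ
    exact hS.exists_tendstoSmoothlyAt hr hΩ hν hSν hg' f hK Set.inter_subset_left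
      fun x hx => hΩδ _ ⟨x, hx, rfl⟩ _ _ (hgf' x hx) (by simpa using hδ)
  choose g' G F hreg hG h using key
  -- The limit is iterated: for each large radius, the index of the sequence belonging to that
  -- radius goes to infinity. The filter `Filter.curry` expresses this order of quantifiers.
  have ht : Filter.Tendsto (fun p : ℕ × ℕ => (hreg p.1 p.2).toSmoothMap)
      (Filter.curry Filter.atTop Filter.atTop) (𝓝 f) := by
    refine TopologicalSpace.tendsto_nhds_generateFrom_iff.2 ?_
    rintro _ ⟨f₀, d, e, φ, ψ, K, k, ε, hK, hKφ, hf₀, -, rfl⟩ hf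
    obtain ⟨R, hR⟩ := (hK.image continuous_subtype_val).isBounded.subset_closedBall 0
    refine Filter.eventually_curry_iff.2 ?_
    filter_upwards [Filter.eventually_ge_atTop ⌈R⌉₊] with N hN
    have hx : ∀ x ∈ K, (x : σ → ℝ) ∈ X ∩ Metric.closedBall 0 N := fun x hx =>
      ⟨x.2, Metric.closedBall_subset_closedBall (Nat.ceil_le.1 hN) (hR ⟨x, hx, rfl⟩)⟩
    exact SmoothMap.eventually_mem_basicNhd hK hKφ hf₀ hf (hG N)
      (fun x hxK => (h N x (hx x hxK)).1) (fun x hxK => (h N x (hx x hxK)).2.1)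
      (fun x hxK => (h N x (hx x hxK)).2.2 k)
  obtain ⟨N, hN⟩ := (Filter.eventually_curry_iff.1 (ht.eventually hU)).exists
  obtain ⟨i, hi⟩ := hN.exists
  exact ⟨_, hi, hreg N i⟩

/-- Closeness is available only on a compact set `K`, so both maps are first precomposed with `κ`,
whose values lie in `K` and which is homotopic to the identity. -/
theorem eventually_homotopic {M : ℕ} {S : Y → (Fin M → ℝ) → Y}
    (hS : IsTrivialSpray S) (hX : IsAlgebraicSet X) {O : Set (σ → ℝ)} {r : (σ → ℝ) → σ → ℝ}
    (hr : IsSmoothRetraction X O r) {O' : Set (τ → ℝ)} {r' : (τ → ℝ) → τ → ℝ}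
    (hr' : IsSmoothRetraction Y O' r') (f : SmoothMap X Y) :
    ∀ᶠ g : SmoothMap X Y in 𝓝 f, f.toContinuousMap.Homotopic g.toContinuousMap := by
  obtain ⟨κ, R, hκ, hκR⟩ := exists_homotopic_id_bounded hX hr
  have hK : IsCompact {x : X | (x : σ → ℝ) ⬝ᵥ (x : σ → ℝ) ≤ R} := by
    refine hX.isClosed.isClosedEmbedding_subtypeVal.isCompact_preimage
      (K := {x : σ → ℝ | x ⬝ᵥ x ≤ R}) (Metric.isCompact_of_isClosed_isBounded
        (isClosed_le (continuous_id.dotProduct continuous_id) continuous_const) ?_)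
    refine (Metric.isBounded_closedBall (x := (0 : σ → ℝ)) (r := √R)).subset fun x hx => ?_
    rw [mem_closedBall_zero_iff]
    exact Real.le_sqrt_of_sq_le ((norm_sq_le_dotProduct_self x).trans hx)
  have hL := hK.image (continuous_subtype_val.comp f.continuous_toFun)
  obtain ⟨Ω, ν, hΩ, hd, hν, hSν⟩ := hS.exists_inverse_near_diagonal hr' hL
    (Set.image_subset_iff.2 fun x _ => (f.toFun x).2)
  filter_upwards [f.eventually_forall_mem hr.exists_smoothChart hr'.exists_smoothChart hK
    (hΩ.preimage (f := fun p : Y × Y => ((p.1 : τ → ℝ), (p.2 : τ → ℝ))) (by fun_prop))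
    fun x hx => hd _ ⟨x, hx, rfl⟩] with g hg
  have hgκ : (g.toContinuousMap.comp κ).Homotopic (f.toContinuousMap.comp κ) := by
    have hΩκ := fun x => hg (κ x) (hκR x)
    have hc : Continuous fun x => ν (g.toFun (κ x), f.toFun (κ x)) :=
      hν.continuousOn.comp_continuous
        ((continuous_subtype_val.comp (g.continuous_toFun.comp κ.continuous)).prodMk
          (continuous_subtype_val.comp (f.continuous_toFun.comp κ.continuous))) hΩκ
    -- The spray parameter is scaled from `0`, where `S` fixes the base point, to `ν`, where `S`
    -- reaches the value of `f`.
    refine ⟨⟨⟨fun p => S (g.toFun (κ p.2))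
      ((p.1 : ℝ) • ν (g.toFun (κ p.2), f.toFun (κ p.2))), ?_⟩, fun x => ?_, fun x => ?_⟩⟩
    · exact hS.continuous.comp ((g.continuous_toFun.comp (κ.continuous.comp continuous_snd)).prodMk
        ((continuous_subtype_val.comp continuous_fst).smul (hc.comp continuous_snd)))
    · simp [hS.zero, SmoothMap.toContinuousMap]
    · simpa [SmoothMap.toContinuousMap] using hSν _ _ (hΩκ x)
  have hcomp : ∀ h : C(X, Y), h.Homotopic (h.comp κ) := fun h => by
    simpa using (ContinuousMap.Homotopic.refl h).comp hκ
  exact ((hcomp _).trans hgκ.symm).trans (hcomp _).symm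

end Approximation

end RealAlg

theorem theorem4p2 {n m : ℕ} (X : Set (Fin n → ℝ)) (Y : Set (Fin m → ℝ))
    (hX : IsAlgebraicSet X) (hXns : IsNonsingular X)
    (hY : IsAlgebraicSet Y) (hYns : IsNonsingular Y) (hYmal : IsMalleable Y)
    (f : SmoothMap X Y) :
    (∀ U ∈ 𝓝 f, ∃ g ∈ U, IsRegularMap g.toFun) ↔
      ∃ g : C(X, Y), IsRegularMap g ∧ f.toContinuousMap.Homotopic g := by
  obtain ⟨O, r, hr⟩ := exists_isSmoothRetraction hX hXns
  obtain ⟨O', r', hr'⟩ := exists_isSmoothRetraction hY hYns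
  obtain ⟨M, S, hS⟩ := hYmal.exists_isTrivialSpray
  constructor
  · intro h
    obtain ⟨g, hg, hreg⟩ := h _ (eventually_homotopic hS hX hr hr' f)
    exact ⟨g.toContinuousMap, hreg, hg⟩
  · rintro ⟨g, hreg, hg⟩ U hU
    exact exists_isRegularMap_mem_of_homotopic hS hX.isClosed hr hr' hreg hg.symm hU
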